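/- Let $Q$ be a smooth finite-dimensional manifold (Hausdorff, second countable). For a smooth manifold $M$, a \emph{discretization map on $M$} is a smooth map $R=(R^1,R^2)\colon U\to M\times M$ on an open neighbourhood $U\subset TM$ of the zero section such that, for all $x\in M$, $R(x,0)=(x,x)$ and $T_{0_x}R^2_x-T_{0_x}R^1_x=\mathrm{Id}_{T_xM}$, where $R^a_x$ is the restriction of $R^a$ to $U\cap T_xM$. Let $R_d\colon U\subset TQ\to Q\times Q$ be a discretization map on $Q$. Let $\omega_Q=-d\theta_Q$ be the canonical symplectic form of $T^*Q$, let $\alpha_Q\colon TT^*Q\to T^*TQ$, $(q,p,\dot q,\dot p)\mapsto(q,\dot q,\dot p,p)$, be the canonical diffeomorphism, let $\Phi\colon T^*Q\times T^*Q\to T^*(Q\times Q)$, $(q_0,p_0;q_1,p_1)\mapsto(q_0,q_1,-p_0,p_1)$, and let $\widehat{R_d}(v,\beta)=(R_d(v),\beta\circ(T_vR_d)^{-1})$ for $v\in U$ with $T_vR_d$ invertible and $\beta\in T_v^*TQ$. Put $R_d^{T^*}=\Phi^{-1}\circ\widehat{R_d}\circ\alpha_Q$, with values in $T^*Q\times T^*Q$;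 it is defined at those $X\in TT^*Q$ for which the base point $v$ of $\alpha_Q(X)$ lies in $U$ and $T_vR_d$ is invertible. Let $L\colon TQ\to\mathbb R$ be a smooth regular Lagrangian (its Hessian along the fibres of $TQ$ is non-degenerate everywhere), let $\mathcal FL\colon TQ\to T^*Q$ be its Legendre map (fibre derivative), $\Omega_L=(\mathcal FL)^*\omega_Q$ and $E_L(v)=\langle\mathcal FL(v),v\rangle-L(v)$. Then there is a unique vector field $\Gamma_L$ on $TQ$ with $i_{\Gamma_L}\Omega_L=dE_L$ (the Euler--Lagrange equations). Consider $$R_d^L=(\mathcal FL^{-1},\mathcal FL^{-1})\circ R_d^{T^*}\circ T\mathcal FL\colon W\to TQ\times TQ ,$$ where $W\subset TTQ$ is an open neighbourhood of the zero section which $T\mathcal FL$ maps into the domain of $R_d^{T^*}$ and, near each $w\in W$ with base point $v\in TQ$, $\mathcal FL^{-1}$ is a local inverse of the local diffeomorphism $\mathcal FL$ with $\mathcal FL^{-1}(\mathcal FL(v))=v$. Such $W$ and $R_d^L$ exist, and for every choice of them the following holds. (a) $R_d^L$ defines a symplectic numerical integrator of the Euler--Lagrange equations for $L$, through the scheme $$R_d^L\bigl(h\,\Gamma_L(y)\bigr)=(x_0,x_1),\qquad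 h\,\Gamma_L(y)\in W,\qquad\text{that is, } h\,\Gamma_L\bigl(\tau_{TQ}((R_d^L)^{-1}(x_0,x_1))\bigr)=(R_d^L)^{-1}(x_0,x_1),\quad y=\tau_{TQ}((R_d^L)^{-1}(x_0,x_1)).$$ Precisely: - (integrator) for every $x\in TQ$ there are $h_0>0$ and open neighbourhoods $V,N$ of $x$ in $TQ$ such that for $|h|<h_0$ and $x_0\in V$ the scheme has exactly one solution $(x_1,y)$ with $x_1\in TQ$ and $y\in N$; it depends smoothly on $(h,x_0)$, and the one-step map $x_1=\varphi_h(x_0)$ satisfies $\varphi_0(x_0)=x_0$ and $\frac{d}{dh}\big|_{h=0}\varphi_h(x_0)=\Gamma_L(x_0)$; - (symplecticity) for every $h\in\mathbb R$, if $\varphi\colon V\to TQ$ is a smooth map on an open set $V\subset TQ$ and $Y\colon V\to TQ$ is continuous, such that $h\,\Gamma_L(Y(x_0))\in W$ and $R_d^L(h\,\Gamma_L(Y(x_0)))=(x_0,\varphi(x_0))$ for all $x_0\in V$, then $\varphi^*\Omega_L=\Omega_L$ on $V$. (b) $R_d^L\colon W\to TQ\times TQ$ is a discretization map on $TQ$.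 -/

import Mathlib

open Set Filter Topology Bundle
open scoped Manifold ContDiff

noncomputable section

namespace DiscMap

section General

variable {E : Type*} [NormedAddCommGroup E] [NormedSpace ℝ E]
  {H : Type*} [TopologicalSpace H] (I : ModelWithCorners ℝ E H)
  {M : Type*} [TopologicalSpace M] [ChartedSpace H M]

/-- A discretization map on the manifold `M`, defined on an open neighbourhood `U` of the zero
section of `TM` (the values of `R` outside `U` are irrelevant).  In `rigidity`, `R` is restricted to
the fibre `T_xM`, which in Mathlib is the model space `E`, and the derivatives are taken at `0`;
since `R (x, 0) = (x, x)`, both of them are endomorphisms of `T_xM`. -/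
structure IsDiscretizationMap [IsManifold I 1 M]
    (U : Set (TangentBundle I M)) (R : TangentBundle I M → M × M) : Prop where
  isOpen : IsOpen U
  zero_mem : ∀ x : M, (⟨x, 0⟩ : TangentBundle I M) ∈ U
  smooth : ContMDiffOn I.tangent (I.prod I) ∞ R U
  map_zero : ∀ x : M, R ⟨x, 0⟩ = (x, x)
  rigidity : ∀ (x : M) (v : E),
    let D₁ : E →L[ℝ] E := mfderiv 𝓘(ℝ, E) I (fun u : E => (R ⟨x, u⟩).1) 0
    let D₂ : E →L[ℝ] E := mfderiv 𝓘(ℝ, E) I (fun u : E => (R ⟨x, u⟩).2) 0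
    D₂ v - D₁ v = v

/-- The cotangent space `T_x^*M`. -/
abbrev CotangentSpace (x : M) : Type _ := TangentSpace I x →L[ℝ] Trivial M ℝ x

variable (M) in
/-- The cotangent bundle `T^*M`, with Mathlib's topology and smooth structure on the bundle of
continuous linear maps from `TM` to the trivial line bundle. -/
abbrev CotangentBundle : Type _ :=
  TotalSpace (E →L[ℝ] ℝ) (fun x : M => TangentSpace I x →L[ℝ] Trivial M ℝ x)

/-- The model with corners of the manifold `T^*M`. -/
abbrev cotangentModel : ModelWithCorners ℝ (E × (E →L[ℝ] ℝ)) (ModelProd H (E →L[ℝ] ℝ)) :=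
  I.prod 𝓘(ℝ, E →L[ℝ] ℝ)

/-- The exterior derivative of a differential one-form `θ` on `M`, computed at `x` in the chart of
`M` around `x`: if `θ'` is the coordinate expression of `θ` and `u'`, `v'` those of `u`, `v`, then
`dθ (u, v) = D_{u'} θ' (v') - D_{v'} θ' (u')`. -/
def extDerivOneForm (θ : ∀ x : M, TangentSpace I x →L[ℝ] ℝ) (x : M)
    (u v : TangentSpace I x) : ℝ :=
  let θ' : E → (E →L[ℝ] ℝ) := fun y =>
    (θ ((extChartAt I x).symm y)).comp
      (mfderivWithin 𝓘(ℝ, E) I (extChartAt I x).symm (range I) y)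
  let Dθ' : E →L[ℝ] E →L[ℝ] ℝ := fderivWithin ℝ θ' (range I) (extChartAt I x x)
  let u' : E := mfderiv I 𝓘(ℝ, E) (extChartAt I x) x u
  let v' : E := mfderiv I 𝓘(ℝ, E) (extChartAt I x) x v
  Dθ' u' v' - Dθ' v' u'

variable [IsManifold I ∞ M]

/-- The Liouville one-form `θ_M` on `T^*M`: `θ_M(α)(X) = α (Tπ X)`. -/
def liouvilleForm (α : CotangentBundle I M) :
    TangentSpace (cotangentModel I) α →L[ℝ] ℝ :=
  ContinuousLinearMap.comp (α.2 : TangentSpace I α.1 →L[ℝ] ℝ)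
    (mfderiv (cotangentModel I) I (TotalSpace.proj : CotangentBundle I M → M) α)

/-- The canonical symplectic form `ω_M = - dθ_M` on `T^*M`. -/
def canonicalForm (α : CotangentBundle I M) (X Y : TangentSpace (cotangentModel I) α) : ℝ :=
  - extDerivOneForm (cotangentModel I) (liouvilleForm I (M := M)) α X Y

/-- The canonical diffeomorphism `α_M : TT^*M → T^*TM`, given in canonical coordinates by
`(q, p, q̇, ṗ) ↦ (q, q̇, ṗ, p)`.  Mathlib's tangent spaces `T_α T^*M = E × E^*` and `T_v TM = E × E`
consist of the components of tangent vectors in the preferred charts of `T^*M` at `α` and of `TM` at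
`v`; for `α` and `v` over the same point `q` these are the canonical charts induced by one and the
same chart of `M` around `q`, in which `α` and `v` themselves have components `p = α.2`, `q̇ = v.2`.
The covector with components `(ṗ, p)` is `(a, b) ↦ ṗ a + p b`. -/
def tulczyjew (X : TangentBundle (cotangentModel I) (CotangentBundle I M)) :
    CotangentBundle I.tangent (TangentBundle I M) :=
  let p : E →L[ℝ] ℝ := X.proj.2
  let X' : E × (E →L[ℝ] ℝ) := X.2
  let v : TangentBundle I M := ⟨X.proj.proj, X'.1⟩
  let β : E × E →L[ℝ] ℝ :=
    X'.2.comp (ContinuousLinearMap.fst ℝ E E) + p.comp (ContinuousLinearMap.snd ℝ E E)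
  ⟨v, β⟩

/-- The cotangent lift of (the inverse of) a local diffeomorphism `F : TM → M × M`,
`(v, β) ↦ (F v, β ∘ (T_v F)⁻¹)`, meaningful where `T_v F` is invertible. -/
def cotangentLift (F : TangentBundle I M → M × M)
    (β : CotangentBundle I.tangent (TangentBundle I M)) : CotangentBundle (I.prod I) (M × M) :=
  ⟨F β.proj, ContinuousLinearMap.comp (β.2 : TangentSpace I.tangent β.proj →L[ℝ] ℝ)
    (mfderiv I.tangent (I.prod I) F β.proj).inverse⟩

/-- The diffeomorphism `Φ⁻¹ : T^*(M × M) → T^*M × T^*M`,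
`(q₀, q₁, p₀, p₁) ↦ (q₀, -p₀; q₁, p₁)`. -/
def splitCotangent (β : CotangentBundle (I.prod I) (M × M)) :
    CotangentBundle I M × CotangentBundle I M :=
  let b : E × E →L[ℝ] ℝ := β.2
  let b₀ : E →L[ℝ] ℝ := b.comp (ContinuousLinearMap.inl ℝ E E)
  let b₁ : E →L[ℝ] ℝ := b.comp (ContinuousLinearMap.inr ℝ E E)
  (⟨β.proj.1, -b₀⟩, ⟨β.proj.2, b₁⟩)

/-- The lift `R_d^{T^*} = Φ⁻¹ ∘ R̂_d ∘ α_Q : TT^*Q → T^*Q × T^*Q` of a discretization map `R_d`. -/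
def cotangentDiscretization (Rd : TangentBundle I M → M × M)
    (X : TangentBundle (cotangentModel I) (CotangentBundle I M)) :
    CotangentBundle I M × CotangentBundle I M :=
  splitCotangent I (cotangentLift I Rd (tulczyjew I X))

/-- The set of `X` in `TT^*Q` at which `R_d^{T^*}` is defined, for `R_d` with domain `U`: the base
point `v` of `α_Q X` lies in `U`, and `T_v R_d` is invertible. -/
def cotangentDiscretizationDomain (U : Set (TangentBundle I M)) (Rd : TangentBundle I M → M × M) :
    Set (TangentBundle (cotangentModel I) (CotangentBundle I M)) :=
  {X | (tulczyjew I X).proj ∈ U ∧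
    (mfderiv I.tangent (I.prod I) Rd (tulczyjew I X).proj).IsInvertible}

/-- The Legendre map (fibre derivative) `FL : TQ → T^*Q` of a Lagrangian `L : TQ → ℝ`. -/
def legendre (L : TangentBundle I M → ℝ) (v : TangentBundle I M) : CotangentBundle I M :=
  let p : E →L[ℝ] ℝ := fderiv ℝ (fun u : E => L ⟨v.proj, u⟩) v.2
  ⟨v.proj, p⟩

/-- A smooth Lagrangian is regular if its Hessian along the fibres of `TQ` is everywhere
non-degenerate. -/
structure IsRegularLagrangian (L : TangentBundle I M → ℝ) : Prop where
  smooth : ContMDiff I.tangent 𝓘(ℝ, ℝ) ∞ L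
  nondegenerate : ∀ (q : M) (v a : E),
    (∀ b : E, fderiv ℝ (fderiv ℝ (fun u : E => L ⟨q, u⟩)) v a b = 0) → a = 0

/-- The energy `E_L(v) = ⟨FL(v), v⟩ - L(v)`. -/
def energy (L : TangentBundle I M → ℝ) (v : TangentBundle I M) : ℝ :=
  (legendre I L v).2 v.2 - L v

/-- The Lagrange two-form `Ω_L = (FL)^* ω_Q` on `TQ`. -/
def lagrangeForm (L : TangentBundle I M → ℝ) (v : TangentBundle I M)
    (X Y : TangentSpace I.tangent v) : ℝ :=
  canonicalForm I (legendre I L v)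
    (mfderiv I.tangent (cotangentModel I) (legendre I L) v X)
    (mfderiv I.tangent (cotangentModel I) (legendre I L) v Y)

/-- `Γ` is the Euler-Lagrange vector field of `L`, that is, `i_Γ Ω_L = dE_L`. -/
def IsEulerLagrangeField (L : TangentBundle I M → ℝ)
    (Γ : ∀ v : TangentBundle I M, TangentSpace I.tangent v) : Prop :=
  ∀ (v : TangentBundle I M) (X : TangentSpace I.tangent v),
    lagrangeForm I L v (Γ v) X = mfderiv I.tangent 𝓘(ℝ, ℝ) (energy I L) v X

/-- `R : W → TQ × TQ` is (a realization of) the map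
`R_d^L = (FL⁻¹, FL⁻¹) ∘ R_d^{T^*} ∘ TFL` on the open neighbourhood `W` of the zero section of `TTQ`.
As `FL` is only a local diffeomorphism, `FL⁻¹` means a local inverse: near each `w ∈ W`, `R` is the
above composition for one local inverse `FL⁻¹ = σ.symm` of `FL` which takes `FL(v)` to `v`, where
`v` is the base point of `w`. -/
structure IsLagrangianLift (L : TangentBundle I M → ℝ)
    (U : Set (TangentBundle I M)) (Rd : TangentBundle I M → M × M)
    (W : Set (TangentBundle I.tangent (TangentBundle I M)))
    (R : TangentBundle I.tangent (TangentBundle I M) →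
      TangentBundle I M × TangentBundle I M) : Prop where
  isOpen : IsOpen W
  zero_mem : ∀ v : TangentBundle I M,
    (⟨v, 0⟩ : TangentBundle I.tangent (TangentBundle I M)) ∈ W
  mem_domain : ∀ w ∈ W, tangentMap I.tangent (cotangentModel I) (legendre I L) w ∈
    cotangentDiscretizationDomain I U Rd
  eq_comp : ∀ w ∈ W, ∃ σ : OpenPartialHomeomorph (TangentBundle I M) (CotangentBundle I M),
    w.proj ∈ σ.source ∧ EqOn σ (legendre I L) σ.source ∧
    ∀ᶠ w' in 𝓝 w,
      let z := cotangentDiscretization I Rd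
        (tangentMap I.tangent (cotangentModel I) (legendre I L) w')
      z.1 ∈ σ.target ∧ z.2 ∈ σ.target ∧ R w' = (σ.symm z.1, σ.symm z.2)

end General

section Integrators

variable {E : Type*} [NormedAddCommGroup E] [NormedSpace ℝ E]
  {H : Type*} [TopologicalSpace H] (I : ModelWithCorners ℝ E H)
  {M : Type*} [TopologicalSpace M] [ChartedSpace H M]

/-- `(x₀, x₁)` satisfies, with auxiliary point `y`, the numerical scheme of step size `h` defined by
a map `R : W ⊆ TM → M × M` and a vector field `Γ` on `M`:
`h Γ(τ(R⁻¹(x₀, x₁))) = R⁻¹(x₀, x₁)`, with `y = τ(R⁻¹(x₀, x₁))`; in other words,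
`R(h Γ(y)) = (x₀, x₁)`. -/
def SchemeStep (Γ : ∀ x : M, TangentSpace I x) (W : Set (TangentBundle I M))
    (R : TangentBundle I M → M × M) (h : ℝ) (x₀ x₁ y : M) : Prop :=
  (⟨y, h • Γ y⟩ : TangentBundle I M) ∈ W ∧ R ⟨y, h • Γ y⟩ = (x₀, x₁)

/-- `φ` preserves the two-form `Ω` on `V`, that is, `φ^*Ω = Ω` on `V`. -/
def PreservesForm (Ω : ∀ x : M, TangentSpace I x → TangentSpace I x → ℝ)
    (V : Set M) (φ : M → M) : Prop :=
  ∀ x ∈ V, ∀ u w : TangentSpace I x,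
    Ω (φ x) (mfderiv I I φ x u) (mfderiv I I φ x w) = Ω x u w

/-- The scheme `R(h Γ(y)) = (x₀, x₁)` defines a numerical one-step integrator of `ẋ = Γ(x)`:
around every point `x` and for small `h`, it has, for `x₀ ∈ V`, exactly one solution `(x₁, y)` with
`y` near `x`; the solution depends smoothly on `(h, x₀)`, and the one-step map `x₁ = φ_h(x₀)` is
consistent with `ẋ = Γ(x)`, that is, `φ_0(x₀) = x₀` and `(d/dh) φ_h(x₀) = Γ(x₀)` at `h = 0`. -/
def IsIntegrator [IsManifold I 1 M] (Γ : ∀ x : M, TangentSpace I x)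
    (W : Set (TangentBundle I M)) (R : TangentBundle I M → M × M) : Prop :=
  ∀ x : M, ∃ h₀ : ℝ, 0 < h₀ ∧ ∃ V N : Set M, IsOpen V ∧ x ∈ V ∧ IsOpen N ∧ x ∈ N ∧
    ∃ φ Y : ℝ → M → M,
      ContMDiffOn (𝓘(ℝ, ℝ).prod I) I ∞ (fun z : ℝ × M => φ z.1 z.2) (Ioo (-h₀) h₀ ×ˢ V) ∧
      ContMDiffOn (𝓘(ℝ, ℝ).prod I) I ∞ (fun z : ℝ × M => Y z.1 z.2) (Ioo (-h₀) h₀ ×ˢ V) ∧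
      (∀ h ∈ Ioo (-h₀) h₀, ∀ x₀ ∈ V, ∀ x₁ y : M,
        (y ∈ N ∧ SchemeStep I Γ W R h x₀ x₁ y) ↔ (x₁ = φ h x₀ ∧ y = Y h x₀)) ∧
      ∀ x₀ ∈ V, tangentMap 𝓘(ℝ, ℝ) I (fun h : ℝ => φ h x₀) ⟨0, (1 : ℝ)⟩ =
        (⟨x₀, Γ x₀⟩ : TangentBundle I M)

/-- The scheme `R(h Γ(y)) = (x₀, x₁)` is symplectic for the two-form `Ω`: for every step size `h`,
every smooth one-step map `φ` on an open set `V` given by the scheme, with the auxiliary point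
`y = Y(x₀)` depending continuously on `x₀`, preserves `Ω`. -/
def IsSymplecticScheme (Ω : ∀ x : M, TangentSpace I x → TangentSpace I x → ℝ)
    (Γ : ∀ x : M, TangentSpace I x)
    (W : Set (TangentBundle I M)) (R : TangentBundle I M → M × M) [IsManifold I 1 M] : Prop :=
  ∀ (h : ℝ) (V : Set M) (φ Y : M → M), IsOpen V → ContMDiffOn I I ∞ φ V → ContinuousOn Y V →
    (∀ x₀ ∈ V, SchemeStep I Γ W R h x₀ (φ x₀) (Y x₀)) → PreservesForm I Ω V φ

end Integrators

end DiscMap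

end

/-!
The proof compares pullbacks of the Liouville forms `θ`. Covectors transform under the cotangent
lift in such a way that Liouville forms match, and the sign in `Φ` turns the form of `T^*(Q × Q)`
into a difference: with `R_d^{T^*} = (R¹, R²)`,
  `α_Q^* θ_{TQ} = (R²)^* θ_Q - (R¹)^* θ_Q`.
On the other hand, the Euler–Lagrange equations for `Γ_L` imply that `y ↦ α_Q(TFL(h Γ_L(y)))`
pulls `θ_{TQ}` back to the exact form `h dL`. Hence along
`y ↦ R_d^{T^*}(TFL(h Γ_L(y))) = (FL(x₀), FL(x₁))` the two pullbacks of `ω_Q` agree, which is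
`φ^* Ω_L = Ω_L` as soon as `y` is a smooth function of `x₀`. For `h ≠ 0` it is, because
`R_d(h y) = (τ(x₀), τ(x₁))` and `T R_d` is invertible at `h y`; for `h = 0` the map `φ` is the
identity.

The same comparison of symplectic forms, at a zero tangent vector, shows that `R_d^{T^*}` is itself
a discretization map, a property which is preserved under pulling back along the local
diffeomorphism `FL`. That a discretization map defines an integrator is the implicit function
theorem for the equation `R¹(h Γ(y)) = x₀` in the unknown `y`.
-/

noncomputable section

namespace DiscMap

/-! ### Derivatives and changes of coordinates -/

section ModelDeriv

variable {E : Type*} [NormedAddCommGroup E] [NormedSpace ℝ E]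
  {H : Type*} [TopologicalSpace H] (I : ModelWithCorners ℝ E H)
  {M : Type*} [TopologicalSpace M] [ChartedSpace H M]
  {E' : Type*} [NormedAddCommGroup E'] [NormedSpace ℝ E']
  {H' : Type*} [TopologicalSpace H'] (I' : ModelWithCorners ℝ E' H')
  {M' : Type*} [TopologicalSpace M'] [ChartedSpace H' M']
  {E'' : Type*} [NormedAddCommGroup E''] [NormedSpace ℝ E'']
  {H'' : Type*} [TopologicalSpace H''] (I'' : ModelWithCorners ℝ E'' H'')
  {M'' : Type*} [TopologicalSpace M''] [ChartedSpace H'' M'']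

/-- The derivative `mfderiv` with its tangent spaces unfolded to the model vector spaces, so that
derivatives at different points can be compared and composed without casts. -/
def modelDeriv (f : M → M') (x : M) : E →L[ℝ] E' := mfderiv I I' f x

variable {I I' I''}

lemma modelDeriv_comp_of_eq {g : M' → M''} {f : M → M'} {x : M} {y : M'}
    (hg : MDifferentiableAt I' I'' g y) (hf : MDifferentiableAt I I' f x) (hy : f x = y) :
    modelDeriv I I'' (g ∘ f) x = (modelDeriv I' I'' g y).comp (modelDeriv I I' f x) := by
  subst hy
  exact mfderiv_comp x hg hf

lemma modelDeriv_comp {g : M' → M''} {f : M → M'} {x : M} (hg : MDifferentiableAt I' I'' g (f x))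
    (hf : MDifferentiableAt I I' f x) :
    modelDeriv I I'' (g ∘ f) x = (modelDeriv I' I'' g (f x)).comp (modelDeriv I I' f x) :=
  mfderiv_comp x hg hf

lemma modelDeriv_congr {f g : M → M'} {x : M} (h : f =ᶠ[𝓝 x] g) :
    modelDeriv I I' f x = modelDeriv I I' g x := h.mfderiv_eq

lemma modelDeriv_eq_fderiv (f : E → E') (x : E) :
    modelDeriv 𝓘(ℝ, E) 𝓘(ℝ, E') f x = fderiv ℝ f x := mfderiv_eq_fderiv

lemma modelDeriv_id (x : M) : modelDeriv I I (id : M → M) x = ContinuousLinearMap.id ℝ E :=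
  mfderiv_id

lemma modelDeriv_const (c : M') (x : M) : modelDeriv I I' (fun _ : M => c) x = 0 :=
  mfderiv_const

lemma modelDeriv_prodMk {f : M → M'} {g : M → M''} {x : M} (hf : MDifferentiableAt I I' f x)
    (hg : MDifferentiableAt I I'' g x) :
    modelDeriv I (I'.prod I'') (fun y => (f y, g y)) x
      = (modelDeriv I I' f x).prod (modelDeriv I I'' g x) :=
  hf.mfderiv_prod hg

lemma modelDeriv_fst_comp {f : M → M' × M''} {x : M}
    (hf : MDifferentiableAt I (I'.prod I'') f x) :
    modelDeriv I I' (fun y => (f y).1) x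
      = (ContinuousLinearMap.fst ℝ E' E'').comp (modelDeriv I (I'.prod I'') f x) :=
  ((hasMFDerivAt_fst (I := I') (I' := I'') (f x)).comp x hf.hasMFDerivAt).mfderiv

lemma modelDeriv_snd_comp {f : M → M' × M''} {x : M}
    (hf : MDifferentiableAt I (I'.prod I'') f x) :
    modelDeriv I I'' (fun y => (f y).2) x
      = (ContinuousLinearMap.snd ℝ E' E'').comp (modelDeriv I (I'.prod I'') f x) :=
  ((hasMFDerivAt_snd (I := I') (I' := I'') (f x)).comp x hf.hasMFDerivAt).mfderiv

end ModelDeriv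

section ChartComponents

variable {E : Type*} [NormedAddCommGroup E] [NormedSpace ℝ E]
  {H : Type*} [TopologicalSpace H] (I : ModelWithCorners ℝ E H)
  {M : Type*} [TopologicalSpace M] [ChartedSpace H M] [IsManifold I 1 M]

/-- The linear map taking a tangent vector at `q` (given, as always in Mathlib, by its components in
the preferred chart at `q`) to its components in the chart around `q₀`. -/
def toChart (q₀ q : M) : E →L[ℝ] E := tangentCoordChange I q q₀ q

/-- The inverse of `toChart I q₀ q`: the tangent vector at `q` with given components in the chart
around `q₀`. -/
def ofChart (q₀ q : M) : E →L[ℝ] E := tangentCoordChange I q₀ q q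

variable {I}

lemma toChart_ofChart {q₀ q : M} (h : q ∈ (chartAt H q₀).source) (v : E) :
    toChart I q₀ q (ofChart I q₀ q v) = v := by
  have h' : q ∈ (extChartAt I q₀).source := by rwa [extChartAt_source]
  exact (tangentCoordChange_comp ⟨⟨h', mem_extChartAt_source q⟩, h'⟩).trans
    (tangentCoordChange_self h')

lemma ofChart_toChart {q₀ q : M} (h : q ∈ (chartAt H q₀).source) (v : E) :
    ofChart I q₀ q (toChart I q₀ q v) = v := by
  have h' : q ∈ (extChartAt I q₀).source := by rwa [extChartAt_source]
  exact (tangentCoordChange_comp ⟨⟨mem_extChartAt_source q, h'⟩, mem_extChartAt_source q⟩).trans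
    (tangentCoordChange_self (mem_extChartAt_source q))

lemma toChart_comp_ofChart {q₀ q : M} (h : q ∈ (chartAt H q₀).source) :
    (toChart I q₀ q).comp (ofChart I q₀ q) = ContinuousLinearMap.id ℝ E :=
  ContinuousLinearMap.ext (toChart_ofChart h)

lemma ofChart_comp_toChart {q₀ q : M} (h : q ∈ (chartAt H q₀).source) :
    (ofChart I q₀ q).comp (toChart I q₀ q) = ContinuousLinearMap.id ℝ E :=
  ContinuousLinearMap.ext (ofChart_toChart h)

@[simp] lemma toChart_self (q : M) : toChart I q q = ContinuousLinearMap.id ℝ E :=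
  ContinuousLinearMap.ext fun _ => tangentCoordChange_self (mem_extChartAt_source q)

@[simp] lemma ofChart_self (q : M) : ofChart I q q = ContinuousLinearMap.id ℝ E :=
  ContinuousLinearMap.ext fun _ => tangentCoordChange_self (mem_extChartAt_source q)

lemma isInvertible_toChart {q₀ q : M} (h : q ∈ (chartAt H q₀).source) :
    (toChart I q₀ q).IsInvertible :=
  .of_inverse (toChart_comp_ofChart h) (ofChart_comp_toChart h)

lemma isInvertible_ofChart {q₀ q : M} (h : q ∈ (chartAt H q₀).source) :
    (ofChart I q₀ q).IsInvertible :=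
  .of_inverse (ofChart_comp_toChart h) (toChart_comp_ofChart h)

lemma modelDeriv_extChartAt {q₀ q : M} (h : q ∈ (chartAt H q₀).source) :
    modelDeriv I 𝓘(ℝ, E) (extChartAt I q₀) q = toChart I q₀ q :=
  (TangentBundle.continuousLinearMapAt_trivializationAt h).symm.trans
    (TangentBundle.continuousLinearMapAt_trivializationAt_eq_core h)

variable [I.Boundaryless]

lemma mdifferentiableAt_extChartAt_symm {q₀ : M} {y : E} (h : y ∈ (extChartAt I q₀).target) :
    MDifferentiableAt 𝓘(ℝ, E) I (extChartAt I q₀).symm y := by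
  have := mdifferentiableWithinAt_extChartAt_symm (I := I) h
  rwa [I.range_eq_univ, mdifferentiableWithinAt_univ] at this

lemma modelDeriv_extChartAt_symm {q₀ q : M} (h : q ∈ (chartAt H q₀).source) :
    modelDeriv 𝓘(ℝ, E) I (extChartAt I q₀).symm (extChartAt I q₀ q) = ofChart I q₀ q := by
  have h' := (TangentBundle.symmL_trivializationAt (I := I) h).symm.trans
    (TangentBundle.symmL_trivializationAt_eq_core h)
  rwa [I.range_eq_univ, mfderivWithin_univ] at h'

end ChartComponents

section InCharts

variable {E : Type*} [NormedAddCommGroup E] [NormedSpace ℝ E]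
  {H : Type*} [TopologicalSpace H] {I : ModelWithCorners ℝ E H}
  {M : Type*} [TopologicalSpace M] [ChartedSpace H M]
  {E' : Type*} [NormedAddCommGroup E'] [NormedSpace ℝ E']
  {H' : Type*} [TopologicalSpace H'] {I' : ModelWithCorners ℝ E' H'}
  {M' : Type*} [TopologicalSpace M'] [ChartedSpace H' M']
  [I.Boundaryless]

lemma contDiffAt_inCharts {n : ℕ∞} [IsManifold I n M] [IsManifold I' n M'] {f : M → M'}
    {q₀ q : M} {r₀ : M'} (hf : ContMDiffAt I I' n f q) (hq : q ∈ (chartAt H q₀).source)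
    (hr : f q ∈ (chartAt H' r₀).source) :
    ContDiffAt ℝ n (extChartAt I' r₀ ∘ f ∘ (extChartAt I q₀).symm) (extChartAt I q₀ q) := by
  have h := ((contMDiffAt_iff_of_mem_source hq hr).1 hf).2
  rwa [I.range_eq_univ, contDiffWithinAt_univ] at h

variable [IsManifold I 1 M] [IsManifold I' 1 M'] {f : M → M'} {q₀ q : M} {r₀ : M'}

lemma fderiv_inCharts (hf : MDifferentiableAt I I' f q) (hq : q ∈ (chartAt H q₀).source)
    (hr : f q ∈ (chartAt H' r₀).source) :
    fderiv ℝ (extChartAt I' r₀ ∘ f ∘ (extChartAt I q₀).symm) (extChartAt I q₀ q)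
      = (toChart I' r₀ (f q)).comp ((modelDeriv I I' f q).comp (ofChart I q₀ q)) := by
  have hq' : q ∈ (extChartAt I q₀).source := by rwa [extChartAt_source]
  have hleft : (extChartAt I q₀).symm (extChartAt I q₀ q) = q := (extChartAt I q₀).left_inv hq'
  have hsymm := mdifferentiableAt_extChartAt_symm ((extChartAt I q₀).map_source hq')
  rw [← modelDeriv_eq_fderiv,
    modelDeriv_comp_of_eq (mdifferentiableAt_extChartAt hr) (hf.comp_of_eq _ hsymm hleft)
      (congrArg f hleft),
    modelDeriv_comp_of_eq hf hsymm hleft, modelDeriv_extChartAt hr, modelDeriv_extChartAt_symm hq]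

lemma modelDeriv_eq_fderiv_inCharts (hf : MDifferentiableAt I I' f q)
    (hq : q ∈ (chartAt H q₀).source) (hr : f q ∈ (chartAt H' r₀).source) :
    modelDeriv I I' f q = (ofChart I' r₀ (f q)).comp
      ((fderiv ℝ (extChartAt I' r₀ ∘ f ∘ (extChartAt I q₀).symm) (extChartAt I q₀ q)).comp
        (toChart I q₀ q)) := by
  rw [fderiv_inCharts hf hq hr]
  ext v
  simp [ofChart_toChart hq, ofChart_toChart hr]

lemma isInvertible_modelDeriv_iff (hf : MDifferentiableAt I I' f q)
    (hq : q ∈ (chartAt H q₀).source) (hr : f q ∈ (chartAt H' r₀).source) :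
    (modelDeriv I I' f q).IsInvertible ↔
      (fderiv ℝ (extChartAt I' r₀ ∘ f ∘ (extChartAt I q₀).symm)
        (extChartAt I q₀ q)).IsInvertible := by
  constructor
  · intro h
    rw [fderiv_inCharts hf hq hr]
    exact (isInvertible_toChart hr).comp (h.comp (isInvertible_ofChart hq))
  · intro h
    rw [modelDeriv_eq_fderiv_inCharts hf hq hr]
    exact (isInvertible_ofChart hr).comp (h.comp (isInvertible_toChart hq))

omit [IsManifold I 1 M] in
lemma modelDeriv_eq_fderiv_extChartAt {f : E → M'} {x : E}
    (hf : MDifferentiableAt 𝓘(ℝ, E) I' f x) :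
    modelDeriv 𝓘(ℝ, E) I' f x = fderiv ℝ (extChartAt I' (f x) ∘ f) x := by
  have h := fderiv_inCharts hf (mem_chart_source E x) (mem_chart_source H' (f x))
  rw [toChart_self, ofChart_self, ContinuousLinearMap.comp_id, ContinuousLinearMap.id_comp] at h
  exact h.symm

end InCharts

section InverseFunction

variable {E : Type*} [NormedAddCommGroup E] [NormedSpace ℝ E]
  {H : Type*} [TopologicalSpace H] {I : ModelWithCorners ℝ E H} [I.Boundaryless]
  {M : Type*} [TopologicalSpace M] [ChartedSpace H M]
  {E' : Type*} [NormedAddCommGroup E'] [NormedSpace ℝ E']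
  {H' : Type*} [TopologicalSpace H'] {I' : ModelWithCorners ℝ E' H'}
  {M' : Type*} [TopologicalSpace M'] [ChartedSpace H' M']

/-- The extended chart of a manifold without boundary, as an open partial homeomorphism. -/
def openExtChartAt (I : ModelWithCorners ℝ E H) [I.Boundaryless] (x : M) :
    OpenPartialHomeomorph M E :=
  (chartAt H x).trans I.toHomeomorph.toOpenPartialHomeomorph

variable (I) in
lemma openExtChartAt_source (x : M) : (openExtChartAt I x).source = (chartAt H x).source := by
  simp [openExtChartAt]

variable [CompleteSpace E]

lemma eventually_isInvertible {X : Type*} [TopologicalSpace X] {A : X → E →L[ℝ] E'} {x : X}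
    (hA : ContinuousAt A x) (h : (A x).IsInvertible) : ∀ᶠ y in 𝓝 x, (A y).IsInvertible := by
  obtain ⟨e, he⟩ := h
  exact hA (he ▸ ContinuousLinearEquiv.nhds e)

lemma eventually_isInvertible_modelDeriv [IsManifold I 1 M] [IsManifold I' 1 M'] {f : M → M'}
    {x : M} (hf : ContMDiffAt I I' 1 f x) (h : (modelDeriv I I' f x).IsInvertible) :
    ∀ᶠ y in 𝓝 x, (modelDeriv I I' f y).IsInvertible := by
  have hx := mem_chart_source H x
  have hfx := mem_chart_source H' (f x)
  have hcont : ContinuousAt (fderiv ℝ (extChartAt I' (f x) ∘ f ∘ (extChartAt I x).symm))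
      (extChartAt I x x) :=
    ((contDiffAt_inCharts (n := 1) hf hx hfx).fderiv_right (m := 0) (by norm_num)).continuousAt
  rw [isInvertible_modelDeriv_iff (hf.mdifferentiableAt one_ne_zero) hx hfx] at h
  filter_upwards [eventually_isInvertible (hcont.comp (continuousAt_extChartAt x)) h,
    (contMDiffAt_iff_contMDiffAt_nhds (n := 1) (by simp)).1 hf,
    (chartAt H x).open_source.mem_nhds hx,
    hf.continuousAt ((chartAt H' (f x)).open_source.mem_nhds hfx)] with y hy hfy hyx hfyx
  exact (isInvertible_modelDeriv_iff (hfy.mdifferentiableAt one_ne_zero) hyx hfyx).2 hy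

variable [IsManifold I ∞ M] [IsManifold I' ∞ M'] [I'.Boundaryless]

lemma contMDiffAt_symm_of_isInvertible (σ : OpenPartialHomeomorph M M') {y : M'}
    (hy : y ∈ σ.target) (hσ : ContMDiffAt I I' ∞ σ (σ.symm y))
    (h : (modelDeriv I I' σ (σ.symm y)).IsInvertible) : ContMDiffAt I' I ∞ σ.symm y := by
  set x := σ.symm y
  have hσx : σ x = y := σ.right_inv hy
  have hx := mem_chart_source H x
  have hσx' : σ x ∈ (chartAt H' y).source := hσx ▸ mem_chart_source H' y
  let c := openExtChartAt I x
  let c' := openExtChartAt I' y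
  have hxc : x ∈ c.source := (openExtChartAt_source I x).symm ▸ hx
  have hyc : y ∈ c'.source := (openExtChartAt_source I' y).symm ▸ mem_chart_source H' y
  let τ := c.symm.trans (σ.trans c')
  have hτy : τ.symm (c' y) = c x := by simp [τ, c'.left_inv hyc, x]
  have hmem : c' y ∈ τ.target := by
    simp [τ, c'.map_source hyc, c'.left_inv hyc, hy, hxc, x]
  obtain ⟨e, he⟩ := (isInvertible_modelDeriv_iff (hσ.mdifferentiableAt (by simp)) hx hσx').1 h
  have hτ : ContDiffAt ℝ ∞ τ (c x) := contDiffAt_inCharts (n := ⊤) hσ hx hσx'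
  have hτsymm : ContDiffAt ℝ ∞ τ.symm (c' y) := by
    refine τ.contDiffAt_symm (f₀' := e) hmem ?_ (hτy.symm ▸ hτ)
    rw [hτy, he]
    exact (hτ.differentiableAt (by simp)).hasFDerivAt
  have hcsymm : ContMDiffAt 𝓘(ℝ, E) I ∞ c.symm (τ.symm (c' y)) := by
    rw [hτy]
    exact (contMDiffOn_extChartAt_symm x).contMDiffAt (extChartAt_target_mem_nhds x)
  have hc' : ContMDiffAt I' 𝓘(ℝ, E') ∞ c' y := contMDiffAt_extChartAt
  refine (hcsymm.comp y (hτsymm.contMDiffAt.comp y hc')).congr_of_eventuallyEq ?_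
  filter_upwards [c'.open_source.mem_nhds hyc, (σ.symm.continuousAt hy).eventually
    (c.open_source.mem_nhds hxc)] with z hz hzc
  simp [τ, c'.left_inv hz, c.left_inv hzc]

theorem exists_openPartialHomeomorph_eqOn {f : M → M'} {s : Set M} {x : M}
    (hs : IsOpen s) (hx : x ∈ s) (hf : ContMDiffOn I I' ∞ f s)
    (h : (modelDeriv I I' f x).IsInvertible) :
    ∃ σ : OpenPartialHomeomorph M M', x ∈ σ.source ∧ σ.source ⊆ s ∧ EqOn σ f σ.source ∧
      ContMDiffOn I' I ∞ σ.symm σ.target := by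
  have hfs {y : M} (hy : y ∈ s) : ContMDiffAt I I' ∞ f y := hf.contMDiffAt (hs.mem_nhds hy)
  let c := openExtChartAt I x
  let c' := openExtChartAt I' (f x)
  have hxc : x ∈ c.source := (openExtChartAt_source I x).symm ▸ mem_chart_source H x
  have hfxc : f x ∈ c'.source := (openExtChartAt_source I' (f x)).symm ▸ mem_chart_source H' (f x)
  have hF : ContDiffAt ℝ ∞ (c' ∘ f ∘ c.symm) (c x) :=
    contDiffAt_inCharts (n := ⊤) (hfs hx) (mem_chart_source H x) (mem_chart_source H' _)
  obtain ⟨e, he⟩ := (isInvertible_modelDeriv_iff ((hfs hx).mdifferentiableAt (by simp))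
    (mem_chart_source H x) (mem_chart_source H' _)).1 h
  have he' : HasFDerivAt (c' ∘ f ∘ c.symm) (e : E →L[ℝ] E') (c x) :=
    he ▸ (hF.differentiableAt (by simp)).hasFDerivAt
  let τ := hF.toOpenPartialHomeomorph _ he' (by simp)
  obtain ⟨t, ht, ht_open, hxt⟩ := eventually_nhds_iff.1 ((eventually_isInvertible_modelDeriv
    ((hfs hx).of_le (by simp)) h).and ((hs.eventually_mem hx).and
    ((hfs hx).continuousAt.eventually (c'.open_source.eventually_mem hfxc))))
  let σ := ((c.trans τ).trans c'.symm).restrOpen t ht_open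
  have hσt : σ.source ⊆ t := inter_subset_right
  have hσf : EqOn σ f σ.source := by
    rintro y ⟨⟨⟨hyc, -⟩, -⟩, hyt⟩
    change c'.symm (c' (f (c.symm (c y)))) = f y
    rw [c.left_inv hyc, c'.left_inv (ht y hyt).2.2]
  have hσx : x ∈ σ.source := by
    refine ⟨⟨⟨hxc, hF.mem_toOpenPartialHomeomorph_source he' (by simp)⟩, ?_⟩, hxt⟩
    change c' (f (c.symm (c x))) ∈ c'.target
    rw [c.left_inv hxc]
    exact c'.map_source hfxc
  refine ⟨σ, hσx, fun y hy => (ht y (hσt hy)).2.1, hσf, fun z hz => ?_⟩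
  have hz' : σ.symm z ∈ σ.source := σ.map_target hz
  have hσeq : σ =ᶠ[𝓝 (σ.symm z)] f := hσf.eventuallyEq_of_mem (σ.open_source.mem_nhds hz')
  have hzt := ht _ (hσt hz')
  exact (contMDiffAt_symm_of_isInvertible (I := I) (I' := I') σ hz
    ((hfs hzt.2.1).congr_of_eventuallyEq hσeq)
    (modelDeriv_congr (I := I) (I' := I') hσeq ▸ hzt.1)).contMDiffWithinAt

end InverseFunction

/-! ### Canonical coordinates on the tangent and cotangent bundles -/

section BundleCharts

variable {E : Type*} [NormedAddCommGroup E] [NormedSpace ℝ E]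
  {H : Type*} [TopologicalSpace H] {I : ModelWithCorners ℝ E H}
  {M : Type*} [TopologicalSpace M] [ChartedSpace H M]

/-- The components of a covector in the preferred chart at its base point. -/
def covec (α : CotangentBundle I M) : E →L[ℝ] ℝ := α.2

/-- The components of a tangent vector in the preferred chart at its base point. -/
def vec (v : TangentBundle I M) : E := v.2

variable [IsManifold I ∞ M]

lemma extChartAt_tangentBundle (v₀ v : TangentBundle I M) :
    extChartAt I.tangent v₀ v =
      (extChartAt I v₀.proj v.proj, toChart I v₀.proj v.proj (vec v)) := rfl

lemma mem_chart_tangentBundle {v₀ v : TangentBundle I M} :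
    v ∈ (chartAt (ModelProd H E) v₀).source ↔ v.proj ∈ (chartAt H v₀.proj).source :=
  TangentBundle.mem_chart_source_iff v v₀

lemma extChartAt_tangentBundle_symm (v₀ : TangentBundle I M) (y : E × E) :
    (extChartAt I.tangent v₀).symm y = ⟨(extChartAt I v₀.proj).symm y.1,
      ofChart I v₀.proj ((extChartAt I v₀.proj).symm y.1) y.2⟩ := rfl

lemma cotangent_trivializationAt_snd {q₀ : M} {α : CotangentBundle I M}
    (h : α.proj ∈ (chartAt H q₀).source) :
    (trivializationAt (E →L[ℝ] ℝ) (fun x : M => TangentSpace I x →L[ℝ] Trivial M ℝ x) q₀ α).2 =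
      (covec α).comp (ofChart I q₀ α.proj) := by
  rw [hom_trivializationAt_apply (RingHom.id ℝ) (F₁ := E) (E₁ := TangentSpace I (M := M))
    (F₂ := ℝ) (E₂ := Trivial M ℝ) q₀ α]
  ext w
  change (Trivial.trivialization M ℝ).linearMapAt ℝ α.proj (α.2
    ((trivializationAt E (TangentSpace I) q₀).symmL ℝ α.proj w)) = _
  rw [TangentBundle.symmL_trivializationAt_eq_core (I := I) h, Trivial.linearMapAt_trivialization]
  rfl

lemma extChartAt_cotangentBundle {α₀ α : CotangentBundle I M}
    (h : α.proj ∈ (chartAt H α₀.proj).source) :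
    extChartAt (cotangentModel I) α₀ α =
      (extChartAt I α₀.proj α.proj, (covec α).comp (ofChart I α₀.proj α.proj)) :=
  Prod.ext rfl (cotangent_trivializationAt_snd h)

lemma mem_chart_cotangentBundle {α₀ α : CotangentBundle I M} :
    α ∈ (chartAt (ModelProd H (E →L[ℝ] ℝ)) α₀).source ↔
      α.proj ∈ (chartAt H α₀.proj).source := by
  simp only [FiberBundle.chartedSpace_chartAt, mfld_simps]
  exact ⟨fun h => h.2, fun h => ⟨⟨h, mem_univ _⟩, h⟩⟩

section Smoothness

variable {n : WithTop ℕ∞} {F : Type*} [NormedAddCommGroup F] [NormedSpace ℝ F]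
  {G : Type*} [TopologicalSpace G] {J : ModelWithCorners ℝ F G}
  {N : Type*} [TopologicalSpace N] [ChartedSpace G N] {x₀ : N}

lemma contMDiffAt_cotangentBundle {f : N → CotangentBundle I M} :
    ContMDiffAt J (cotangentModel I) n f x₀ ↔ ContMDiffAt J I n (fun x => (f x).proj) x₀ ∧
      ContMDiffAt J 𝓘(ℝ, E →L[ℝ] ℝ) n
        (fun x => (covec (f x)).comp (ofChart I (f x₀).proj (f x).proj)) x₀ := by
  rw [Bundle.contMDiffAt_totalSpace]
  refine and_congr_right fun h => Filter.EventuallyEq.contMDiffAt_iff ?_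
  filter_upwards [h.continuousAt ((chartAt H (f x₀).proj).open_source.mem_nhds
    (mem_chart_source H _))] with x hx
  exact cotangent_trivializationAt_snd hx

lemma contMDiffAt_tangentBundle {f : N → TangentBundle I M} :
    ContMDiffAt J I.tangent n f x₀ ↔ ContMDiffAt J I n (fun x => (f x).proj) x₀ ∧
      ContMDiffAt J 𝓘(ℝ, E) n
        (fun x => toChart I (f x₀).proj (f x).proj (vec (f x))) x₀ :=
  Bundle.contMDiffAt_totalSpace

end Smoothness

/-! ### The canonical symplectic form in coordinates -/

section Pullback

variable {F : Type*} [NormedAddCommGroup F] [NormedSpace ℝ F]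
  {G : Type*} [TopologicalSpace G] (J : ModelWithCorners ℝ F G)
  {N : Type*} [TopologicalSpace N] [ChartedSpace G N]

/-- The pullback of the Liouville form under a map `g` from a manifold to `T^*M`. -/
def liouvillePullback (g : N → CotangentBundle I M) (x : N) : F →L[ℝ] ℝ :=
  (covec (g x)).comp (modelDeriv J I (fun z => (g z).proj) x)

lemma mdifferentiableAt_cotangentProj (α : CotangentBundle I M) :
    MDifferentiableAt (cotangentModel I) I (TotalSpace.proj : CotangentBundle I M → M) α :=
  (contMDiffAt_proj (n := 1) _).mdifferentiableAt one_ne_zero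

variable {J}

lemma liouvillePullback_eq_comp {g : N → CotangentBundle I M} {x : N}
    (hg : MDifferentiableAt J (cotangentModel I) g x) :
    liouvillePullback J g x = ContinuousLinearMap.comp (liouvilleForm I (g x))
      (modelDeriv J (cotangentModel I) g x) :=
  congrArg (covec (g x)).comp (modelDeriv_comp (mdifferentiableAt_cotangentProj (g x)) hg)

lemma liouvillePullback_comp {F' : Type*} [NormedAddCommGroup F'] [NormedSpace ℝ F']
    {G' : Type*} [TopologicalSpace G'] {J' : ModelWithCorners ℝ F' G'}
    {N' : Type*} [TopologicalSpace N'] [ChartedSpace G' N']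
    {g : N → CotangentBundle I M} {s : N' → N} {y : N'}
    (hg : MDifferentiableAt J (cotangentModel I) g (s y)) (hs : MDifferentiableAt J' J s y) :
    liouvillePullback J' (g ∘ s) y =
      (liouvillePullback J g (s y)).comp (modelDeriv J' J s y) :=
  congrArg (covec (g (s y))).comp
    (modelDeriv_comp ((mdifferentiableAt_cotangentProj (g (s y))).comp (s y) hg) hs)

lemma liouvillePullback_inCharts {g : F → CotangentBundle I M} {y : F} {α₀ : CotangentBundle I M}
    (hg : MDifferentiableAt 𝓘(ℝ, F) (cotangentModel I) g y)
    (h : (g y).proj ∈ (chartAt H α₀.proj).source) :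
    liouvillePullback 𝓘(ℝ, F) g y = (extChartAt (cotangentModel I) α₀ (g y)).2.comp
      (fderiv ℝ (fun z => (extChartAt (cotangentModel I) α₀ (g z)).1) y) := by
  have h_proj := modelDeriv_eq_fderiv_inCharts
    ((mdifferentiableAt_cotangentProj (g y)).comp y hg) (mem_chart_source _ y) h
  rw [toChart_self, ContinuousLinearMap.comp_id] at h_proj
  refine (congrArg (covec (g y)).comp h_proj).trans ?_
  rw [extChartAt_cotangentBundle h, ContinuousLinearMap.comp_assoc]
  rfl

end Pullback

variable [I.Boundaryless]

lemma liouvillePullback_extChartAt_symm (α : CotangentBundle I M) {y : E × (E →L[ℝ] ℝ)}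
    (hy : y ∈ (extChartAt (cotangentModel I) α).target) :
    liouvillePullback 𝓘(ℝ, E × (E →L[ℝ] ℝ)) (extChartAt (cotangentModel I) α).symm y =
      y.2.comp (ContinuousLinearMap.fst ℝ E (E →L[ℝ] ℝ)) := by
  set c := extChartAt (cotangentModel I) α
  have h_mem : c.symm y ∈ (chartAt (ModelProd H (E →L[ℝ] ℝ)) α).source := by
    rw [← extChartAt_source (cotangentModel I)]
    exact c.map_target hy
  have h_fst : (fun z => (c (c.symm z)).1) =ᶠ[𝓝 y] Prod.fst := by
    filter_upwards [(isOpen_extChartAt_target α).mem_nhds hy] with z hz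
    rw [c.right_inv hz]
  rw [liouvillePullback_inCharts (mdifferentiableAt_extChartAt_symm hy)
    (mem_chart_cotangentBundle.1 h_mem), h_fst.fderiv_eq, fderiv_fst, c.right_inv hy]

lemma extDerivOneForm_eq {θ : M → E →L[ℝ] ℝ} {x : M} {θ' : E → E →L[ℝ] ℝ}
    {D : E →L[ℝ] E →L[ℝ] ℝ} (hD : HasFDerivAt θ' D (extChartAt I x x))
    (hθ : ∀ᶠ y in 𝓝 (extChartAt I x x), (θ ((extChartAt I x).symm y)).comp
      (modelDeriv 𝓘(ℝ, E) I (extChartAt I x).symm y) = θ' y) (u v : E) :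
    extDerivOneForm I θ x u v = D u v - D v u := by
  have h_chart (w : E) : modelDeriv I 𝓘(ℝ, E) (extChartAt I x) x w = w := by
    rw [modelDeriv_extChartAt (mem_chart_source _ x), toChart_self]
    rfl
  have h_form : extDerivOneForm I θ x u v =
      fderiv ℝ (fun y => (θ ((extChartAt I x).symm y)).comp
        (modelDeriv 𝓘(ℝ, E) I (extChartAt I x).symm y)) (extChartAt I x x)
        (modelDeriv I 𝓘(ℝ, E) (extChartAt I x) x u) (modelDeriv I 𝓘(ℝ, E) (extChartAt I x) x v) -
      fderiv ℝ (fun y => (θ ((extChartAt I x).symm y)).comp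
        (modelDeriv 𝓘(ℝ, E) I (extChartAt I x).symm y)) (extChartAt I x x)
        (modelDeriv I 𝓘(ℝ, E) (extChartAt I x) x v)
        (modelDeriv I 𝓘(ℝ, E) (extChartAt I x) x u) := by
    simp only [extDerivOneForm, I.range_eq_univ, mfderivWithin_univ, fderivWithin_univ]
    rfl
  rw [h_form, h_chart, h_chart, (hD.congr_of_eventuallyEq hθ).fderiv]

theorem canonicalForm_apply (α : CotangentBundle I M) (X Y : E × (E →L[ℝ] ℝ)) :
    canonicalForm I α X Y = Y.2 X.1 - X.2 Y.1 := by
  have h_deriv := (hasFDerivAt_snd (𝕜 := ℝ) (p := extChartAt (cotangentModel I) α α)).clm_comp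
    (hasFDerivAt_const (ContinuousLinearMap.fst ℝ E (E →L[ℝ] ℝ)) _)
  have h_form : extDerivOneForm (cotangentModel I) (liouvilleForm I (M := M)) α X Y =
      X.2 Y.1 - Y.2 X.1 := by
    refine (extDerivOneForm_eq h_deriv ?_ X Y).trans (by simp)
    filter_upwards [extChartAt_target_mem_nhds (I := cotangentModel I) α] with y hy
    exact (liouvillePullback_eq_comp (mdifferentiableAt_extChartAt_symm hy)).symm.trans
      (liouvillePullback_extChartAt_symm α hy)
  exact (congrArg Neg.neg h_form).trans (neg_sub _ _)

lemma eq_of_forall_canonicalForm_eq {α : CotangentBundle I M} {Y Z : E × (E →L[ℝ] ℝ)}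
    (h : ∀ X : E × (E →L[ℝ] ℝ), canonicalForm I α X Y = canonicalForm I α X Z) : Y = Z := by
  simp only [canonicalForm_apply] at h
  refine Prod.ext ((SeparatingDual.eq_iff_forall_dual_eq (R := ℝ)).2 fun p => ?_)
    (ContinuousLinearMap.ext fun a => ?_)
  · simpa using h (0, p)
  · simpa using h (a, 0)

section Pullback

variable {F : Type*} [NormedAddCommGroup F] [NormedSpace ℝ F]

/-- The derivative of `y ↦ p(y) dq(y)` is `dp ∧ dq` up to a symmetric second derivative. -/
lemma hasFDerivAt_snd_comp_fderiv_fst {G : F → E × (E →L[ℝ] ℝ)} {y₀ : F}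
    (hG : ContDiffAt ℝ 2 G y₀) :
    ∃ D : F →L[ℝ] F →L[ℝ] ℝ,
      HasFDerivAt (fun y => (G y).2.comp (fderiv ℝ (fun z => (G z).1) y)) D y₀ ∧
      ∀ u w, D w u - D u w = (fderiv ℝ G y₀ w).2 (fderiv ℝ G y₀ u).1 -
        (fderiv ℝ G y₀ u).2 (fderiv ℝ G y₀ w).1 := by
  have hG_diff := hG.differentiableAt two_ne_zero
  have hq : ContDiffAt ℝ 2 (fun y => (G y).1) y₀ := contDiffAt_fst.comp y₀ hG
  have hp := (hasFDerivAt_snd (𝕜 := ℝ) (p := G y₀)).comp y₀ hG_diff.hasFDerivAt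
  have hq' := ((hq.fderiv_right (m := 1) (by norm_num)).differentiableAt one_ne_zero).hasFDerivAt
  refine ⟨_, hp.clm_comp hq', fun u w => ?_⟩
  have h_symm := (hq.isSymmSndFDerivAt (by simp)).eq u w
  have h_fst (v : F) : fderiv ℝ (fun y => (G y).1) y₀ v = (fderiv ℝ G y₀ v).1 := by
    rw [fderiv.fst hG_diff]
    rfl
  simp [h_symm, h_fst]

lemma canonicalForm_modelDeriv_of_vectorSpace {g : F → CotangentBundle I M} {y₀ : F}
    (hg : ContMDiffAt 𝓘(ℝ, F) (cotangentModel I) ∞ g y₀) :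
    ∃ D : F →L[ℝ] F →L[ℝ] ℝ, HasFDerivAt (liouvillePullback 𝓘(ℝ, F) g) D y₀ ∧ ∀ u w : F,
      canonicalForm I (g y₀) (modelDeriv 𝓘(ℝ, F) (cotangentModel I) g y₀ u)
        (modelDeriv 𝓘(ℝ, F) (cotangentModel I) g y₀ w) = D w u - D u w := by
  have hG : ContDiffAt ℝ ∞ (extChartAt (cotangentModel I) (g y₀) ∘ g) y₀ :=
    contDiffAt_inCharts (n := ⊤) (I := 𝓘(ℝ, F)) (q₀ := y₀) hg
      (mem_chart_source _ y₀) (mem_chart_source _ (g y₀))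
  obtain ⟨D, hD, hD_alt⟩ := hasFDerivAt_snd_comp_fderiv_fst (hG.of_le (by norm_cast))
  refine ⟨D, hD.congr_of_eventuallyEq ?_, fun u w => ?_⟩
  · filter_upwards [(contMDiffAt_iff_contMDiffAt_nhds (n := 1) (by simp)).1 (hg.of_le (by simp)),
      hg.continuousAt ((chartAt (ModelProd H (E →L[ℝ] ℝ)) (g y₀)).open_source.mem_nhds
        (mem_chart_source _ (g y₀)))] with y hy hy_mem
    exact liouvillePullback_inCharts (hy.mdifferentiableAt one_ne_zero)
      (mem_chart_cotangentBundle.1 hy_mem)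
  · rw [modelDeriv_eq_fderiv_extChartAt (hg.mdifferentiableAt (by simp)), canonicalForm_apply,
      hD_alt]

variable {G : Type*} [TopologicalSpace G] {J : ModelWithCorners ℝ F G} [J.Boundaryless]
  {N : Type*} [TopologicalSpace N] [ChartedSpace G N] [IsManifold J ∞ N] {x : N}

lemma canonicalForm_modelDeriv {g : N → CotangentBundle I M}
    (hg : ContMDiffAt J (cotangentModel I) ∞ g x) :
    ∃ D : F →L[ℝ] F →L[ℝ] ℝ,
      HasFDerivAt (fun y => (liouvillePullback J g ((extChartAt J x).symm y)).comp
        (modelDeriv 𝓘(ℝ, F) J (extChartAt J x).symm y)) D (extChartAt J x x) ∧ ∀ u w : F,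
      canonicalForm I (g x) (modelDeriv J (cotangentModel I) g x u)
        (modelDeriv J (cotangentModel I) g x w) = D w u - D u w := by
  set s := (extChartAt J x).symm
  set y₀ := extChartAt J x x
  have hs : ContMDiffAt 𝓘(ℝ, F) J ∞ s y₀ :=
    (contMDiffOn_extChartAt_symm x).contMDiffAt (extChartAt_target_mem_nhds x)
  have hs₀ : s y₀ = x := extChartAt_to_inv x
  have hg' : ContMDiffAt J (cotangentModel I) ∞ g (s y₀) := by rwa [hs₀]
  have h_deriv : modelDeriv 𝓘(ℝ, F) (cotangentModel I) (g ∘ s) y₀ =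
      modelDeriv J (cotangentModel I) g x := by
    rw [modelDeriv_comp_of_eq (hg.mdifferentiableAt (by simp)) (hs.mdifferentiableAt (by simp)) hs₀,
      modelDeriv_extChartAt_symm (mem_chart_source G x), ofChart_self,
      ContinuousLinearMap.comp_id]
  obtain ⟨D, hD, hD_form⟩ := canonicalForm_modelDeriv_of_vectorSpace (hg'.comp y₀ hs)
  refine ⟨D, hD.congr_of_eventuallyEq ?_, fun u w => ?_⟩
  · filter_upwards [extChartAt_target_mem_nhds x, hs.continuousAt.eventually
      ((contMDiffAt_iff_contMDiffAt_nhds (n := 1) (by simp)).1 (hg'.of_le (by simp)))] with y hy hgy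
    exact (liouvillePullback_comp (hgy.mdifferentiableAt one_ne_zero)
      (mdifferentiableAt_extChartAt_symm hy)).symm
  · rw [← hD_form, h_deriv, canonicalForm_apply, canonicalForm_apply]

theorem canonicalForm_sub_of_liouvillePullback_sub
    {E' : Type*} [NormedAddCommGroup E'] [NormedSpace ℝ E']
    {H' : Type*} [TopologicalSpace H'] {I' : ModelWithCorners ℝ E' H'} [I'.Boundaryless]
    {M' : Type*} [TopologicalSpace M'] [ChartedSpace H' M'] [IsManifold I' ∞ M']
    {g₀ g₁ : N → CotangentBundle I M} {g : N → CotangentBundle I' M'}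
    (hg₀ : ContMDiffAt J (cotangentModel I) ∞ g₀ x)
    (hg₁ : ContMDiffAt J (cotangentModel I) ∞ g₁ x)
    (hg : ContMDiffAt J (cotangentModel I') ∞ g x)
    (h : ∀ᶠ z in 𝓝 x,
      liouvillePullback J g₁ z - liouvillePullback J g₀ z = liouvillePullback J g z) (u w : F) :
    canonicalForm I (g₁ x) (modelDeriv J (cotangentModel I) g₁ x u)
        (modelDeriv J (cotangentModel I) g₁ x w) -
      canonicalForm I (g₀ x) (modelDeriv J (cotangentModel I) g₀ x u)
        (modelDeriv J (cotangentModel I) g₀ x w) =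
      canonicalForm I' (g x) (modelDeriv J (cotangentModel I') g x u)
        (modelDeriv J (cotangentModel I') g x w) := by
  obtain ⟨D₀, hD₀, h_form₀⟩ := canonicalForm_modelDeriv hg₀
  obtain ⟨D₁, hD₁, h_form₁⟩ := canonicalForm_modelDeriv hg₁
  obtain ⟨D, hD, h_form⟩ := canonicalForm_modelDeriv hg
  have h_eq : D₁ - D₀ = D := by
    refine (hD₁.sub hD₀).unique (hD.congr_of_eventuallyEq ?_)
    filter_upwards [(continuousAt_extChartAt_symm x).eventually
      ((extChartAt_to_inv (I := J) x).symm ▸ h)] with y hy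
    rw [← hy]
    rfl
  rw [h_form₀, h_form₁, h_form, ← h_eq]
  simp only [sub_apply]
  ring

theorem canonicalForm_eq_zero_of_liouvillePullback_eq_deriv {g : N → CotangentBundle I M}
    (hg : ContMDiffAt J (cotangentModel I) ∞ g x) {S : N → ℝ} (hS : ContMDiffAt J 𝓘(ℝ, ℝ) ∞ S x)
    (h : liouvillePullback J g =ᶠ[𝓝 x] modelDeriv J 𝓘(ℝ, ℝ) S) (u w : F) :
    canonicalForm I (g x) (modelDeriv J (cotangentModel I) g x u)
      (modelDeriv J (cotangentModel I) g x w) = 0 := by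
  have hS_chart : ContDiffAt ℝ ∞ (S ∘ (extChartAt J x).symm) (extChartAt J x x) :=
    contDiffAt_inCharts (n := ⊤) hS (mem_chart_source G x) (mem_chart_source ℝ (S x))
  obtain ⟨D, hD, h_form⟩ := canonicalForm_modelDeriv hg
  have hD_eq : D = fderiv ℝ (fderiv ℝ (S ∘ (extChartAt J x).symm)) (extChartAt J x x) := by
    refine (hD.congr_of_eventuallyEq ?_).fderiv.symm
    filter_upwards [extChartAt_target_mem_nhds x, (continuousAt_extChartAt_symm x).eventually
      ((extChartAt_to_inv (I := J) x).symm ▸ h.and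
        ((contMDiffAt_iff_contMDiffAt_nhds (n := 1) (by simp)).1 (hS.of_le (by simp))))]
      with y hy hSy
    rw [hSy.1, ← modelDeriv_eq_fderiv]
    exact modelDeriv_comp (hSy.2.mdifferentiableAt one_ne_zero)
      (mdifferentiableAt_extChartAt_symm hy)
  rw [h_form, hD_eq, (hS_chart.isSymmSndFDerivAt (by simp; norm_cast)).eq u w, sub_self]

end Pullback

end BundleCharts

/-! ### The canonical diffeomorphism `TT^*M → T^*TM` -/

section Tulczyjew

variable {E : Type*} [NormedAddCommGroup E] [NormedSpace ℝ E]
  {H : Type*} [TopologicalSpace H] {I : ModelWithCorners ℝ E H}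
  {M : Type*} [TopologicalSpace M] [ChartedSpace H M]

variable (I) in
/-- The change of coordinates from the preferred chart at `q` to the one at `q₀`. -/
def chartChange (q₀ q : M) : E → E := extChartAt I q₀ ∘ (extChartAt I q).symm

variable [I.Boundaryless]

lemma eventually_mem_charts {q₀ q : M} (h₀ : q ∈ (chartAt H q₀).source) :
    ∀ᶠ x in 𝓝 (extChartAt I q q), x ∈ (extChartAt I q).target ∧
      (extChartAt I q).symm x ∈ (chartAt H q).source ∧
      (extChartAt I q).symm x ∈ (chartAt H q₀).source := by
  have h_cont : ContinuousAt (extChartAt I q).symm (extChartAt I q q) :=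
    continuousAt_extChartAt_symm q
  have h_inv : (extChartAt I q).symm (extChartAt I q q) = q := extChartAt_to_inv q
  exact eventually_and.2 ⟨extChartAt_target_mem_nhds q, eventually_and.2
    ⟨h_cont.eventually ((chartAt H q).open_source.eventually_mem
      (h_inv.symm ▸ mem_chart_source H q)),
    h_cont.eventually ((chartAt H q₀).open_source.eventually_mem (h_inv.symm ▸ h₀))⟩⟩

variable [IsManifold I ∞ M]

lemma toChart_eq_fderiv (q₀ q : M) :
    toChart I q₀ q = fderiv ℝ (chartChange I q₀ q) (extChartAt I q q) := by
  rw [← fderivWithin_univ, ← I.range_eq_univ]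
  rfl

lemma fderiv_chartChange {q₀ q q' : M} (h : q' ∈ (chartAt H q).source)
    (h₀ : q' ∈ (chartAt H q₀).source) :
    fderiv ℝ (chartChange I q₀ q) (extChartAt I q q')
      = (toChart I q₀ q').comp (ofChart I q q') := by
  have h_id := fderiv_inCharts (I := I) (I' := I) (f := (id : M → M)) mdifferentiableAt_id h h₀
  rwa [modelDeriv_id, ContinuousLinearMap.id_comp] at h_id

lemma contDiffAt_chartChange {q₀ q : M} (h₀ : q ∈ (chartAt H q₀).source) :
    ContDiffAt ℝ ∞ (chartChange I q₀ q) (extChartAt I q q) :=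
  contDiffAt_inCharts (n := ⊤) (f := (id : M → M)) contMDiffAt_id (mem_chart_source H q) h₀

lemma hasFDerivAt_chartChange {q₀ q : M} (h₀ : q ∈ (chartAt H q₀).source) :
    HasFDerivAt (chartChange I q₀ q) (toChart I q₀ q) (extChartAt I q q) :=
  toChart_eq_fderiv (I := I) q₀ q ▸
    ((contDiffAt_chartChange h₀).differentiableAt (by simp)).hasFDerivAt

lemma hasFDerivAt_fderiv_chartChange {q₀ q : M} (h₀ : q ∈ (chartAt H q₀).source) :
    HasFDerivAt (fderiv ℝ (chartChange I q₀ q))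
      (fderiv ℝ (fderiv ℝ (chartChange I q₀ q)) (extChartAt I q q)) (extChartAt I q q) :=
  (((contDiffAt_chartChange h₀).fderiv_right (m := 1) (by norm_cast)).differentiableAt
    one_ne_zero).hasFDerivAt

lemma fderiv_fderiv_chartChange_comm {q₀ q : M} (h₀ : q ∈ (chartAt H q₀).source) (a b : E) :
    fderiv ℝ (fderiv ℝ (chartChange I q₀ q)) (extChartAt I q q) a b =
      fderiv ℝ (fderiv ℝ (chartChange I q₀ q)) (extChartAt I q q) b a :=
  ((contDiffAt_chartChange h₀).isSymmSndFDerivAt (by simp; norm_cast)).eq a b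

lemma chartChange_tangentBundle {v₀ v : TangentBundle I M}
    (h₀ : v.proj ∈ (chartAt H v₀.proj).source) :
    chartChange I.tangent v₀ v =ᶠ[𝓝 (extChartAt I.tangent v v)] fun y =>
      (chartChange I v₀.proj v.proj y.1, fderiv ℝ (chartChange I v₀.proj v.proj) y.1 y.2) := by
  filter_upwards [(continuousAt_fst (p := extChartAt I.tangent v v)).eventually
    (eventually_mem_charts (q := v.proj) h₀)] with y hy
  have h_deriv := fderiv_chartChange (I := I) hy.2.1 hy.2.2
  rw [(extChartAt I v.proj).right_inv hy.1] at h_deriv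
  rw [h_deriv, chartChange, Function.comp_apply, extChartAt_tangentBundle_symm,
    extChartAt_tangentBundle]
  rfl

lemma toChart_tangentBundle_apply {v₀ v : TangentBundle I M}
    (h₀ : v.proj ∈ (chartAt H v₀.proj).source) (X : E × E) :
    toChart I.tangent v₀ v X = (toChart I v₀.proj v.proj X.1,
      fderiv ℝ (fderiv ℝ (chartChange I v₀.proj v.proj)) (extChartAt I v.proj v.proj) X.1 (vec v)
        + toChart I v₀.proj v.proj X.2) := by
  have h_point : extChartAt I.tangent v v = (extChartAt I v.proj v.proj, vec v) := by
    rw [extChartAt_tangentBundle, toChart_self]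
    rfl
  have h_deriv := (((hasFDerivAt_chartChange (I := I) h₀).comp
    (f := Prod.fst) (extChartAt I v.proj v.proj, vec v) hasFDerivAt_fst).prodMk
    (((hasFDerivAt_fderiv_chartChange (I := I) h₀).comp (f := Prod.fst)
      (extChartAt I v.proj v.proj, vec v) hasFDerivAt_fst).clm_apply hasFDerivAt_snd))
  have h_unique := (h_point ▸ hasFDerivAt_chartChange (I := I.tangent)
    (mem_chart_tangentBundle.2 h₀)).unique
    (h_deriv.congr_of_eventuallyEq (h_point ▸ chartChange_tangentBundle h₀))
  rw [h_unique]
  simp [toChart_eq_fderiv, add_comm]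

lemma chartChange_cotangentBundle {α₀ α : CotangentBundle I M}
    (h₀ : α.proj ∈ (chartAt H α₀.proj).source) :
    ∀ᶠ y in 𝓝 (extChartAt (cotangentModel I) α α),
      (chartChange (cotangentModel I) α₀ α y).1 = chartChange I α₀.proj α.proj y.1 ∧
      ∀ a, (chartChange (cotangentModel I) α₀ α y).2
        (fderiv ℝ (chartChange I α₀.proj α.proj) y.1 a) = y.2 a := by
  filter_upwards [eventually_mem_charts (mem_chart_cotangentBundle.2 h₀)] with y ⟨hy, hyα, hyα₀⟩
  set β := (extChartAt (cotangentModel I) α).symm y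
  have hβ := mem_chart_cotangentBundle.1 hyα
  have hβ₀ := mem_chart_cotangentBundle.1 hyα₀
  have h_eq : y = (extChartAt I α.proj β.proj, (covec β).comp (ofChart I α.proj β.proj)) :=
    ((extChartAt (cotangentModel I) α).right_inv hy).symm.trans (extChartAt_cotangentBundle hβ)
  have h_change : chartChange (cotangentModel I) α₀ α y =
      (extChartAt I α₀.proj β.proj, (covec β).comp (ofChart I α₀.proj β.proj)) :=
    extChartAt_cotangentBundle hβ₀
  rw [h_change, h_eq]
  refine ⟨?_, fun a => ?_⟩
  · rw [chartChange, Function.comp_apply, (extChartAt I α.proj).left_inv]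
    rwa [extChartAt_source]
  · rw [fderiv_chartChange hβ hβ₀]
    simp [ofChart_toChart hβ₀]

lemma toChart_cotangentBundle_fst {α₀ α : CotangentBundle I M}
    (h₀ : α.proj ∈ (chartAt H α₀.proj).source) (X : E × (E →L[ℝ] ℝ)) :
    (toChart (cotangentModel I) α₀ α X).1 = toChart I α₀.proj α.proj X.1 := by
  have h_deriv := (hasFDerivAt_chartChange (I := cotangentModel I)
    (mem_chart_cotangentBundle.2 h₀)).fst
  have h_deriv' := (hasFDerivAt_chartChange (I := I) h₀).comp (f := Prod.fst)
    (extChartAt (cotangentModel I) α α) hasFDerivAt_fst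
  exact DFunLike.congr_fun (h_deriv.unique (h_deriv'.congr_of_eventuallyEq
    ((chartChange_cotangentBundle h₀).mono fun _ hy => hy.1))) X

lemma toChart_cotangentBundle_snd {α₀ α : CotangentBundle I M}
    (h₀ : α.proj ∈ (chartAt H α₀.proj).source) (X : E × (E →L[ℝ] ℝ)) (a : E) :
    (toChart (cotangentModel I) α₀ α X).2 (toChart I α₀.proj α.proj a) =
      X.2 a - covec α (ofChart I α₀.proj α.proj
        (fderiv ℝ (fderiv ℝ (chartChange I α₀.proj α.proj)) (extChartAt I α.proj α.proj)
          X.1 a)) := by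
  have h_covec : (chartChange (cotangentModel I) α₀ α (extChartAt (cotangentModel I) α α)).2 =
      (covec α).comp (ofChart I α₀.proj α.proj) := by
    rw [chartChange, Function.comp_apply, extChartAt_to_inv, extChartAt_cotangentBundle h₀]
  have h_deriv := (hasFDerivAt_chartChange (I := cotangentModel I)
    (mem_chart_cotangentBundle.2 h₀)).snd.clm_apply
    (((hasFDerivAt_fderiv_chartChange (I := I) h₀).comp (f := Prod.fst) _
      hasFDerivAt_fst).clm_apply (hasFDerivAt_const a _))
  have h_const := ((hasFDerivAt_snd (𝕜 := ℝ) (p := _)).clm_apply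
    (hasFDerivAt_const a _)).congr_of_eventuallyEq
    ((chartChange_cotangentBundle h₀).mono fun _ hy => hy.2 a)
  have h := DFunLike.congr_fun (h_deriv.unique h_const) X
  have h_fst : fderiv ℝ (chartChange I α₀.proj α.proj) (extChartAt (cotangentModel I) α α).1 =
      toChart I α₀.proj α.proj :=
    (toChart_eq_fderiv _ _).symm
  simp only [add_apply, ContinuousLinearMap.comp_apply, ContinuousLinearMap.flip_apply,
    ContinuousLinearMap.coe_fst', ContinuousLinearMap.coe_snd', zero_apply, map_zero, zero_add,
    h_covec, Function.comp_apply, h_fst] at h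
  exact eq_sub_of_add_eq' h

lemma tulczyjew_pairing {α₀ α : CotangentBundle I M} (u₀ : E)
    (h₀ : α.proj ∈ (chartAt H α₀.proj).source) (X : E × (E →L[ℝ] ℝ)) (a b : E) :
    (toChart (cotangentModel I) α₀ α X).2 (toChart I α₀.proj α.proj a) +
      covec α (ofChart I α₀.proj α.proj
        (toChart I.tangent (⟨α₀.proj, u₀⟩ : TangentBundle I M)
          (⟨α.proj, X.1⟩ : TangentBundle I M) (a, b)).2) = X.2 a + covec α b := by
  rw [toChart_tangentBundle_apply (v₀ := ⟨α₀.proj, u₀⟩) (v := ⟨α.proj, X.1⟩) h₀,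
    toChart_cotangentBundle_snd h₀, fderiv_fderiv_chartChange_comm h₀]
  simp only [map_add, ofChart_toChart h₀, vec]
  ring

omit [I.Boundaryless] in
lemma covec_tulczyjew (X : TangentBundle (cotangentModel I) (CotangentBundle I M)) :
    covec (tulczyjew I X) = (vec X).2.comp (ContinuousLinearMap.fst ℝ E E)
      + (covec X.proj).comp (ContinuousLinearMap.snd ℝ E E) := rfl

lemma covec_tulczyjew_comp_ofChart {α₀ : CotangentBundle I M} (u₀ : E)
    {X : TangentBundle (cotangentModel I) (CotangentBundle I M)}
    (h₀ : X.proj.proj ∈ (chartAt H α₀.proj).source) :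
    (covec (tulczyjew I X)).comp (ofChart I.tangent (⟨α₀.proj, u₀⟩ : TangentBundle I M)
      (tulczyjew I X).proj) =
    (toChart (cotangentModel I) α₀ X.proj (vec X)).2.comp (ContinuousLinearMap.fst ℝ E E) +
      ((covec X.proj).comp (ofChart I α₀.proj X.proj.proj)).comp
        (ContinuousLinearMap.snd ℝ E E) := by
  have h_mem : (tulczyjew I X).proj ∈
      (chartAt (ModelProd H E) (⟨α₀.proj, u₀⟩ : TangentBundle I M)).source :=
    mem_chart_tangentBundle.2 h₀
  refine ContinuousLinearMap.ext fun Z => ?_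
  set Y : E × E := ofChart I.tangent (⟨α₀.proj, u₀⟩ : TangentBundle I M) (tulczyjew I X).proj Z
    with hY
  have hZ : toChart I.tangent (⟨α₀.proj, u₀⟩ : TangentBundle I M) (tulczyjew I X).proj Y = Z :=
    toChart_ofChart h_mem Z
  have hZ_fst : Z.1 = toChart I α₀.proj X.proj.proj Y.1 := by
    rw [← hZ, toChart_tangentBundle_apply (v₀ := (⟨α₀.proj, u₀⟩ : TangentBundle I M)) h₀]
    rfl
  have h_pairing := tulczyjew_pairing u₀ h₀ (vec X) Y.1 Y.2
  have hZ' : toChart I.tangent (⟨α₀.proj, u₀⟩ : TangentBundle I M)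
    (⟨X.proj.proj, (vec X).1⟩ : TangentBundle I M) (Y.1, Y.2) = Z := hZ
  rw [hZ', ← hZ_fst] at h_pairing
  rw [ContinuousLinearMap.comp_apply, ← hY, covec_tulczyjew]
  simp only [add_apply, ContinuousLinearMap.comp_apply, ContinuousLinearMap.coe_fst',
    ContinuousLinearMap.coe_snd']
  exact h_pairing.symm

theorem contMDiff_tulczyjew :
    ContMDiff (cotangentModel I).tangent (cotangentModel I.tangent) ∞ (tulczyjew I (M := M)) := by
  intro X₀
  obtain ⟨h_proj, h_vec⟩ := (contMDiffAt_tangentBundle (I := cotangentModel I) (n := ∞)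
    (f := (id : TangentBundle (cotangentModel I) (CotangentBundle I M) → _)) (x₀ := X₀)).1
    contMDiffAt_id
  obtain ⟨h_base, h_covec⟩ := (contMDiffAt_cotangentBundle (I := I) (n := ∞)).1 h_proj
  have h_chart : ∀ᶠ X in 𝓝 X₀, X.proj.proj ∈ (chartAt H X₀.proj.proj).source :=
    h_base.continuousAt.eventually ((chartAt H X₀.proj.proj).open_source.eventually_mem
      (mem_chart_source H _))
  refine contMDiffAt_cotangentBundle.2 ⟨contMDiffAt_tangentBundle.2 ⟨h_base, ?_⟩, ?_⟩
  · refine (contDiff_fst.contMDiff.contMDiffAt.comp X₀ h_vec).congr_of_eventuallyEq ?_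
    filter_upwards [h_chart] with X hX
    exact (toChart_cotangentBundle_fst hX (vec X)).symm
  · have h_dot := contDiff_snd.contMDiff.contMDiffAt.comp X₀ h_vec
    refine ((h_dot.clm_comp (contMDiffAt_const (c := ContinuousLinearMap.fst ℝ E E))).add
      (h_covec.clm_comp (contMDiffAt_const (c := ContinuousLinearMap.snd ℝ E E)))
        ).congr_of_eventuallyEq ?_
    filter_upwards [h_chart] with X hX
    exact covec_tulczyjew_comp_ofChart _ hX

end Tulczyjew

section FiniteDimensional

variable {E : Type*} [NormedAddCommGroup E] [NormedSpace ℝ E] [FiniteDimensional ℝ E]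

lemma isInvertible_of_injective {F : Type*} [NormedAddCommGroup F] [NormedSpace ℝ F]
    [FiniteDimensional ℝ F] {A : E →L[ℝ] F} (h : Function.Injective A)
    (hEF : Module.finrank ℝ E = Module.finrank ℝ F) : A.IsInvertible :=
  ⟨(LinearEquiv.ofInjectiveOfFinrankEq (A : E →ₗ[ℝ] F) h hEF).toContinuousLinearEquiv, rfl⟩

variable (E) in
lemma finrank_continuousDual : Module.finrank ℝ (E →L[ℝ] ℝ) = Module.finrank ℝ E :=
  (LinearMap.toContinuousLinearMap (𝕜 := ℝ) (E := E) (F' := ℝ)).finrank_eq.symm.trans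
    (Subspace.dual_finrank_eq (K := ℝ) (V := E))

end FiniteDimensional

/-! ### The Legendre map and the Euler–Lagrange field -/

section Legendre

variable {E : Type*} [NormedAddCommGroup E] [NormedSpace ℝ E]
  {H : Type*} [TopologicalSpace H] {I : ModelWithCorners ℝ E H}
  {M : Type*} [TopologicalSpace M] [ChartedSpace H M] [IsManifold I ∞ M]
  {L : TangentBundle I M → ℝ}

variable (L) in
/-- The coordinate expression of a function on `TM` in the chart of `TM` around `v₀`. -/
def inChart (v₀ : TangentBundle I M) : E × E → ℝ := L ∘ (extChartAt I.tangent v₀).symm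

lemma extChartAt_tangentBundle_self (v : TangentBundle I M) (u : E) :
    extChartAt I.tangent v (⟨v.proj, u⟩ : TangentBundle I M) = (extChartAt I v.proj v.proj, u) := by
  rw [extChartAt_tangentBundle, toChart_self]
  rfl

lemma extChartAt_tangentBundle_symm_self (v : TangentBundle I M) (u : E) :
    (extChartAt I.tangent v).symm (extChartAt I v.proj v.proj, u) = ⟨v.proj, u⟩ := by
  rw [← extChartAt_tangentBundle_self, (extChartAt I.tangent v).left_inv]
  rw [extChartAt_source]
  exact mem_chart_tangentBundle.2 (mem_chart_source H _)

lemma eventually_mem_chart_proj (v₀ : TangentBundle I M) :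
    ∀ᶠ v in 𝓝 v₀, v.proj ∈ (chartAt H v₀.proj).source :=
  (contMDiffAt_proj (n := 1) (IB := I) (TangentSpace I) (p := v₀)).continuousAt.eventually
    ((chartAt H v₀.proj).open_source.eventually_mem (mem_chart_source H _))

variable [I.Boundaryless]

lemma ofChart_tangentBundle_vertical {v₀ v : TangentBundle I M}
    (h : v.proj ∈ (chartAt H v₀.proj).source) (b : E) :
    ofChart I.tangent v₀ v (0, b) = (0, ofChart I v₀.proj v.proj b) := by
  have h_inv : toChart I.tangent v₀ v (0, ofChart I v₀.proj v.proj b) = (0, b) := by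
    rw [toChart_tangentBundle_apply h]
    simp [toChart_ofChart h]
  rw [← h_inv, ofChart_toChart (mem_chart_tangentBundle.2 h)]

section Smooth

variable (hL : ContMDiff I.tangent 𝓘(ℝ, ℝ) ∞ L) {v₀ v : TangentBundle I M}

include hL

lemma contDiffAt_inChart (h : v.proj ∈ (chartAt H v₀.proj).source) :
    ContDiffAt ℝ ∞ (inChart L v₀) (extChartAt I.tangent v₀ v) :=
  contDiffAt_inCharts (n := ⊤) (hL v) (mem_chart_tangentBundle.2 h) (mem_chart_source ℝ (L v))

lemma contDiffAt_fderiv_inChart (h : v.proj ∈ (chartAt H v₀.proj).source) :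
    ContDiffAt ℝ ∞ (fderiv ℝ (inChart L v₀)) (extChartAt I.tangent v₀ v) :=
  (contDiffAt_inChart hL h).fderiv_right le_rfl

lemma fderiv_inChart (h : v.proj ∈ (chartAt H v₀.proj).source) :
    fderiv ℝ (inChart L v₀) (extChartAt I.tangent v₀ v)
      = (modelDeriv I.tangent 𝓘(ℝ, ℝ) L v).comp (ofChart I.tangent v₀ v) := by
  have h_deriv := fderiv_inCharts ((hL v).mdifferentiableAt (by simp))
    (mem_chart_tangentBundle.2 h) (mem_chart_source ℝ (L v))
  rwa [toChart_self, ContinuousLinearMap.id_comp] at h_deriv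

variable (v)

lemma fderiv_inChart_self :
    fderiv ℝ (inChart L v) (extChartAt I.tangent v v) = modelDeriv I.tangent 𝓘(ℝ, ℝ) L v := by
  rw [fderiv_inChart hL (mem_chart_source H _), ofChart_self, ContinuousLinearMap.comp_id]

lemma hasFDerivAt_fiber (u : E) :
    HasFDerivAt (fun u : E => L ⟨v.proj, u⟩)
      ((fderiv ℝ (inChart L v) (extChartAt I v.proj v.proj, u)).comp
        (ContinuousLinearMap.inr ℝ E E)) u := by
  have h_smooth := contDiffAt_inChart hL (v₀ := v) (v := ⟨v.proj, u⟩) (mem_chart_source H _)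
  rw [extChartAt_tangentBundle_self] at h_smooth
  refine (HasFDerivAt.comp (f := fun u : E => (extChartAt I v.proj v.proj, u)) u
    (h_smooth.differentiableAt (by simp)).hasFDerivAt
    (hasFDerivAt_prodMk_right _ u)).congr_of_eventuallyEq (Eventually.of_forall fun w => ?_)
  rw [Function.comp_apply, inChart, Function.comp_apply, extChartAt_tangentBundle_symm_self]

lemma covec_legendre :
    covec (legendre I L v) = (modelDeriv I.tangent 𝓘(ℝ, ℝ) L v).comp
      (ContinuousLinearMap.inr ℝ E E) := by
  have h_point : extChartAt I.tangent v v = (extChartAt I v.proj v.proj, vec v) :=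
    extChartAt_tangentBundle_self v (vec v)
  rw [← fderiv_inChart_self hL, h_point]
  exact (hasFDerivAt_fiber hL v (vec v)).fderiv

variable {v}

lemma covec_legendre_comp_ofChart (h : v.proj ∈ (chartAt H v₀.proj).source) :
    (covec (legendre I L v)).comp (ofChart I v₀.proj v.proj) =
      (fderiv ℝ (inChart L v₀) (extChartAt I.tangent v₀ v)).comp
        (ContinuousLinearMap.inr ℝ E E) := by
  rw [covec_legendre hL, fderiv_inChart hL h]
  refine ContinuousLinearMap.ext fun b => ?_
  simp only [ContinuousLinearMap.comp_apply, ContinuousLinearMap.inr_apply]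
  rw [ofChart_tangentBundle_vertical h]

omit hL in
/-- The coordinate expression `(q, q̇) ↦ (q, ∂L/∂q̇)` of the Legendre map in the charts of `TM` and
`T^*M` induced by the chart of `M` around the base point of `v₀`. -/
def legendreInChart (L : TangentBundle I M → ℝ) (v₀ : TangentBundle I M) (y : E × E) :
    E × (E →L[ℝ] ℝ) :=
  (y.1, (fderiv ℝ (inChart L v₀) y).comp (ContinuousLinearMap.inr ℝ E E))

lemma extChartAt_legendre (h : v.proj ∈ (chartAt H v₀.proj).source) :
    extChartAt (cotangentModel I) (legendre I L v₀) (legendre I L v) =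
      legendreInChart L v₀ (extChartAt I.tangent v₀ v) :=
  (extChartAt_cotangentBundle h).trans (Prod.ext rfl (covec_legendre_comp_ofChart hL h))

lemma contDiffAt_legendreInChart (h : v.proj ∈ (chartAt H v₀.proj).source) :
    ContDiffAt ℝ ∞ (legendreInChart L v₀) (extChartAt I.tangent v₀ v) :=
  contDiffAt_fst.prodMk ((contDiffAt_fderiv_inChart hL h).clm_comp contDiffAt_const)

theorem contMDiff_legendre : ContMDiff I.tangent (cotangentModel I) ∞ (legendre I L) := by
  intro v₀
  refine contMDiffAt_cotangentBundle.2 ⟨contMDiffAt_proj (TangentSpace I), ?_⟩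
  have h_smooth : ContMDiffAt I.tangent 𝓘(ℝ, E →L[ℝ] ℝ) ∞
      (fun v => (fderiv ℝ (inChart L v₀) (extChartAt I.tangent v₀ v)).comp
        (ContinuousLinearMap.inr ℝ E E)) v₀ :=
    (((contDiffAt_fderiv_inChart hL (mem_chart_source H _)).contMDiffAt).comp v₀
      contMDiffAt_extChartAt).clm_comp contMDiffAt_const
  refine h_smooth.congr_of_eventuallyEq ?_
  filter_upwards [eventually_mem_chart_proj v₀] with v hv
  exact covec_legendre_comp_ofChart hL hv

lemma fderiv_legendreInChart (h : v.proj ∈ (chartAt H v₀.proj).source) :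
    fderiv ℝ (legendreInChart L v₀) (extChartAt I.tangent v₀ v) =
      (toChart (cotangentModel I) (legendre I L v₀) (legendre I L v)).comp
        ((modelDeriv I.tangent (cotangentModel I) (legendre I L) v).comp
          (ofChart I.tangent v₀ v)) := by
  have hv := mem_chart_tangentBundle.2 h
  rw [← fderiv_inCharts ((contMDiff_legendre hL v).mdifferentiableAt (by simp))
    hv (mem_chart_cotangentBundle.2 h)]
  refine Filter.EventuallyEq.fderiv_eq ?_
  have hv' : v ∈ (extChartAt I.tangent v₀).source := by rwa [extChartAt_source]
  filter_upwards [(isOpen_extChartAt_target v₀).mem_nhds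
    ((extChartAt I.tangent v₀).map_source hv')] with y hy
  have hy_mem := (extChartAt I.tangent v₀).map_target hy
  rw [extChartAt_source, mem_chart_tangentBundle] at hy_mem
  rw [Function.comp_apply, Function.comp_apply, extChartAt_legendre hL hy_mem,
    (extChartAt I.tangent v₀).right_inv hy]

omit hL in
/-- The full Hessian of `L`, in horizontal and vertical directions, in the preferred chart at `v`;
only its vertical part does not depend on the chart. -/
def hessian (L : TangentBundle I M → ℝ) (v : TangentBundle I M) : E × E →L[ℝ] E × E →L[ℝ] ℝ :=
  fderiv ℝ (fderiv ℝ (inChart L v)) (extChartAt I.tangent v v)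

variable (v)

lemma hasFDerivAt_fderiv_inChart :
    HasFDerivAt (fderiv ℝ (inChart L v)) (hessian L v) (extChartAt I.tangent v v) :=
  ((contDiffAt_fderiv_inChart hL (mem_chart_source H _)).differentiableAt (by simp)).hasFDerivAt

lemma hessian_symm (X Y : E × E) : hessian L v X Y = hessian L v Y X :=
  ((contDiffAt_inChart hL (mem_chart_source H _)).isSymmSndFDerivAt (by simp; norm_cast)).eq _ _

lemma hessian_vertical (a b : E) :
    fderiv ℝ (fderiv ℝ (fun u : E => L ⟨v.proj, u⟩)) (vec v) a b = hessian L v (0, a) (0, b) := by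
  have h_fderiv : fderiv ℝ (fun u : E => L ⟨v.proj, u⟩) = fun u =>
      (fderiv ℝ (inChart L v) (extChartAt I v.proj v.proj, u)).comp
        (ContinuousLinearMap.inr ℝ E E) := funext fun u => (hasFDerivAt_fiber hL v u).fderiv
  have h_point : extChartAt I.tangent v v = (extChartAt I v.proj v.proj, vec v) :=
    extChartAt_tangentBundle_self v (vec v)
  have h_hess := (HasFDerivAt.comp (f := fun u : E => (extChartAt I v.proj v.proj, u)) (vec v)
    (h_point ▸ hasFDerivAt_fderiv_inChart hL v) (hasFDerivAt_prodMk_right _ (vec v))).clm_comp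
      (hasFDerivAt_const (ContinuousLinearMap.inr ℝ E E) (vec v))
  rw [h_fderiv]
  exact (congrArg (fun A : E →L[ℝ] E →L[ℝ] ℝ => A a b) h_hess.fderiv).trans (by simp)

lemma modelDeriv_legendre (X : E × E) :
    modelDeriv I.tangent (cotangentModel I) (legendre I L) v X =
      (X.1, (hessian L v X).comp (ContinuousLinearMap.inr ℝ E E)) := by
  have h := fderiv_legendreInChart hL (v₀ := v) (v := v) (mem_chart_source H _)
  rw [toChart_self, ofChart_self, ContinuousLinearMap.comp_id, ContinuousLinearMap.id_comp] at h
  have h_deriv : HasFDerivAt (legendreInChart L v) _ (extChartAt I.tangent v v) :=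
    hasFDerivAt_fst.prodMk ((hasFDerivAt_fderiv_inChart hL v).clm_comp
      (hasFDerivAt_const (ContinuousLinearMap.inr ℝ E E) _))
  rw [← h, h_deriv.fderiv]
  simp

lemma lagrangeForm_apply (X Y : E × E) :
    lagrangeForm I L v X Y = hessian L v Y (0, X.1) - hessian L v X (0, Y.1) := by
  have h_form : lagrangeForm I L v X Y = canonicalForm I (legendre I L v)
    (modelDeriv I.tangent (cotangentModel I) (legendre I L) v X)
    (modelDeriv I.tangent (cotangentModel I) (legendre I L) v Y) := rfl
  rw [h_form, canonicalForm_apply, modelDeriv_legendre hL, modelDeriv_legendre hL]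
  simp

variable {v} in
lemma energy_eq_inChart (h : v.proj ∈ (chartAt H v₀.proj).source) :
    energy I L v = fderiv ℝ (inChart L v₀) (extChartAt I.tangent v₀ v)
      (0, (extChartAt I.tangent v₀ v).2) - inChart L v₀ (extChartAt I.tangent v₀ v) := by
  have h_pairing := DFunLike.congr_fun (covec_legendre_comp_ofChart hL h)
    (toChart I v₀.proj v.proj (vec v))
  simp only [ContinuousLinearMap.comp_apply, ofChart_toChart h] at h_pairing
  have h_inChart : inChart L v₀ (extChartAt I.tangent v₀ v) = L v := by
    rw [inChart, Function.comp_apply, (extChartAt I.tangent v₀).left_inv]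
    rw [extChartAt_source]
    exact mem_chart_tangentBundle.2 h
  rw [h_inChart]
  exact congrArg (· - L v) h_pairing

lemma modelDeriv_energy (X : E × E) :
    modelDeriv I.tangent 𝓘(ℝ, ℝ) (energy I L) v X =
      hessian L v X (0, vec v) - modelDeriv I.tangent 𝓘(ℝ, ℝ) L v (X.1, 0) := by
  set y₀ := extChartAt I.tangent v v with hy₀
  have hy₀_snd : y₀.2 = vec v := congrArg Prod.snd (extChartAt_tangentBundle_self v (vec v))
  have h_energy : energy I L =ᶠ[𝓝 v]
      (fun y : E × E => fderiv ℝ (inChart L v) y (0, y.2) - inChart L v y)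
        ∘ extChartAt I.tangent v :=
    (eventually_mem_chart_proj v).mono fun w hw => energy_eq_inChart hL hw
  have h_deriv : HasFDerivAt
      (fun y : E × E => fderiv ℝ (inChart L v) y (0, y.2) - inChart L v y) _ y₀ :=
    ((hasFDerivAt_fderiv_inChart hL v).clm_apply
      (((ContinuousLinearMap.inr ℝ E E).comp (ContinuousLinearMap.snd ℝ E E)).hasFDerivAt)).sub
    ((contDiffAt_inChart hL (mem_chart_source H _)).differentiableAt (by simp)).hasFDerivAt
  have hX : fderiv ℝ (inChart L v) y₀ X = fderiv ℝ (inChart L v) y₀ (X.1, 0) +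
      fderiv ℝ (inChart L v) y₀ (0, X.2) := by
    rw [← map_add, Prod.mk_add_mk, add_zero, zero_add]
  rw [modelDeriv_congr h_energy, modelDeriv_comp (I' := 𝓘(ℝ, E × E))
    (f := extChartAt I.tangent v) h_deriv.differentiableAt.mdifferentiableAt
    (mdifferentiableAt_extChartAt (mem_chart_source _ v)),
    modelDeriv_extChartAt (mem_chart_source _ v), toChart_self, ContinuousLinearMap.comp_id,
    modelDeriv_eq_fderiv, h_deriv.fderiv, ← fderiv_inChart_self hL]
  simp only [← hy₀, sub_apply, add_apply, ContinuousLinearMap.comp_apply,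
    ContinuousLinearMap.flip_apply, ContinuousLinearMap.inr_apply,
    ContinuousLinearMap.coe_snd', hX, hy₀_snd]
  ring

end Smooth

lemma hessian_nondegenerate (hL : IsRegularLagrangian I L) (v : TangentBundle I M) (a : E)
    (h : ∀ b, hessian L v (0, a) (0, b) = 0) : a = 0 :=
  hL.nondegenerate v.proj (vec v) a fun b => by rw [hessian_vertical hL.smooth, h]

lemma isInvertible_modelDeriv_legendre [FiniteDimensional ℝ E] (hL : IsRegularLagrangian I L)
    (v : TangentBundle I M) :
    (modelDeriv I.tangent (cotangentModel I) (legendre I L) v).IsInvertible := by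
  refine isInvertible_of_injective ((injective_iff_map_eq_zero _).2 ?_) ?_
  · rintro ⟨a, b⟩ hX
    rw [modelDeriv_legendre hL.smooth, Prod.mk_eq_zero] at hX
    obtain ⟨rfl, hb⟩ := hX
    rw [Prod.mk_eq_zero]
    exact ⟨rfl, hessian_nondegenerate hL v b fun w => DFunLike.congr_fun hb w⟩
  · rw [Module.finrank_prod, Module.finrank_prod, finrank_continuousDual]

/-- In coordinates: `Γ` is the vector field of the second-order equation
`d/dt (q, ∂L/∂q̇) = (q̇, ∂L/∂q)`. -/
theorem isEulerLagrangeField_iff (hL : IsRegularLagrangian I L)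
    {Γ : ∀ v : TangentBundle I M, TangentSpace I.tangent v} :
    IsEulerLagrangeField I L Γ ↔ ∀ v,
      modelDeriv I.tangent (cotangentModel I) (legendre I L) v (Γ v) =
        (vec v, (modelDeriv I.tangent 𝓘(ℝ, ℝ) L v).comp (ContinuousLinearMap.inl ℝ E E)) := by
  refine forall_congr' fun v => ?_
  generalize Γ v = G
  revert G
  change ∀ G : E × E, (∀ X : E × E, lagrangeForm I L v G X =
    modelDeriv I.tangent 𝓘(ℝ, ℝ) (energy I L) v X) ↔ _
  rintro ⟨G₁, G₂⟩
  simp only [lagrangeForm_apply hL.smooth, modelDeriv_energy hL.smooth,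
    modelDeriv_legendre hL.smooth, Prod.mk.injEq]
  constructor
  · intro h
    have h_fst : G₁ = vec v := by
      refine sub_eq_zero.1 (hessian_nondegenerate hL v _ fun b => ?_)
      have hb := h (0, b)
      have h_sub : ((0 : E), G₁ - vec v) = (0, G₁) - (0, vec v) := by simp
      rw [hessian_symm hL.smooth, h_sub, map_sub, sub_eq_zero]
      simpa [Prod.mk_zero_zero] using hb
    refine ⟨h_fst, ContinuousLinearMap.ext fun a => ?_⟩
    have ha := h (a, 0)
    rw [h_fst] at ha
    simpa [h_fst] using ha
  · rintro ⟨rfl, h⟩ X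
    exact congrArg (hessian L v X (0, vec v) - ·) (DFunLike.congr_fun h X.1)

theorem existsUnique_eulerLagrangeField [FiniteDimensional ℝ E] (hL : IsRegularLagrangian I L) :
    ∃! Γ, IsEulerLagrangeField I L Γ := by
  simp only [isEulerLagrangeField_iff hL]
  choose Γ hΓ using fun v => (isInvertible_modelDeriv_legendre hL v).surjective
    (vec v, (modelDeriv I.tangent 𝓘(ℝ, ℝ) L v).comp (ContinuousLinearMap.inl ℝ E E))
  exact ⟨Γ, hΓ, fun Γ' hΓ' => funext fun v =>
    (isInvertible_modelDeriv_legendre hL v).injective ((hΓ' v).trans (hΓ v).symm)⟩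

end Legendre

section EulerLagrange

variable {E : Type*} [NormedAddCommGroup E] [NormedSpace ℝ E]
  {H : Type*} [TopologicalSpace H] {I : ModelWithCorners ℝ E H}
  {M : Type*} [TopologicalSpace M] [ChartedSpace H M] [IsManifold I ∞ M]
  {L : TangentBundle I M → ℝ}

/-- The tangent vector `TFL (h Γ(v))` of `T^*M`. -/
def legendreLift (L : TangentBundle I M → ℝ) (Γ : ∀ v : TangentBundle I M, TangentSpace I.tangent v)
    (h : ℝ) (v : TangentBundle I M) : TangentBundle (cotangentModel I) (CotangentBundle I M) :=
  tangentMap I.tangent (cotangentModel I) (legendre I L) ⟨v, h • Γ v⟩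

variable [I.Boundaryless] (hL : IsRegularLagrangian I L)
  {Γ : ∀ v : TangentBundle I M, TangentSpace I.tangent v} (hΓ : IsEulerLagrangeField I L Γ)

include hL hΓ

lemma vec_legendreLift (h : ℝ) (v : TangentBundle I M) :
    vec (legendreLift L Γ h v) = (h • vec v,
      h • (modelDeriv I.tangent 𝓘(ℝ, ℝ) L v).comp (ContinuousLinearMap.inl ℝ E E)) :=
  ((modelDeriv I.tangent (cotangentModel I) (legendre I L) v).map_smul h (Γ v)).trans
    (congrArg (h • ·) ((isEulerLagrangeField_iff hL).1 hΓ v))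

lemma tulczyjew_legendreLift_proj (h : ℝ) (v : TangentBundle I M) :
    (tulczyjew I (legendreLift L Γ h v)).proj = ⟨v.proj, h • vec v⟩ :=
  congrArg (fun X : E × (E →L[ℝ] ℝ) => (⟨v.proj, X.1⟩ : TangentBundle I M))
    (vec_legendreLift hL hΓ h v)

lemma covec_tulczyjew_legendreLift (h : ℝ) (v : TangentBundle I M) (X : E × E) :
    covec (tulczyjew I (legendreLift L Γ h v)) X =
      modelDeriv I.tangent 𝓘(ℝ, ℝ) L v (h • X.1, X.2) := by
  have h_base : covec (legendreLift L Γ h v).proj = covec (legendre I L v) := rfl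
  have hX : (h • X.1, X.2) = h • ((X.1, 0) : E × E) + (0, X.2) := by simp
  rw [covec_tulczyjew, vec_legendreLift hL hΓ, h_base, covec_legendre hL.smooth, hX, map_add,
    map_smul]
  simp

lemma fderiv_legendreInChart_toChart {v₀ v : TangentBundle I M}
    (h : v.proj ∈ (chartAt H v₀.proj).source) :
    fderiv ℝ (legendreInChart L v₀) (extChartAt I.tangent v₀ v) (toChart I.tangent v₀ v (Γ v)) =
      ((extChartAt I.tangent v₀ v).2, (fderiv ℝ (inChart L v₀) (extChartAt I.tangent v₀ v)).comp
        (ContinuousLinearMap.inl ℝ E E)) := by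
  have h_tangent : fderiv ℝ (legendreInChart L v₀) (extChartAt I.tangent v₀ v)
      (toChart I.tangent v₀ v (Γ v)) =
        toChart (cotangentModel I) (legendre I L v₀) (legendre I L v)
          (vec (legendreLift L Γ 1 v)) := by
    have h_vec : vec (legendreLift L Γ 1 v) =
        modelDeriv I.tangent (cotangentModel I) (legendre I L) v ((1 : ℝ) • (Γ v : E × E)) := rfl
    rw [fderiv_legendreInChart hL.smooth h, h_vec, one_smul]
    exact congrArg (fun G : E × E => toChart (cotangentModel I) (legendre I L v₀) (legendre I L v)
      (modelDeriv I.tangent (cotangentModel I) (legendre I L) v G))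
      (ofChart_toChart (I := I.tangent) (mem_chart_tangentBundle.2 h) (Γ v : E × E))
  have h_proj : (tulczyjew I (legendreLift L Γ 1 v)).proj = v := by
    rw [tulczyjew_legendreLift_proj hL hΓ, one_smul]
    rfl
  have h_covec : covec (tulczyjew I (legendreLift L Γ 1 v)) =
      modelDeriv I.tangent 𝓘(ℝ, ℝ) L v := by
    refine ContinuousLinearMap.ext fun Z => ?_
    rw [covec_tulczyjew_legendreLift hL hΓ, one_smul]
  have h_chart := covec_tulczyjew_comp_ofChart (α₀ := legendre I L v₀) (vec v₀)
    (X := legendreLift L Γ 1 v) h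
  rw [h_covec, h_proj] at h_chart
  rw [h_tangent]
  refine Prod.ext ?_ ?_
  · rw [toChart_cotangentBundle_fst (α₀ := legendre I L v₀) (α := legendre I L v) h,
      vec_legendreLift hL hΓ, one_smul]
    rfl
  · refine Eq.trans (ContinuousLinearMap.ext fun a => ?_) (congrArg
      (fun A : E × E →L[ℝ] ℝ => A.comp (ContinuousLinearMap.inl ℝ E E))
      (h_chart.symm.trans (fderiv_inChart hL.smooth h).symm))
    simp
    rfl

theorem contMDiff_eulerLagrangeField [FiniteDimensional ℝ E] :
    ContMDiff I.tangent I.tangent.tangent ∞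
      (fun v => (⟨v, Γ v⟩ : TangentBundle I.tangent (TangentBundle I M))) := by
  intro v₀
  have := FiniteDimensional.complete ℝ E
  refine contMDiffAt_tangentBundle.2 ⟨contMDiffAt_id, ?_⟩
  have h_chart : ContMDiffAt I.tangent 𝓘(ℝ, E × E) ∞ (extChartAt I.tangent v₀) v₀ :=
    contMDiffAt_extChartAt
  have h_inv {v : TangentBundle I M} (hv : v.proj ∈ (chartAt H v₀.proj).source) :
      (fderiv ℝ (legendreInChart L v₀) (extChartAt I.tangent v₀ v)).IsInvertible := by
    rw [fderiv_legendreInChart hL.smooth hv]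
    exact (isInvertible_toChart (mem_chart_cotangentBundle.2 hv)).comp
      ((isInvertible_modelDeriv_legendre hL v).comp
        (isInvertible_ofChart (mem_chart_tangentBundle.2 hv)))
  have h_inverse : ContDiffAt ℝ ∞ (fun y => (fderiv ℝ (legendreInChart L v₀) y).inverse)
      (extChartAt I.tangent v₀ v₀) :=
    (h_inv (mem_chart_source H _)).contDiffAt_map_inverse.comp _
      ((contDiffAt_legendreInChart hL.smooth (mem_chart_source H _)).fderiv_right le_rfl)
  have h_force : ContDiffAt ℝ ∞ (fun y : E × E => (y.2, (fderiv ℝ (inChart L v₀) y).comp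
      (ContinuousLinearMap.inl ℝ E E))) (extChartAt I.tangent v₀ v₀) :=
    contDiffAt_snd.prodMk ((contDiffAt_fderiv_inChart hL.smooth (mem_chart_source H _)).clm_comp
      contDiffAt_const)
  refine ((h_inverse.clm_apply h_force).contMDiffAt.comp v₀ h_chart).congr_of_eventuallyEq ?_
  filter_upwards [eventually_mem_chart_proj v₀] with v hv
  exact ((h_inv hv).inverse_apply_eq.2 (fderiv_legendreInChart_toChart hL hΓ hv).symm).symm

end EulerLagrange

/-! ### Discretization maps -/

section ZeroSection

variable {E : Type*} [NormedAddCommGroup E] [NormedSpace ℝ E]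
  {H : Type*} [TopologicalSpace H] {I : ModelWithCorners ℝ E H}
  {M : Type*} [TopologicalSpace M] [ChartedSpace H M]

variable [IsManifold I ∞ M]

/-- The inclusion of the fibre `T_qM`, identified with the model space, into `TM`. -/
def fiberInclusion (I : ModelWithCorners ℝ E H) (q : M) (u : E) : TangentBundle I M := ⟨q, u⟩

lemma contMDiff_fiberInclusion (q : M) :
    ContMDiff 𝓘(ℝ, E) I.tangent ∞ (fiberInclusion I q) := by
  refine fun u => contMDiffAt_tangentBundle.2 ⟨contMDiffAt_const, ?_⟩
  change ContMDiffAt 𝓘(ℝ, E) 𝓘(ℝ, E) ∞ (toChart I q q) u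
  rw [toChart_self]
  exact contMDiffAt_id

lemma modelDeriv_fiberInclusion (q : M) (u : E) :
    modelDeriv 𝓘(ℝ, E) I.tangent (fiberInclusion I q) u = ContinuousLinearMap.inr ℝ E E := by
  rw [modelDeriv_eq_fderiv_extChartAt
    ((contMDiff_fiberInclusion (I := I) q u).mdifferentiableAt (by simp))]
  have h_chart : extChartAt I.tangent (fiberInclusion I q u) ∘ fiberInclusion I q =
      fun w : E => (extChartAt I q q, w) :=
    funext fun w => extChartAt_tangentBundle_self (fiberInclusion I q u) w
  rw [h_chart]
  exact (hasFDerivAt_prodMk_right _ _).fderiv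

lemma contMDiff_zeroTangent :
    ContMDiff I I.tangent ∞ (fun q : M => (⟨q, 0⟩ : TangentBundle I M)) := by
  refine fun q => contMDiffAt_tangentBundle.2 ⟨contMDiffAt_id, ?_⟩
  refine (contMDiffAt_const (c := (0 : E))).congr_of_eventuallyEq (Eventually.of_forall fun w => ?_)
  exact map_zero (toChart I q w)

variable [I.Boundaryless]

lemma modelDeriv_zeroTangent (q : M) :
    modelDeriv I I.tangent (fun q : M => (⟨q, 0⟩ : TangentBundle I M)) q
      = ContinuousLinearMap.inl ℝ E E := by
  have h := fderiv_inCharts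
    ((contMDiff_zeroTangent (I := I) q).mdifferentiableAt (by simp))
    (mem_chart_source H q) (mem_chart_source (ModelProd H E) (⟨q, 0⟩ : TangentBundle I M))
  rw [toChart_self, ofChart_self, ContinuousLinearMap.comp_id, ContinuousLinearMap.id_comp] at h
  rw [← h]
  refine (Filter.EventuallyEq.fderiv_eq (f := fun x : E => (x, (0 : E))) ?_).trans
    (hasFDerivAt_prodMk_left _ _).fderiv
  filter_upwards [extChartAt_target_mem_nhds (I := I) q] with x hx
  exact Prod.ext ((extChartAt I q).right_inv hx) (map_zero (toChart I q _))

lemma modelDeriv_apply_split {F : Type*} [NormedAddCommGroup F] [NormedSpace ℝ F] {G : Type*}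
    [TopologicalSpace G] {J : ModelWithCorners ℝ F G} {N : Type*} [TopologicalSpace N]
    [ChartedSpace G N] {f : TangentBundle I M → N} {q : M}
    (hf : MDifferentiableAt I.tangent J f ⟨q, 0⟩) (Y : E × E) :
    modelDeriv I.tangent J f ⟨q, 0⟩ Y =
      modelDeriv I J (fun x : M => f ⟨x, 0⟩) q Y.1 +
      modelDeriv 𝓘(ℝ, E) J (fun u : E => f ⟨q, u⟩) 0 Y.2 := by
  have h_zero := modelDeriv_comp (I := I) (f := fun q : M => (⟨q, 0⟩ : TangentBundle I M)) (x := q)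
    hf ((contMDiff_zeroTangent (I := I) q).mdifferentiableAt (by simp))
  have h_fiber := modelDeriv_comp (I := 𝓘(ℝ, E)) (f := fiberInclusion I q) (x := 0) hf
    ((contMDiff_fiberInclusion (I := I) q 0).mdifferentiableAt (by simp))
  rw [modelDeriv_zeroTangent] at h_zero
  rw [modelDeriv_fiberInclusion] at h_fiber
  have h_fst : modelDeriv I J (fun x : M => f ⟨x, 0⟩) q Y.1 =
    modelDeriv I.tangent J f ⟨q, 0⟩ (Y.1, 0) := DFunLike.congr_fun h_zero Y.1
  have h_snd : modelDeriv 𝓘(ℝ, E) J (fun u : E => f ⟨q, u⟩) 0 Y.2 =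
    modelDeriv I.tangent J f ⟨q, 0⟩ (0, Y.2) := DFunLike.congr_fun h_fiber Y.2
  rw [h_fst, h_snd, ← map_add]
  simp

lemma modelDeriv_apply_of_map_zero {r : TangentBundle I M → M} {q : M}
    (hr : MDifferentiableAt I.tangent I r ⟨q, 0⟩) (h_zero : ∀ x : M, r ⟨x, 0⟩ = x) (Y : E × E) :
    modelDeriv I.tangent I r ⟨q, 0⟩ Y =
      Y.1 + modelDeriv 𝓘(ℝ, E) I (fun u : E => r ⟨q, u⟩) 0 Y.2 := by
  have h_id : (fun x : M => r ⟨x, 0⟩) = id := funext h_zero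
  rw [modelDeriv_apply_split hr, h_id, modelDeriv_id]
  rfl

end ZeroSection

section DiscretizationMap

variable {E : Type*} [NormedAddCommGroup E] [NormedSpace ℝ E]
  {H : Type*} [TopologicalSpace H] {I : ModelWithCorners ℝ E H}
  {M : Type*} [TopologicalSpace M] [ChartedSpace H M]
  {U : Set (TangentBundle I M)} {R : TangentBundle I M → M × M}

/-- The derivative at the origin of the first component of `R` along the fibre `T_qM`; it is an
endomorphism of `T_qM` when `R (q, 0) = (q, q)`. -/
def fiberDeriv₁ (R : TangentBundle I M → M × M) (q : M) : E →L[ℝ] E :=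
  modelDeriv 𝓘(ℝ, E) I (fun u : E => (R ⟨q, u⟩).1) 0

/-- The derivative at the origin of the second component of `R` along the fibre `T_qM`; it is an
endomorphism of `T_qM` when `R (q, 0) = (q, q)`. -/
def fiberDeriv₂ (R : TangentBundle I M → M × M) (q : M) : E →L[ℝ] E :=
  modelDeriv 𝓘(ℝ, E) I (fun u : E => (R ⟨q, u⟩).2) 0

namespace IsDiscretizationMap

lemma contMDiffAt [IsManifold I 1 M] (h : IsDiscretizationMap I U R) {v : TangentBundle I M}
    (hv : v ∈ U) : ContMDiffAt I.tangent (I.prod I) ∞ R v :=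
  h.smooth.contMDiffAt (h.isOpen.mem_nhds hv)

lemma fiberDeriv_sub [IsManifold I 1 M] (h : IsDiscretizationMap I U R) (q : M) (u : E) :
    fiberDeriv₂ R q u - fiberDeriv₁ R q u = u := h.rigidity q u

variable [IsManifold I ∞ M] [I.Boundaryless]

lemma modelDeriv_fst_zero (h : IsDiscretizationMap I U R) (q : M) (Y : E × E) :
    modelDeriv I.tangent I (fun v => (R v).1) ⟨q, 0⟩ Y = Y.1 + fiberDeriv₁ R q Y.2 :=
  modelDeriv_apply_of_map_zero
    ((contMDiffAt_fst.comp _ (h.contMDiffAt (h.zero_mem q))).mdifferentiableAt (by simp))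
    (fun x => congrArg Prod.fst (h.map_zero x)) Y

lemma modelDeriv_snd_zero (h : IsDiscretizationMap I U R) (q : M) (Y : E × E) :
    modelDeriv I.tangent I (fun v => (R v).2) ⟨q, 0⟩ Y = Y.1 + fiberDeriv₂ R q Y.2 :=
  modelDeriv_apply_of_map_zero
    ((contMDiffAt_snd.comp _ (h.contMDiffAt (h.zero_mem q))).mdifferentiableAt (by simp))
    (fun x => congrArg Prod.snd (h.map_zero x)) Y

lemma modelDeriv_zero (h : IsDiscretizationMap I U R) (q : M) (Y : E × E) :
    modelDeriv I.tangent (I.prod I) R ⟨q, 0⟩ Y =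
      (Y.1 + fiberDeriv₁ R q Y.2, Y.1 + fiberDeriv₂ R q Y.2) := by
  have hd := (h.contMDiffAt (h.zero_mem q)).mdifferentiableAt (by simp)
  rw [← h.modelDeriv_fst_zero, ← h.modelDeriv_snd_zero, modelDeriv_fst_comp hd,
    modelDeriv_snd_comp hd]
  rfl

lemma modelDeriv_zero_sub (h : IsDiscretizationMap I U R) (q : M) (a₀ a₁ : E) :
    modelDeriv I.tangent (I.prod I) R ⟨q, 0⟩ (a₀ - fiberDeriv₁ R q (a₁ - a₀), a₁ - a₀) =
      (a₀, a₁) := by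
  rw [h.modelDeriv_zero]
  refine Prod.ext (sub_add_cancel _ _) ?_
  change a₀ - fiberDeriv₁ R q (a₁ - a₀) + fiberDeriv₂ R q (a₁ - a₀) = a₁
  rw [sub_add_eq_add_sub, add_sub_assoc, h.fiberDeriv_sub, add_sub_cancel]

lemma isInvertible_modelDeriv_zero [FiniteDimensional ℝ E] (h : IsDiscretizationMap I U R)
    (q : M) : (modelDeriv I.tangent (I.prod I) R ⟨q, 0⟩).IsInvertible := by
  refine isInvertible_of_injective (LinearMap.injective_iff_surjective.2 fun a => ?_) rfl
  exact ⟨_, h.modelDeriv_zero_sub q a.1 a.2⟩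

end IsDiscretizationMap

end DiscretizationMap

/-! ### The cotangent lift of a discretization map -/

section ProductCharts

variable {E : Type*} [NormedAddCommGroup E] [NormedSpace ℝ E]
  {H : Type*} [TopologicalSpace H] {I : ModelWithCorners ℝ E H}
  {M : Type*} [TopologicalSpace M] [ChartedSpace H M] [IsManifold I ∞ M]
  {E' : Type*} [NormedAddCommGroup E'] [NormedSpace ℝ E']
  {H' : Type*} [TopologicalSpace H'] {J : ModelWithCorners ℝ E' H'}
  {N : Type*} [TopologicalSpace N] [ChartedSpace H' N] [IsManifold J ∞ N]

lemma ofChart_prod {r₀ r : M} {s₀ s : N}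
    (hr : r ∈ (chartAt H r₀).source) (hs : s ∈ (chartAt H' s₀).source) :
    ofChart (I.prod J) (r₀, s₀) (r, s) = (ofChart I r₀ r).prodMap (ofChart J s₀ s) := by
  rw [← extChartAt_source I] at hr
  rw [← extChartAt_source J] at hs
  have h_prod : (r, s) ∈ (extChartAt (I.prod J) (r₀, s₀)).source := by
    rw [extChartAt_prod]
    exact ⟨hr, hs⟩
  have h_fst := hasFDerivWithinAt_tangentCoordChange ⟨hr, mem_extChartAt_source (I := I) r⟩
  have h_snd := hasFDerivWithinAt_tangentCoordChange ⟨hs, mem_extChartAt_source (I := J) s⟩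
  have h_map := HasFDerivWithinAt.prodMap (p := extChartAt (I.prod J) (r₀, s₀) (r, s))
    (s := range (I.prod J)) (h_fst.mono ?_) (h_snd.mono ?_)
  · have h_chart : extChartAt (I.prod J) (r, s) ∘ (extChartAt (I.prod J) (r₀, s₀)).symm =
        Prod.map (extChartAt I r ∘ (extChartAt I r₀).symm)
          (extChartAt J s ∘ (extChartAt J s₀).symm) := by
      rw [extChartAt_prod, extChartAt_prod]
      rfl
    have h_pair := hasFDerivWithinAt_tangentCoordChange
      ⟨h_prod, mem_extChartAt_source (I := I.prod J) (r, s)⟩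
    rw [h_chart] at h_pair
    exact UniqueDiffWithinAt.eq ((I.prod J).uniqueDiffOn _ (mem_range_self _)) h_pair h_map
  · rintro _ ⟨_, ⟨x, rfl⟩, rfl⟩
    exact mem_range_self x.1
  · rintro _ ⟨_, ⟨x, rfl⟩, rfl⟩
    exact mem_range_self x.2

end ProductCharts

section CotangentLift

variable {E : Type*} [NormedAddCommGroup E] [NormedSpace ℝ E]
  {H : Type*} [TopologicalSpace H] {I : ModelWithCorners ℝ E H}
  {M : Type*} [TopologicalSpace M] [ChartedSpace H M] [IsManifold I ∞ M]

lemma contMDiff_splitCotangent :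
    ContMDiff (cotangentModel (I.prod I)) ((cotangentModel I).prod (cotangentModel I)) ∞
      (splitCotangent I (M := M)) := by
  intro β₀
  obtain ⟨h_proj, h_covec⟩ := (contMDiffAt_cotangentBundle (I := I.prod I) (M := M × M) (n := ∞)
    (f := (id : CotangentBundle (I.prod I) (M × M) → _)) (x₀ := β₀)).1 contMDiffAt_id
  have h_charts : ∀ᶠ β : CotangentBundle (I.prod I) (M × M) in 𝓝 β₀,
      ofChart (I.prod I) β₀.proj β.proj =
        (ofChart I β₀.proj.1 β.proj.1).prodMap (ofChart I β₀.proj.2 β.proj.2) := by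
    filter_upwards [h_proj.continuousAt.eventually
      ((chartAt (ModelProd H H) β₀.proj).open_source.eventually_mem (mem_chart_source _ _))]
      with β hβ
    have hβ' : β.proj ∈ (chartAt H β₀.proj.1).source ×ˢ (chartAt H β₀.proj.2).source := by
      simpa only [mfld_simps] using hβ
    exact ofChart_prod hβ'.1 hβ'.2
  refine ContMDiffAt.prodMk
    (contMDiffAt_cotangentBundle.2 ⟨contMDiffAt_fst.comp β₀ h_proj, ?_⟩)
    (contMDiffAt_cotangentBundle.2 ⟨contMDiffAt_snd.comp β₀ h_proj, ?_⟩)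
  · refine (h_covec.clm_comp (contMDiffAt_const
      (c := ContinuousLinearMap.inl ℝ E E))).neg.congr_of_eventuallyEq ?_
    filter_upwards [h_charts] with β hβ
    refine ContinuousLinearMap.ext fun a => congrArg Neg.neg (congrArg (covec β) ?_)
    change _ = ofChart (I.prod I) β₀.proj β.proj _
    rw [hβ]
    simp
  · refine (h_covec.clm_comp (contMDiffAt_const
      (c := ContinuousLinearMap.inr ℝ E E))).congr_of_eventuallyEq ?_
    filter_upwards [h_charts] with β hβ
    refine ContinuousLinearMap.ext fun a => congrArg (covec β) ?_
    change _ = ofChart (I.prod I) β₀.proj β.proj _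
    rw [hβ]
    simp

variable [I.Boundaryless] {R : TangentBundle I M → M × M}

lemma covec_cotangentLift_comp_ofChart {β : CotangentBundle I.tangent (TangentBundle I M)}
    {v₀ : TangentBundle I M} {r₀ : M × M}
    (hR : MDifferentiableAt I.tangent (I.prod I) R β.proj)
    (hβ : β.proj ∈ (chartAt (ModelProd H E) v₀).source)
    (hr : R β.proj ∈ (chartAt (ModelProd H H) r₀).source) :
    (covec (cotangentLift I R β)).comp (ofChart (I.prod I) r₀ (R β.proj)) =
      ((covec β).comp (ofChart I.tangent v₀ β.proj)).comp
        (fderiv ℝ (extChartAt (I.prod I) r₀ ∘ R ∘ (extChartAt I.tangent v₀).symm)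
          (extChartAt I.tangent v₀ β.proj)).inverse := by
  have h_inv : (toChart (I.prod I) r₀ (R β.proj)).inverse = ofChart (I.prod I) r₀ (R β.proj) :=
    ContinuousLinearMap.inverse_eq (toChart_comp_ofChart hr) (ofChart_comp_toChart hr)
  rw [fderiv_inCharts (I := I.tangent) (I' := I.prod I) hR hβ hr,
    (isInvertible_toChart hr).inverse_comp_of_left,
    (isInvertible_ofChart hβ).inverse_comp_of_right, h_inv,
    ContinuousLinearMap.inverse_eq (ofChart_comp_toChart hβ) (toChart_comp_ofChart hβ)]
  refine ContinuousLinearMap.ext fun Z => congrArg (covec β) ?_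
  exact (ofChart_toChart (I := I.tangent) hβ _).symm

theorem contMDiffAt_cotangentLift [CompleteSpace E]
    {β₀ : CotangentBundle I.tangent (TangentBundle I M)}
    (hR : ContMDiffAt I.tangent (I.prod I) ∞ R β₀.proj)
    (h_inv : (modelDeriv I.tangent (I.prod I) R β₀.proj).IsInvertible) :
    ContMDiffAt (cotangentModel I.tangent) (cotangentModel (I.prod I)) ∞
      (cotangentLift I R) β₀ := by
  obtain ⟨h_proj, h_covec⟩ := (contMDiffAt_cotangentBundle (I := I.tangent) (n := ∞)
    (M := TangentBundle I M) (f := (id : CotangentBundle I.tangent (TangentBundle I M) → _))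
    (x₀ := β₀)).1 contMDiffAt_id
  have h_source := mem_chart_source (ModelProd H E) β₀.proj
  have h_target := mem_chart_source (ModelProd H H) (R β₀.proj)
  have h_R := hR.comp β₀ h_proj
  have h_deriv : ContDiffAt ℝ ∞ (fun y => (fderiv ℝ (extChartAt (I.prod I) (R β₀.proj) ∘ R ∘
      (extChartAt I.tangent β₀.proj).symm) y).inverse) (extChartAt I.tangent β₀.proj β₀.proj) :=
    ((isInvertible_modelDeriv_iff (hR.mdifferentiableAt (by simp)) h_source h_target).1
      h_inv).contDiffAt_map_inverse.comp _
        ((contDiffAt_inCharts (n := ⊤) hR h_source h_target).fderiv_right le_rfl)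
  refine contMDiffAt_cotangentBundle.2 ⟨h_R, ?_⟩
  refine (h_covec.clm_comp (h_deriv.contMDiffAt.comp β₀
    (contMDiffAt_extChartAt.comp β₀ h_proj))).congr_of_eventuallyEq ?_
  have h_smooth : ∀ᶠ v in 𝓝 β₀.proj, ContMDiffAt I.tangent (I.prod I) 1 R v :=
    (contMDiffAt_iff_contMDiffAt_nhds (n := 1) (by simp)).1 (hR.of_le (by simp))
  filter_upwards [h_proj.continuousAt.eventually h_smooth, h_proj.continuousAt.eventually
      ((chartAt (ModelProd H E) β₀.proj).open_source.eventually_mem h_source),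
    h_R.continuousAt.eventually
      ((chartAt (ModelProd H H) (R β₀.proj)).open_source.eventually_mem h_target)] with β h₁ h₂ h₃
  exact covec_cotangentLift_comp_ofChart (h₁.mdifferentiableAt one_ne_zero) h₂ h₃

end CotangentLift

section CotangentDiscretization

variable {E : Type*} [NormedAddCommGroup E] [NormedSpace ℝ E]
  {H : Type*} [TopologicalSpace H] {I : ModelWithCorners ℝ E H}
  {M : Type*} [TopologicalSpace M] [ChartedSpace H M] [IsManifold I ∞ M]

omit [IsManifold I ∞ M] in
lemma cotangent_ext {α β : CotangentBundle I M} (h_proj : α.proj = β.proj)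
    (h_covec : covec α = covec β) : α = β := by
  obtain ⟨q, p⟩ := α
  obtain ⟨q', p'⟩ := β
  cases h_proj
  exact congrArg (TotalSpace.mk q) h_covec

lemma liouvillePullback_splitCotangent (β : CotangentBundle (I.prod I) (M × M)) :
    liouvillePullback (cotangentModel (I.prod I)) (fun β => (splitCotangent I β).2) β -
      liouvillePullback (cotangentModel (I.prod I)) (fun β => (splitCotangent I β).1) β =
      liouvillePullback (cotangentModel (I.prod I)) id β := by
  have h_proj := mdifferentiableAt_cotangentProj β
  refine ContinuousLinearMap.ext fun Y => ?_
  set a : E × E := modelDeriv (cotangentModel (I.prod I)) (I.prod I) TotalSpace.proj β Y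
  have h_fst : modelDeriv (cotangentModel (I.prod I)) I (fun β => β.proj.1) β Y = a.1 := by
    rw [modelDeriv_fst_comp h_proj]
    rfl
  have h_snd : modelDeriv (cotangentModel (I.prod I)) I (fun β => β.proj.2) β Y = a.2 := by
    rw [modelDeriv_snd_comp h_proj]
    rfl
  change covec β (0, modelDeriv (cotangentModel (I.prod I)) I (fun β => β.proj.2) β Y) -
    -covec β (modelDeriv (cotangentModel (I.prod I)) I (fun β => β.proj.1) β Y, 0) = covec β a
  rw [h_fst, h_snd, sub_neg_eq_add, ← map_add]
  simp

lemma liouvillePullback_cotangentLift {R : TangentBundle I M → M × M}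
    {β : CotangentBundle I.tangent (TangentBundle I M)}
    (hR : MDifferentiableAt I.tangent (I.prod I) R β.proj)
    (h_inv : (modelDeriv I.tangent (I.prod I) R β.proj).IsInvertible) :
    liouvillePullback (cotangentModel I.tangent) (cotangentLift I R) β =
      liouvillePullback (cotangentModel I.tangent) id β := by
  refine ContinuousLinearMap.ext fun Y => congrArg (covec β) ?_
  have h_comp : modelDeriv (cotangentModel I.tangent) (I.prod I) (fun β => R β.proj) β =
      (modelDeriv I.tangent (I.prod I) R β.proj).comp
        (modelDeriv (cotangentModel I.tangent) I.tangent TotalSpace.proj β) :=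
    modelDeriv_comp hR (mdifferentiableAt_cotangentProj β)
  refine (congrArg (modelDeriv I.tangent (I.prod I) R β.proj).inverse
    (DFunLike.congr_fun h_comp Y)).trans ?_
  exact h_inv.inverse_apply_self _

variable [I.Boundaryless] {U : Set (TangentBundle I M)} {R : TangentBundle I M → M × M}
  {X : TangentBundle (cotangentModel I) (CotangentBundle I M)}

theorem liouvillePullback_cotangentDiscretization [CompleteSpace E]
    (hR : ContMDiffAt I.tangent (I.prod I) ∞ R (tulczyjew I X).proj)
    (h_inv : (modelDeriv I.tangent (I.prod I) R (tulczyjew I X).proj).IsInvertible) :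
    liouvillePullback (cotangentModel I).tangent (fun X => (cotangentDiscretization I R X).2) X -
      liouvillePullback (cotangentModel I).tangent (fun X => (cotangentDiscretization I R X).1) X =
      liouvillePullback (cotangentModel I).tangent (tulczyjew I) X := by
  have h_split := contMDiff_splitCotangent (I := I) (cotangentLift I R (tulczyjew I X))
  have h_lift := contMDiffAt_cotangentLift hR h_inv
  have h_tulczyjew := (contMDiff_tulczyjew X).mdifferentiableAt (n := ∞) (by simp)
  have h_comp := (h_lift.mdifferentiableAt (by simp)).comp X h_tulczyjew
  have h_fst := liouvillePullback_comp (s := cotangentLift I R ∘ tulczyjew I)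
    ((contMDiffAt_fst.comp _ h_split).mdifferentiableAt (by simp)) h_comp
  have h_snd := liouvillePullback_comp (s := cotangentLift I R ∘ tulczyjew I)
    ((contMDiffAt_snd.comp _ h_split).mdifferentiableAt (by simp)) h_comp
  calc _ = (liouvillePullback (cotangentModel (I.prod I)) id
        (cotangentLift I R (tulczyjew I X))).comp (modelDeriv (cotangentModel I).tangent
          (cotangentModel (I.prod I)) (cotangentLift I R ∘ tulczyjew I) X) := by
        rw [← liouvillePullback_splitCotangent, ContinuousLinearMap.sub_comp]
        exact congrArg₂ HSub.hSub h_snd h_fst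
    _ = liouvillePullback (cotangentModel I).tangent (cotangentLift I R ∘ tulczyjew I) X :=
        (liouvillePullback_comp (g := id) mdifferentiableAt_id h_comp).symm
    _ = (liouvillePullback (cotangentModel I.tangent) id (tulczyjew I X)).comp
        (modelDeriv (cotangentModel I).tangent (cotangentModel I.tangent) (tulczyjew I) X) := by
        rw [liouvillePullback_comp (h_lift.mdifferentiableAt (by simp)) h_tulczyjew,
          liouvillePullback_cotangentLift (hR.mdifferentiableAt (by simp)) h_inv]
    _ = _ := (liouvillePullback_comp (g := id) mdifferentiableAt_id h_tulczyjew).symm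

variable (E) in
/-- The canonical diffeomorphism in canonical coordinates, where it is linear:
`(q, p, q̇, ṗ) ↦ (q, q̇, ṗ, p)`, with `(ṗ, p)` encoding the covector `(a, b) ↦ ṗ a + p b`. -/
def tulczyjewModel :
    (E × (E →L[ℝ] ℝ)) × (E × (E →L[ℝ] ℝ)) →L[ℝ] (E × E) × (E × E →L[ℝ] ℝ) :=
  ((ContinuousLinearMap.fst ℝ E (E →L[ℝ] ℝ)).prodMap (ContinuousLinearMap.fst ℝ E (E →L[ℝ] ℝ))).prod
    (((ContinuousLinearMap.fst ℝ E E).precomp ℝ).comp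
        ((ContinuousLinearMap.snd ℝ E (E →L[ℝ] ℝ)).comp (ContinuousLinearMap.snd ℝ _ _)) +
      ((ContinuousLinearMap.snd ℝ E E).precomp ℝ).comp
        ((ContinuousLinearMap.snd ℝ E (E →L[ℝ] ℝ)).comp (ContinuousLinearMap.fst ℝ _ _)))

lemma extChartAt_tulczyjew {X₀ X : TangentBundle (cotangentModel I) (CotangentBundle I M)}
    (hX : X.proj.proj ∈ (chartAt H X₀.proj.proj).source) :
    extChartAt (cotangentModel I.tangent) (tulczyjew I X₀) (tulczyjew I X) =
      tulczyjewModel E (extChartAt (cotangentModel I).tangent X₀ X) := by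
  rw [extChartAt_cotangentBundle (α := tulczyjew I X) (mem_chart_tangentBundle.2 hX),
    extChartAt_tangentBundle X₀ X, extChartAt_cotangentBundle hX, extChartAt_tangentBundle]
  refine Prod.ext (Prod.ext rfl (toChart_cotangentBundle_fst hX (vec X)).symm) ?_
  exact covec_tulczyjew_comp_ofChart _ hX

lemma modelDeriv_tulczyjew (X : TangentBundle (cotangentModel I) (CotangentBundle I M)) :
    modelDeriv (cotangentModel I).tangent (cotangentModel I.tangent) (tulczyjew I) X =
      tulczyjewModel E := by
  have h := fderiv_inCharts ((contMDiff_tulczyjew X).mdifferentiableAt (n := ∞) (by simp))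
    (mem_chart_source _ X) (mem_chart_source _ (tulczyjew I X))
  rw [toChart_self, ofChart_self, ContinuousLinearMap.comp_id, ContinuousLinearMap.id_comp] at h
  rw [← h]
  refine (Filter.EventuallyEq.fderiv_eq (f := tulczyjewModel E) ?_).trans
    (tulczyjewModel E).hasFDerivAt.fderiv
  filter_upwards [eventually_mem_charts (I := (cotangentModel I).tangent) (mem_chart_source _ X)]
    with y hy
  refine (extChartAt_tulczyjew (mem_chart_cotangentBundle.1
    (mem_chart_tangentBundle.1 hy.2.1))).trans ?_
  rw [(extChartAt (cotangentModel I).tangent X).right_inv hy.1]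

lemma continuous_tulczyjew_proj :
    Continuous fun X : TangentBundle (cotangentModel I) (CotangentBundle I M) =>
      (tulczyjew I X).proj :=
  (FiberBundle.continuous_proj _ _).comp (contMDiff_tulczyjew (I := I)).continuous

variable [FiniteDimensional ℝ E] (h : IsDiscretizationMap I U R)
include h

lemma isOpen_cotangentDiscretizationDomain : IsOpen (cotangentDiscretizationDomain I U R) :=
  isOpen_iff_mem_nhds.2 fun _ hX =>
    (continuous_tulczyjew_proj.continuousAt.eventually ((h.isOpen.eventually_mem hX.1).and
      (eventually_isInvertible_modelDeriv ((h.contMDiffAt hX.1).of_le (by simp)) hX.2)))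

lemma contMDiffAt_cotangentDiscretization (hX : X ∈ cotangentDiscretizationDomain I U R) :
    ContMDiffAt (cotangentModel I).tangent ((cotangentModel I).prod (cotangentModel I)) ∞
      (cotangentDiscretization I R) X :=
  (contMDiff_splitCotangent _).comp X
    ((contMDiffAt_cotangentLift (h.contMDiffAt hX.1) hX.2).comp X (contMDiff_tulczyjew X))

theorem canonicalForm_cotangentDiscretization (hX : X ∈ cotangentDiscretizationDomain I U R)
    (Y Y' : (E × (E →L[ℝ] ℝ)) × (E × (E →L[ℝ] ℝ))) :
    canonicalForm I (cotangentDiscretization I R X).2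
        (modelDeriv (cotangentModel I).tangent (cotangentModel I)
          (fun X => (cotangentDiscretization I R X).2) X Y)
        (modelDeriv (cotangentModel I).tangent (cotangentModel I)
          (fun X => (cotangentDiscretization I R X).2) X Y') -
      canonicalForm I (cotangentDiscretization I R X).1
        (modelDeriv (cotangentModel I).tangent (cotangentModel I)
          (fun X => (cotangentDiscretization I R X).1) X Y)
        (modelDeriv (cotangentModel I).tangent (cotangentModel I)
          (fun X => (cotangentDiscretization I R X).1) X Y') =
      canonicalForm I.tangent (tulczyjew I X)
        (modelDeriv (cotangentModel I).tangent (cotangentModel I.tangent) (tulczyjew I) X Y)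
        (modelDeriv (cotangentModel I).tangent (cotangentModel I.tangent) (tulczyjew I) X Y') := by
  have h_smooth := contMDiffAt_cotangentDiscretization h hX
  refine canonicalForm_sub_of_liouvillePullback_sub (contMDiffAt_fst.comp X h_smooth)
    (contMDiffAt_snd.comp X h_smooth) (contMDiff_tulczyjew X) ?_ Y Y'
  filter_upwards [(isOpen_cotangentDiscretizationDomain h).mem_nhds hX] with X' hX'
  exact liouvillePullback_cotangentDiscretization (h.contMDiffAt hX'.1) hX'.2

lemma zero_mem_cotangentDiscretizationDomain (α : CotangentBundle I M) :
    (⟨α, 0⟩ : TangentBundle (cotangentModel I) (CotangentBundle I M)) ∈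
      cotangentDiscretizationDomain I U R :=
  ⟨h.zero_mem α.proj, h.isInvertible_modelDeriv_zero α.proj⟩

lemma covec_cotangentLift_tulczyjew_zero (α : CotangentBundle I M) (a₀ a₁ : E) :
    covec (cotangentLift I R (tulczyjew I ⟨α, 0⟩)) (a₀, a₁) = covec α (a₁ - a₀) := by
  have h_inv := h.isInvertible_modelDeriv_zero α.proj
  rw [← h.modelDeriv_zero_sub α.proj a₀ a₁]
  refine (congrArg (covec (tulczyjew I ⟨α, 0⟩)) (h_inv.inverse_apply_self _)).trans ?_
  rw [covec_tulczyjew]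
  exact zero_add _

lemma cotangentDiscretization_zero (α : CotangentBundle I M) :
    cotangentDiscretization I R ⟨α, 0⟩ = (α, α) := by
  have h_base : R (tulczyjew I ⟨α, 0⟩).proj = (α.proj, α.proj) := h.map_zero α.proj
  refine Prod.ext (cotangent_ext (congrArg Prod.fst h_base) ?_)
    (cotangent_ext (congrArg Prod.snd h_base) ?_)
  · refine ContinuousLinearMap.ext fun a => ?_
    refine (congrArg Neg.neg (covec_cotangentLift_tulczyjew_zero h α a 0)).trans ?_
    rw [zero_sub, map_neg, neg_neg]
  · refine ContinuousLinearMap.ext fun a => ?_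
    exact (covec_cotangentLift_tulczyjew_zero h α 0 a).trans (by rw [sub_zero])

/-- Since `α_Q` carries the tangent lift of the symplectic form to the canonical one, pairing a
horizontal with a vertical vector at a zero vector recovers the symplectic form itself. -/
lemma canonicalForm_fiberDeriv_sub (α : CotangentBundle I M) (X Y : E × (E →L[ℝ] ℝ)) :
    canonicalForm I α X (fiberDeriv₂ (cotangentDiscretization I R) α Y -
      fiberDeriv₁ (cotangentDiscretization I R) α Y) = canonicalForm I α X Y := by
  have h_mem := zero_mem_cotangentDiscretizationDomain h α
  have h_smooth := contMDiffAt_cotangentDiscretization h h_mem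
  have h_fst := modelDeriv_apply_of_map_zero (I := cotangentModel I)
    (r := fun X => (cotangentDiscretization I R X).1)
    ((contMDiffAt_fst.comp _ h_smooth).mdifferentiableAt (by simp))
    (fun β => congrArg Prod.fst (cotangentDiscretization_zero h β))
  have h_snd := modelDeriv_apply_of_map_zero (I := cotangentModel I)
    (r := fun X => (cotangentDiscretization I R X).2)
    ((contMDiffAt_snd.comp _ h_smooth).mdifferentiableAt (by simp))
    (fun β => congrArg Prod.snd (cotangentDiscretization_zero h β))
  have h_form := canonicalForm_cotangentDiscretization h h_mem (X, 0) (0, Y)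
  rw [h_fst, h_fst, h_snd, h_snd, modelDeriv_tulczyjew] at h_form
  have h_model : (tulczyjewModel E (0, Y)).2 (tulczyjewModel E (X, 0)).1 -
      (tulczyjewModel E (X, 0)).2 (tulczyjewModel E (0, Y)).1 = Y.2 X.1 - X.2 Y.1 := by
    simp [tulczyjewModel]
  simp only [canonicalForm_apply, map_zero, add_zero, zero_add, h_model] at h_form ⊢
  rw [← h_form, Prod.snd_sub, Prod.fst_sub, map_sub, sub_apply, fiberDeriv₁, fiberDeriv₂]
  ring

theorem IsDiscretizationMap.cotangentDiscretization :
    IsDiscretizationMap (cotangentModel I) (cotangentDiscretizationDomain I U R)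
      (cotangentDiscretization I R) where
  isOpen := isOpen_cotangentDiscretizationDomain h
  zero_mem := zero_mem_cotangentDiscretizationDomain h
  smooth _ hX := (contMDiffAt_cotangentDiscretization h hX).contMDiffWithinAt
  map_zero := cotangentDiscretization_zero h
  rigidity α Y := eq_of_forall_canonicalForm_eq fun X => canonicalForm_fiberDeriv_sub h α X Y

end CotangentDiscretization

/-! ### Pulling back along local diffeomorphisms -/

section Pullback

variable {E : Type*} [NormedAddCommGroup E] [NormedSpace ℝ E]
  {H : Type*} [TopologicalSpace H] {I : ModelWithCorners ℝ E H}
  {M : Type*} [TopologicalSpace M] [ChartedSpace H M]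
  {F : Type*} [NormedAddCommGroup F] [NormedSpace ℝ F]
  {G : Type*} [TopologicalSpace G] {J : ModelWithCorners ℝ F G}
  {N : Type*} [TopologicalSpace N] [ChartedSpace G N]

section FiberDerivative

variable [IsManifold I ∞ M] [IsManifold J ∞ N] {f : M → N} {r : TangentBundle I M → M}
  {s : TangentBundle J N → N} {x : M}

lemma modelDeriv_modelDeriv_fiber (hf : MDifferentiableAt I J f x)
    (hr : MDifferentiableAt I.tangent I r ⟨x, 0⟩) (hs : MDifferentiableAt J.tangent J s ⟨f x, 0⟩)
    (h_zero : r ⟨x, 0⟩ = x) (h : f ∘ r =ᶠ[𝓝 ⟨x, 0⟩] s ∘ tangentMap I J f) (v : E) :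
    modelDeriv I J f x (modelDeriv 𝓘(ℝ, E) I (fun u : E => r ⟨x, u⟩) 0 v) =
      modelDeriv 𝓘(ℝ, F) J (fun u : F => s ⟨f x, u⟩) 0 (modelDeriv I J f x v) := by
  have h_fiber : f ∘ (fun u : E => r ⟨x, u⟩) =ᶠ[𝓝 0]
      (fun u : F => s ⟨f x, u⟩) ∘ modelDeriv I J f x :=
    ((contMDiff_fiberInclusion (I := I) x).continuous.tendsto 0).eventually h
  have hr' : MDifferentiableAt 𝓘(ℝ, E) I (fun u : E => r ⟨x, u⟩) 0 :=
    hr.comp (0 : E) ((contMDiff_fiberInclusion (I := I) x 0).mdifferentiableAt (by simp))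
  have hs' : MDifferentiableAt 𝓘(ℝ, F) J (fun u : F => s ⟨f x, u⟩) 0 :=
    hs.comp (0 : F) ((contMDiff_fiberInclusion (I := J) (f x) 0).mdifferentiableAt (by simp))
  have h_deriv := modelDeriv_congr (I := 𝓘(ℝ, E)) (I' := J) h_fiber
  rw [modelDeriv_comp_of_eq hf hr' h_zero, modelDeriv_comp_of_eq hs'
    (modelDeriv I J f x).mdifferentiableAt (map_zero _), modelDeriv_eq_fderiv,
    ContinuousLinearMap.fderiv] at h_deriv
  exact DFunLike.congr_fun h_deriv v

end FiberDerivative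

/-- Near `w`, the map `R` is the composition `(f⁻¹, f⁻¹) ∘ S ∘ Tf` for a local inverse `f⁻¹` of `f`
which takes `f x` to `x`, where `x` is the base point of `w`. -/
def IsPullbackAt (I : ModelWithCorners ℝ E H) (J : ModelWithCorners ℝ F G) [IsManifold I 1 M]
    (f : M → N) (S : TangentBundle J N → N × N) (R : TangentBundle I M → M × M)
    (w : TangentBundle I M) : Prop :=
  ∃ σ : OpenPartialHomeomorph M N, w.proj ∈ σ.source ∧ EqOn σ f σ.source ∧
    ∀ᶠ w' in 𝓝 w, (S (tangentMap I J f w')).1 ∈ σ.target ∧ (S (tangentMap I J f w')).2 ∈ σ.target ∧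
      R w' = (σ.symm (S (tangentMap I J f w')).1, σ.symm (S (tangentMap I J f w')).2)

variable {f : M → N} {S : TangentBundle J N → N × N} {R : TangentBundle I M → M × M}

namespace IsPullbackAt

section Values

variable [IsManifold I 1 M]

lemma eventually_map_eq {w : TangentBundle I M} (h : IsPullbackAt I J f S R w) :
    ∀ᶠ w' in 𝓝 w, Prod.map f f (R w') = S (tangentMap I J f w') := by
  obtain ⟨σ, -, hσ, h_ev⟩ := h
  filter_upwards [h_ev] with w' ⟨h₁, h₂, hR⟩
  rw [hR]
  refine Prod.ext ?_ ?_
  · exact (hσ (σ.map_target h₁)).symm.trans (σ.right_inv h₁)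
  · exact (hσ (σ.map_target h₂)).symm.trans (σ.right_inv h₂)

lemma map_zero_section {x : M} (h : IsPullbackAt I J f S R ⟨x, 0⟩)
    (hS : S ⟨f x, 0⟩ = (f x, f x)) : R ⟨x, 0⟩ = (x, x) := by
  obtain ⟨σ, hx, hσ, h_ev⟩ := h
  have h_zero : tangentMap I J f ⟨x, 0⟩ = ⟨f x, 0⟩ :=
    congrArg (TotalSpace.mk (f x)) (map_zero (modelDeriv I J f x))
  have h_symm : σ.symm (f x) = x := by rw [← hσ hx]; exact σ.left_inv hx
  rw [h_ev.self_of_nhds.2.2, h_zero, hS, h_symm]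

end Values

variable [CompleteSpace E] [I.Boundaryless] [J.Boundaryless] [IsManifold I ∞ M] [IsManifold J ∞ N]

lemma contMDiffAt {w : TangentBundle I M} (h : IsPullbackAt I J f S R w)
    (hf : ContMDiff I J ∞ f) (h_inv : ∀ x, (modelDeriv I J f x).IsInvertible)
    (hS : ContMDiffAt J.tangent (J.prod J) ∞ S (tangentMap I J f w)) :
    ContMDiffAt I.tangent (I.prod I) ∞ R w := by
  obtain ⟨σ, -, hσ, h_ev⟩ := h
  have h_symm {y : N} (hy : y ∈ σ.target) : ContMDiffAt J I ∞ σ.symm y := by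
    have hσf : σ =ᶠ[𝓝 (σ.symm y)] f :=
      hσ.eventuallyEq_of_mem (σ.open_source.mem_nhds (σ.map_target hy))
    exact contMDiffAt_symm_of_isInvertible (I := I) (I' := J) σ hy
      ((hf _).congr_of_eventuallyEq hσf) (modelDeriv_congr (I := I) (I' := J) hσf ▸ h_inv _)
  have hS' : ContMDiffAt I.tangent (J.prod J) ∞ (fun w => S (tangentMap I J f w)) w :=
    hS.comp w (hf.contMDiff_tangentMap (m := ∞) le_rfl w)
  obtain ⟨h₁, h₂, -⟩ := h_ev.self_of_nhds
  have h_comp₁ : ContMDiffAt I.tangent I ∞ (fun w => σ.symm (S (tangentMap I J f w)).1) w :=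
    ContMDiffAt.comp (I' := J) w (h_symm h₁) (contMDiffAt_fst.comp w hS')
  have h_comp₂ : ContMDiffAt I.tangent I ∞ (fun w => σ.symm (S (tangentMap I J f w)).2) w :=
    ContMDiffAt.comp (I' := J) w (h_symm h₂) (contMDiffAt_snd.comp w hS')
  exact (h_comp₁.prodMk h_comp₂).congr_of_eventuallyEq (h_ev.mono fun w' hw' => hw'.2.2)

end IsPullbackAt

variable [CompleteSpace E] [I.Boundaryless] [J.Boundaryless] [IsManifold I ∞ M] [IsManifold J ∞ N]

theorem IsDiscretizationMap.pullback {V : Set (TangentBundle J N)}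
    (h : IsDiscretizationMap J V S) (hf : ContMDiff I J ∞ f)
    (h_inv : ∀ x, (modelDeriv I J f x).IsInvertible) {W : Set (TangentBundle I M)} (hW : IsOpen W)
    (h_zero : ∀ x, (⟨x, 0⟩ : TangentBundle I M) ∈ W) (h_maps : MapsTo (tangentMap I J f) W V)
    (hR : ∀ w ∈ W, IsPullbackAt I J f S R w) : IsDiscretizationMap I W R := by
  have h_map_zero (x : M) : R ⟨x, 0⟩ = (x, x) :=
    (hR _ (h_zero x)).map_zero_section (h.map_zero (f x))
  have h_smooth {w} (hw : w ∈ W) : ContMDiffAt I.tangent (I.prod I) ∞ R w :=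
    (hR w hw).contMDiffAt hf h_inv (h.contMDiffAt (h_maps hw))
  refine ⟨hW, h_zero, fun w hw => (h_smooth hw).contMDiffWithinAt, h_map_zero, fun x v => ?_⟩
  have hfd := (hf x).mdifferentiableAt (by simp)
  have hRd := (h_smooth (h_zero x)).mdifferentiableAt (by simp)
  have hSd := (h.contMDiffAt (h.zero_mem (f x))).mdifferentiableAt (by simp)
  have h_ev := (hR _ (h_zero x)).eventually_map_eq
  have h₁ : modelDeriv I J f x (fiberDeriv₁ R x v) =
      fiberDeriv₁ S (f x) (modelDeriv I J f x v) :=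
    modelDeriv_modelDeriv_fiber hfd hRd.fst hSd.fst (congrArg Prod.fst (h_map_zero x))
      (h_ev.mono fun _ => congrArg Prod.fst) v
  have h₂ : modelDeriv I J f x (fiberDeriv₂ R x v) =
      fiberDeriv₂ S (f x) (modelDeriv I J f x v) :=
    modelDeriv_modelDeriv_fiber hfd hRd.snd hSd.snd (congrArg Prod.snd (h_map_zero x))
      (h_ev.mono fun _ => congrArg Prod.snd) v
  refine (h_inv x).injective ?_
  change modelDeriv I J f x (fiberDeriv₂ R x v - fiberDeriv₁ R x v) = modelDeriv I J f x v
  rw [map_sub, h₁, h₂, h.fiberDeriv_sub]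

end Pullback

section LagrangianLift

variable {E : Type*} [NormedAddCommGroup E] [NormedSpace ℝ E]
  {H : Type*} [TopologicalSpace H] {I : ModelWithCorners ℝ E H}
  {M : Type*} [TopologicalSpace M] [ChartedSpace H M] [IsManifold I ∞ M]
  {U : Set (TangentBundle I M)} {Rd : TangentBundle I M → M × M}
  {L : TangentBundle I M → ℝ} {W : Set (TangentBundle I.tangent (TangentBundle I M))}
  {R : TangentBundle I.tangent (TangentBundle I M) → TangentBundle I M × TangentBundle I M}

lemma IsLagrangianLift.isPullbackAt (hR : IsLagrangianLift I L U Rd W R)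
    {w : TangentBundle I.tangent (TangentBundle I M)} (hw : w ∈ W) :
    IsPullbackAt I.tangent (cotangentModel I) (legendre I L) (cotangentDiscretization I Rd) R w :=
  hR.eq_comp w hw

theorem IsLagrangianLift.isDiscretizationMap [I.Boundaryless] [FiniteDimensional ℝ E]
    (h : IsDiscretizationMap I U Rd) (hL : IsRegularLagrangian I L)
    (hR : IsLagrangianLift I L U Rd W R) : IsDiscretizationMap I.tangent W R :=
  have := FiniteDimensional.complete ℝ E
  h.cotangentDiscretization.pullback (contMDiff_legendre hL.smooth)
    (isInvertible_modelDeriv_legendre hL) hR.isOpen hR.zero_mem hR.mem_domain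
    fun _ => hR.isPullbackAt

end LagrangianLift

/-! ### Integrators -/

section ImplicitFunction

variable {E : Type*} [NormedAddCommGroup E] [NormedSpace ℝ E]
  {H : Type*} [TopologicalSpace H] {I : ModelWithCorners ℝ E H}
  {M : Type*} [TopologicalSpace M] [ChartedSpace H M]
  {E' : Type*} [NormedAddCommGroup E'] [NormedSpace ℝ E']
  {H' : Type*} [TopologicalSpace H'] {I' : ModelWithCorners ℝ E' H'}
  {M' : Type*} [TopologicalSpace M'] [ChartedSpace H' M']
  {F : Type*} [NormedAddCommGroup F] [NormedSpace ℝ F]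
  {G : Type*} [TopologicalSpace G] {J : ModelWithCorners ℝ F G}
  {N : Type*} [TopologicalSpace N] [ChartedSpace G N]

lemma modelDeriv_prod_apply {f : N × M → M'} {p : N} {x : M}
    (hf : MDifferentiableAt (J.prod I) I' f (p, x)) (Z : F × E) :
    modelDeriv (J.prod I) I' f (p, x) Z =
      modelDeriv J I' (fun q => f (q, x)) p Z.1 + modelDeriv I I' (fun y => f (p, y)) x Z.2 :=
  mfderiv_prod_eq_add_apply hf

lemma isInvertible_modelDeriv_fst_prodMk {f : N × M → M'} {p : N} {x : M}
    (hf : MDifferentiableAt (J.prod I) I' f (p, x))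
    (h : (modelDeriv I I' (fun y => f (p, y)) x).IsInvertible) :
    (modelDeriv (J.prod I) (J.prod I') (fun z => (z.1, f z)) (p, x)).IsInvertible := by
  obtain ⟨e, he⟩ := h
  refine ⟨(ContinuousLinearEquiv.refl ℝ F).skewProd e (modelDeriv J I' (fun q => f (q, x)) p), ?_⟩
  have h_fst : modelDeriv (J.prod I) J (fun z : N × M => z.1) (p, x) =
      ContinuousLinearMap.fst ℝ F E := mfderiv_fst
  rw [modelDeriv_prodMk mdifferentiableAt_fst hf, h_fst]
  refine ContinuousLinearMap.ext fun Z => Prod.ext rfl ?_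
  refine Eq.trans ?_ (modelDeriv_prod_apply hf Z).symm
  rw [← he, add_comm]
  rfl

variable [I.Boundaryless] [I'.Boundaryless] [J.Boundaryless] [CompleteSpace E] [CompleteSpace F]
  [IsManifold I ∞ M] [IsManifold I' ∞ M'] [IsManifold J ∞ N]

theorem exists_contMDiffOn_implicitFunction {S : Set (N × M)} {f : N × M → M'} {p : N} {x : M}
    (hS : IsOpen S) (hpx : (p, x) ∈ S) (hf : ContMDiffOn (J.prod I) I' ∞ f S)
    (h : (modelDeriv I I' (fun y => f (p, y)) x).IsInvertible) :
    ∃ A ∈ 𝓝 p, ∃ V : Set M', IsOpen V ∧ f (p, x) ∈ V ∧ ∃ B : Set M, IsOpen B ∧ x ∈ B ∧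
      ∃ Y : N → M' → M, ContMDiffOn (J.prod I') I ∞ (fun z : N × M' => Y z.1 z.2) (A ×ˢ V) ∧
        ∀ q ∈ A, ∀ v ∈ V, ∀ y, (y ∈ B ∧ (q, y) ∈ S ∧ f (q, y) = v) ↔ y = Y q v := by
  have hfx := (hf.contMDiffAt (hS.mem_nhds hpx)).mdifferentiableAt (by simp)
  obtain ⟨σ, hxσ, hσS, hσ, hσ_symm⟩ := exists_openPartialHomeomorph_eqOn (I := J.prod I)
    (I' := J.prod I') (f := fun z => (z.1, f z)) hS hpx (contMDiffOn_fst.prodMk hf)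
    (isInvertible_modelDeriv_fst_prodMk hfx h)
  have h_symm {z : N × M'} (hz : z ∈ σ.target) : (σ.symm z).1 = z.1 ∧ f (σ.symm z) = z.2 :=
    Prod.ext_iff.1 ((hσ (σ.map_target hz)).symm.trans (σ.right_inv hz))
  obtain ⟨A₀, B, hA₀, hB, hpA₀, hxB, hAB⟩ := isOpen_prod_iff.1 σ.open_source p x hxσ
  have hσx : σ (p, x) = (p, f (p, x)) := hσ hxσ
  have h_nhds : σ.target ∩ σ.symm ⁻¹' (A₀ ×ˢ B) ∈ 𝓝 (p, f (p, x)) := by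
    refine (σ.isOpen_inter_preimage_symm (hA₀.prod hB)).mem_nhds ?_
    rw [← hσx, mem_inter_iff, mem_preimage, σ.left_inv hxσ]
    exact ⟨σ.map_source hxσ, hpA₀, hxB⟩
  obtain ⟨A, hA, V₀, hV₀, hAV₀⟩ := mem_nhds_prod_iff.1 h_nhds
  obtain ⟨V, hVV₀, hV, hxV⟩ := mem_nhds_iff.1 hV₀
  have h_box {q : N} {v : M'} (hq : q ∈ A) (hv : v ∈ V) := hAV₀ (mk_mem_prod hq (hVV₀ hv))
  refine ⟨A, hA, V, hV, hxV, B, hB, hxB, fun q v => (σ.symm (q, v)).2,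
    contMDiff_snd.comp_contMDiffOn (hσ_symm.mono fun z hz => (h_box hz.1 hz.2).1),
    fun q hq v hv y => ⟨?_, ?_⟩⟩
  · rintro ⟨hyB, -, hfy⟩
    obtain ⟨h_target, h_source⟩ := h_box hq hv
    have hyσ : (q, y) ∈ σ.source := hAB ⟨(h_symm h_target).1 ▸ h_source.1, hyB⟩
    have hσy : σ (q, y) = (q, v) := (hσ hyσ).trans (congrArg (Prod.mk q) hfy)
    change y = (σ.symm (q, v)).2
    rw [← hσy, σ.left_inv hyσ]
  · rintro rfl
    obtain ⟨h_target, h_source⟩ := h_box hq hv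
    have h_eq : (q, (σ.symm (q, v)).2) = σ.symm (q, v) :=
      Prod.ext (h_symm h_target).1.symm rfl
    refine ⟨h_source.2, ?_, ?_⟩ <;> rw [h_eq]
    exacts [hσS (σ.map_target h_target), (h_symm h_target).2]

end ImplicitFunction

section Integrator

variable {E : Type*} [NormedAddCommGroup E] [NormedSpace ℝ E]
  {H : Type*} [TopologicalSpace H] {I : ModelWithCorners ℝ E H}
  {M : Type*} [TopologicalSpace M] [ChartedSpace H M]
  {Γ : ∀ x : M, TangentSpace I x}

lemma tangent_ext {v w : TangentBundle I M} (h_proj : v.proj = w.proj) (h_vec : vec v = vec w) :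
    v = w := by
  obtain ⟨q, p⟩ := v
  obtain ⟨q', p'⟩ := w
  cases h_proj
  exact congrArg (TotalSpace.mk q) h_vec

/-- The map `(h, y) ↦ h Γ(y)`. -/
def scaledField (Γ : ∀ x : M, TangentSpace I x) (z : ℝ × M) : TangentBundle I M :=
  ⟨z.2, z.1 • Γ z.2⟩

lemma scaledField_zero (y : M) : scaledField Γ (0, y) = (⟨y, 0⟩ : TangentBundle I M) :=
  congrArg (TotalSpace.mk y) (zero_smul ℝ (Γ y : E))

variable [IsManifold I ∞ M]

lemma contMDiff_scaledField (hΓ : ContMDiff I I.tangent ∞ fun x => (⟨x, Γ x⟩ : TangentBundle I M)) :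
    ContMDiff (𝓘(ℝ, ℝ).prod I) I.tangent ∞ (scaledField Γ) := by
  intro z₀
  have h_field : ContMDiffAt (𝓘(ℝ, ℝ).prod I) 𝓘(ℝ, E) ∞
      (fun z : ℝ × M => toChart I z₀.2 z.2 (Γ z.2)) z₀ :=
    ContMDiffAt.comp (I' := I) z₀ (contMDiffAt_tangentBundle.1 (hΓ z₀.2)).2 contMDiffAt_snd
  have h_smul : ContMDiffAt (𝓘(ℝ, ℝ).prod I) 𝓘(ℝ, E) ∞
      (fun z : ℝ × M => z.1 • toChart I z₀.2 z.2 (Γ z.2)) z₀ := contMDiffAt_fst.smul h_field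
  refine contMDiffAt_tangentBundle.2 ⟨contMDiffAt_snd, ?_⟩
  exact h_smul.congr_of_eventuallyEq
    (Eventually.of_forall fun z => (toChart I z₀.2 z.2).map_smul z.1 (Γ z.2 : E))

variable [I.Boundaryless]

omit [I.Boundaryless] in
lemma modelDeriv_fiberInclusion_smul (x : M) (a : E) (s : ℝ) :
    modelDeriv 𝓘(ℝ, ℝ) I.tangent (fun h : ℝ => fiberInclusion I x (h • a)) 0 s = (0, s • a) := by
  have h_line : HasFDerivAt (fun h : ℝ => h • a) ((ContinuousLinearMap.id ℝ ℝ).smulRight a) 0 :=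
    (hasFDerivAt_id 0).smul_const a
  have h_comp := modelDeriv_comp (I := 𝓘(ℝ, ℝ)) (f := fun h : ℝ => h • a) (x := 0)
    ((contMDiff_fiberInclusion (I := I) x _).mdifferentiableAt (by simp))
    h_line.differentiableAt.mdifferentiableAt
  rw [modelDeriv_fiberInclusion, modelDeriv_eq_fderiv, h_line.fderiv] at h_comp
  exact DFunLike.congr_fun h_comp s

lemma modelDeriv_scaledField
    (hΓ : ContMDiff I I.tangent ∞ fun x => (⟨x, Γ x⟩ : TangentBundle I M)) (x : M) (s : ℝ) (w : E) :
    modelDeriv (𝓘(ℝ, ℝ).prod I) I.tangent (scaledField Γ) (0, x) (s, w) = (w, s • (Γ x : E)) := by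
  have h_fst : modelDeriv 𝓘(ℝ, ℝ) I.tangent (fun h => scaledField Γ (h, x)) 0 s =
      (0, s • (Γ x : E)) := modelDeriv_fiberInclusion_smul (E := E) x (Γ x) s
  have h_snd : modelDeriv I I.tangent (fun y => scaledField Γ (0, y)) x w = (w, 0) := by
    rw [funext scaledField_zero]
    exact DFunLike.congr_fun (modelDeriv_zeroTangent x) w
  refine (modelDeriv_prod_apply ((contMDiff_scaledField hΓ _).mdifferentiableAt (by simp)) _).trans
    ((congrArg₂ (· + ·) h_fst h_snd).trans ?_)
  exact Prod.ext (zero_add w) (add_zero _)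

namespace IsDiscretizationMap

variable {U : Set (TangentBundle I M)} {R : TangentBundle I M → M × M}
  (h : IsDiscretizationMap I U R)
  (hΓ : ContMDiff I I.tangent ∞ fun x => (⟨x, Γ x⟩ : TangentBundle I M))
include h

omit [I.Boundaryless] in
lemma apply_scaledField_zero (y : M) : R (scaledField Γ (0, y)) = (y, y) :=
  (congrArg R (scaledField_zero y)).trans (h.map_zero y)

include hΓ

lemma tangentMap_scheme {c : ℝ → M} {x₀ : M} (hc : MDifferentiableAt 𝓘(ℝ, ℝ) I c 0)
    (hc₀ : c 0 = x₀) (h_fst : (fun s => (R (scaledField Γ (s, c s))).1) =ᶠ[𝓝 0] fun _ => x₀) :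
    tangentMap 𝓘(ℝ, ℝ) I (fun s => (R (scaledField Γ (s, c s))).2) ⟨0, (1 : ℝ)⟩ =
      (⟨x₀, Γ x₀⟩ : TangentBundle I M) := by
  subst hc₀
  have h_pair : MDifferentiableAt 𝓘(ℝ, ℝ) (𝓘(ℝ, ℝ).prod I) (fun s : ℝ => (s, c s)) 0 :=
    mdifferentiableAt_id.prodMk hc
  have h_field := (contMDiff_scaledField hΓ (0, c 0)).mdifferentiableAt (by simp)
  have h_curve := h_field.comp (0 : ℝ) h_pair
  have h_velocity : modelDeriv 𝓘(ℝ, ℝ) I.tangent (fun s => scaledField Γ (s, c s)) 0 1 =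
      (modelDeriv 𝓘(ℝ, ℝ) I c 0 1, (Γ (c 0) : E)) := by
    have h_comp :=
      modelDeriv_comp (I := 𝓘(ℝ, ℝ)) (f := fun s : ℝ => (s, c s)) (x := 0) h_field h_pair
    have h_pair_deriv : modelDeriv 𝓘(ℝ, ℝ) (𝓘(ℝ, ℝ).prod I) (fun s : ℝ => (s, c s)) 0 1 =
        ((1 : ℝ), modelDeriv 𝓘(ℝ, ℝ) I c 0 1) :=
      (DFunLike.congr_fun (modelDeriv_prodMk mdifferentiableAt_id hc) 1).trans
        (Prod.ext (DFunLike.congr_fun (modelDeriv_id (I := 𝓘(ℝ, ℝ)) (0 : ℝ)) 1) rfl)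
    refine (DFunLike.congr_fun h_comp 1).trans ((congrArg _ h_pair_deriv).trans ?_)
    exact (modelDeriv_scaledField hΓ _ _ _).trans (Prod.ext rfl (one_smul ℝ (Γ (c 0) : E)))
  have hR := (h.contMDiffAt (h.zero_mem (c 0))).mdifferentiableAt (by simp)
  have h_deriv_fst : modelDeriv 𝓘(ℝ, ℝ) I (fun s => (R (scaledField Γ (s, c s))).1) 0 1 =
      modelDeriv 𝓘(ℝ, ℝ) I c 0 1 + fiberDeriv₁ R (c 0) (Γ (c 0)) := by
    refine (DFunLike.congr_fun (modelDeriv_comp_of_eq hR.fst h_curve (scaledField_zero _)) 1).trans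
      ?_
    rw [ContinuousLinearMap.comp_apply]
    exact (congrArg _ h_velocity).trans (h.modelDeriv_fst_zero _ _)
  have h_deriv_snd : modelDeriv 𝓘(ℝ, ℝ) I (fun s => (R (scaledField Γ (s, c s))).2) 0 1 =
      modelDeriv 𝓘(ℝ, ℝ) I c 0 1 + fiberDeriv₂ R (c 0) (Γ (c 0)) := by
    refine (DFunLike.congr_fun (modelDeriv_comp_of_eq hR.snd h_curve (scaledField_zero _)) 1).trans
      ?_
    rw [ContinuousLinearMap.comp_apply]
    exact (congrArg _ h_velocity).trans (h.modelDeriv_snd_zero _ _)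
  rw [modelDeriv_congr h_fst, modelDeriv_const] at h_deriv_fst
  refine tangent_ext (congrArg Prod.snd (h.apply_scaledField_zero (c 0))) (h_deriv_snd.trans ?_)
  rw [eq_neg_of_add_eq_zero_left h_deriv_fst.symm, neg_add_eq_sub]
  exact h.fiberDeriv_sub _ _

theorem isIntegrator [CompleteSpace E] : IsIntegrator I Γ U R := by
  intro x
  have h_field := contMDiff_scaledField hΓ
  have h_open : IsOpen (scaledField Γ ⁻¹' U) := h.isOpen.preimage h_field.continuous
  have h_mem : ((0 : ℝ), x) ∈ scaledField Γ ⁻¹' U := by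
    rw [mem_preimage, scaledField_zero]
    exact h.zero_mem x
  have h_smooth : ContMDiffOn (𝓘(ℝ, ℝ).prod I) (I.prod I) ∞ (R ∘ scaledField Γ)
      (scaledField Γ ⁻¹' U) := h.smooth.comp h_field.contMDiffOn fun _ => id
  have h_id : (fun y => (R (scaledField Γ (0, y))).1) = id :=
    funext fun y => congrArg Prod.fst (h.apply_scaledField_zero y)
  obtain ⟨A, hA, V, hV, hxV, N, hN, hxN, Y, hY, h_iff⟩ :=
    exists_contMDiffOn_implicitFunction (J := 𝓘(ℝ, ℝ)) (I' := I) h_open h_mem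
      (contMDiff_fst.comp_contMDiffOn h_smooth)
      (⟨.refl ℝ E, ((congrArg (modelDeriv I I · x) h_id).trans (modelDeriv_id x)).symm⟩)
  obtain ⟨h₀, h₀_pos, h_ball⟩ := Metric.mem_nhds_iff.1 hA
  rw [Real.ball_eq_Ioo, zero_sub, zero_add] at h_ball
  have h_sol {s x₀} (hs : s ∈ Ioo (-h₀) h₀) (hx₀ : x₀ ∈ V) :=
    (h_iff s (h_ball hs) x₀ hx₀ _).2 rfl
  have hY' := hY.mono (prod_mono_left h_ball)
  refine ⟨h₀, h₀_pos, V, N, hV, ?_, hN, hxN, fun s x₀ => (R (scaledField Γ (s, Y s x₀))).2, Y,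
    ?_, hY', ?_, ?_⟩
  · rwa [Function.comp_apply, Function.comp_apply, h.apply_scaledField_zero] at hxV
  · exact contMDiff_snd.comp_contMDiffOn (h_smooth.comp (contMDiffOn_fst.prodMk hY')
      fun z hz => (h_sol hz.1 hz.2).2.1)
  · intro s hs x₀ hx₀ x₁ y
    refine ⟨?_, ?_⟩
    · rintro ⟨hyN, hyU, hyR⟩
      obtain rfl := (h_iff s (h_ball hs) x₀ hx₀ y).1 ⟨hyN, hyU, congrArg Prod.fst hyR⟩
      exact ⟨(congrArg Prod.snd hyR).symm, rfl⟩
    · rintro ⟨rfl, rfl⟩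
      obtain ⟨hyN, hyU, hyR⟩ := h_sol hs hx₀
      exact ⟨hyN, hyU, Prod.ext hyR rfl⟩
  · intro x₀ hx₀
    have h_Ioo : Ioo (-h₀) h₀ ∈ 𝓝 (0 : ℝ) := Ioo_mem_nhds (neg_lt_zero.2 h₀_pos) h₀_pos
    have hY₀ : Y 0 x₀ = x₀ := (congrFun h_id (Y 0 x₀)).symm.trans
      (h_sol (mem_of_mem_nhds h_Ioo) hx₀).2.2
    refine h.tangentMap_scheme hΓ ?_ hY₀ ?_
    · exact ((hY'.contMDiffAt (prod_mem_nhds h_Ioo (hV.mem_nhds hx₀))).mdifferentiableAt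
        (by simp)).comp (0 : ℝ) (f := fun s : ℝ => (s, x₀))
        (mdifferentiableAt_id.prodMk mdifferentiableAt_const)
    · filter_upwards [h_Ioo] with s hs using (h_sol hs hx₀).2.2

end IsDiscretizationMap

end Integrator

/-! ### Symplecticity -/

section LocalDiffeomorphism

variable {E : Type*} [NormedAddCommGroup E] [NormedSpace ℝ E]
  {H : Type*} [TopologicalSpace H] {I : ModelWithCorners ℝ E H}
  {M : Type*} [TopologicalSpace M] [ChartedSpace H M]
  {E' : Type*} [NormedAddCommGroup E'] [NormedSpace ℝ E']
  {H' : Type*} [TopologicalSpace H'] {I' : ModelWithCorners ℝ E' H'}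
  {M' : Type*} [TopologicalSpace M'] [ChartedSpace H' M']
  {F : Type*} [NormedAddCommGroup F] [NormedSpace ℝ F]
  {G : Type*} [TopologicalSpace G] {J : ModelWithCorners ℝ F G}
  {N : Type*} [TopologicalSpace N] [ChartedSpace G N]
  [I.Boundaryless] [I'.Boundaryless] [CompleteSpace E] [IsManifold I ∞ M] [IsManifold I' ∞ M']

lemma contMDiffAt_of_contMDiffAt_comp {f : M → M'} {s : Set M} {Y : N → M} {x : N}
    (hs : IsOpen s) (hf : ContMDiffOn I I' ∞ f s) (hYs : Y x ∈ s)
    (h_inv : (modelDeriv I I' f (Y x)).IsInvertible) (hY : ContinuousAt Y x)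
    (h : ContMDiffAt J I' ∞ (f ∘ Y) x) : ContMDiffAt J I ∞ Y x := by
  obtain ⟨σ, hxσ, -, hσ, hσ_symm⟩ := exists_openPartialHomeomorph_eqOn (I := I) (I' := I')
    hs hYs hf h_inv
  have h_target : (f ∘ Y) x ∈ σ.target := (congrArg (· ∈ σ.target) (hσ hxσ)).mp (σ.map_source hxσ)
  refine (ContMDiffAt.comp (I' := I') x (hσ_symm.contMDiffAt (σ.open_target.mem_nhds h_target))
    h).congr_of_eventuallyEq ?_
  filter_upwards [hY.eventually (σ.open_source.eventually_mem hxσ)] with z hz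
  exact ((congrArg σ.symm (hσ hz)).symm.trans (σ.left_inv hz)).symm

end LocalDiffeomorphism

section FiberScaling

variable {E : Type*} [NormedAddCommGroup E] [NormedSpace ℝ E]
  {H : Type*} [TopologicalSpace H] {I : ModelWithCorners ℝ E H}
  {M : Type*} [TopologicalSpace M] [ChartedSpace H M]

/-- Multiplication by `h` in the fibres of `TM`. -/
def fiberScaling (h : ℝ) (v : TangentBundle I M) : TangentBundle I M := ⟨v.proj, h • vec v⟩

variable [IsManifold I ∞ M]

lemma contMDiff_fiberScaling (h : ℝ) :
    ContMDiff I.tangent I.tangent ∞ (fiberScaling h : TangentBundle I M → TangentBundle I M) := by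
  intro v₀
  obtain ⟨h_proj, h_vec⟩ := contMDiffAt_tangentBundle.1
    (contMDiffAt_id (I := I.tangent) (n := ∞) (x := v₀))
  have h_smul : ContMDiffAt I.tangent 𝓘(ℝ, E) ∞
      (fun v : TangentBundle I M => h • toChart I v₀.proj v.proj (vec v)) v₀ :=
    (contDiff_const_smul h).contMDiff.contMDiffAt.comp v₀ h_vec
  exact contMDiffAt_tangentBundle.2 ⟨h_proj, h_smul.congr_of_eventuallyEq
    (Eventually.of_forall fun v => (toChart I v₀.proj v.proj).map_smul h (vec v))⟩

lemma extChartAt_fiberScaling (h : ℝ) (v₀ v : TangentBundle I M) :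
    extChartAt I.tangent v₀ (fiberScaling h v) =
      (ContinuousLinearMap.id ℝ E).prodMap (h • ContinuousLinearMap.id ℝ E)
        (extChartAt I.tangent v₀ v) :=
  Prod.ext rfl ((toChart I v₀.proj v.proj).map_smul h (vec v))

variable [I.Boundaryless]

lemma modelDeriv_fiberScaling (h : ℝ) (v : TangentBundle I M) :
    modelDeriv I.tangent I.tangent (fiberScaling h) v =
      (ContinuousLinearMap.id ℝ E).prodMap (h • ContinuousLinearMap.id ℝ E) := by
  have h_chart : extChartAt I.tangent (fiberScaling h v) ∘ fiberScaling h ∘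
      (extChartAt I.tangent v).symm =ᶠ[𝓝 (extChartAt I.tangent v v)]
        (ContinuousLinearMap.id ℝ E).prodMap (h • ContinuousLinearMap.id ℝ E) := by
    filter_upwards [extChartAt_target_mem_nhds (I := I.tangent) v] with y hy
    exact (extChartAt_fiberScaling h v _).trans (congrArg _ ((extChartAt I.tangent v).right_inv hy))
  rw [modelDeriv_eq_fderiv_inCharts ((contMDiff_fiberScaling h v).mdifferentiableAt (by simp))
    (mem_chart_source _ v) (mem_chart_source _ (fiberScaling h v)), h_chart.fderiv_eq,
    ContinuousLinearMap.fderiv, toChart_self, ofChart_self]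
  rfl

lemma isInvertible_modelDeriv_fiberScaling {h : ℝ} (hh : h ≠ 0) (v : TangentBundle I M) :
    (modelDeriv I.tangent I.tangent (fiberScaling h) v).IsInvertible := by
  rw [modelDeriv_fiberScaling]
  exact ⟨(ContinuousLinearEquiv.refl ℝ E).prodCongr
    (ContinuousLinearEquiv.smulLeft (Units.mk0 h hh)), rfl⟩

end FiberScaling

section LegendreLift

variable {E : Type*} [NormedAddCommGroup E] [NormedSpace ℝ E]
  {H : Type*} [TopologicalSpace H] {I : ModelWithCorners ℝ E H} [I.Boundaryless]
  {M : Type*} [TopologicalSpace M] [ChartedSpace H M] [IsManifold I ∞ M]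
  {L : TangentBundle I M → ℝ} {Γ : ∀ v : TangentBundle I M, TangentSpace I.tangent v}
  (hL : IsRegularLagrangian I L) (hΓ : IsEulerLagrangeField I L Γ)

include hL hΓ

lemma contMDiff_legendreLift [FiniteDimensional ℝ E] (h : ℝ) :
    ContMDiff I.tangent (cotangentModel I).tangent ∞ (legendreLift L Γ h) :=
  ((contMDiff_legendre hL.smooth).contMDiff_tangentMap (m := ∞) le_rfl).comp
    ((contMDiff_scaledField (contMDiff_eulerLagrangeField hL hΓ)).comp
      (contMDiff_const.prodMk contMDiff_id))

lemma liouvillePullback_tulczyjew_legendreLift (h : ℝ) (v : TangentBundle I M) :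
    liouvillePullback I.tangent (fun v => tulczyjew I (legendreLift L Γ h v)) v =
      modelDeriv I.tangent 𝓘(ℝ, ℝ) (h • L) v := by
  have h_proj : (fun v => (tulczyjew I (legendreLift L Γ h v)).proj) = fiberScaling h :=
    funext (tulczyjew_legendreLift_proj hL hΓ h)
  have hLd := (hL.smooth v).mdifferentiableAt (by simp)
  refine ContinuousLinearMap.ext fun Z => ?_
  have h_smul : modelDeriv I.tangent 𝓘(ℝ, ℝ) (h • L) v = h • modelDeriv I.tangent 𝓘(ℝ, ℝ) L v :=
    const_smul_mfderiv hLd h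
  rw [liouvillePullback, h_proj, modelDeriv_fiberScaling, ContinuousLinearMap.comp_apply,
    covec_tulczyjew_legendreLift hL hΓ, h_smul]
  exact (modelDeriv I.tangent 𝓘(ℝ, ℝ) L v).map_smul h Z

/-- The Euler–Lagrange equations say that `α_Q ∘ TFL ∘ h Γ` pulls the Liouville form of `T^*TQ` back
to the exact form `h dL`. -/
theorem canonicalForm_tulczyjew_legendreLift [FiniteDimensional ℝ E] (h : ℝ)
    (v : TangentBundle I M) (u w : E × E) :
    canonicalForm I.tangent (tulczyjew I (legendreLift L Γ h v))
      (modelDeriv I.tangent (cotangentModel I.tangent)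
        (fun v => tulczyjew I (legendreLift L Γ h v)) v u)
      (modelDeriv I.tangent (cotangentModel I.tangent)
        (fun v => tulczyjew I (legendreLift L Γ h v)) v w) = 0 :=
  canonicalForm_eq_zero_of_liouvillePullback_eq_deriv
    (contMDiff_tulczyjew.comp (contMDiff_legendreLift hL hΓ h) v)
    ((contDiff_const_smul h).contMDiff.comp hL.smooth v)
    (Eventually.of_forall (liouvillePullback_tulczyjew_legendreLift hL hΓ h)) u w

variable [FiniteDimensional ℝ E] {U : Set (TangentBundle I M)} {Rd : TangentBundle I M → M × M}
  (hRd : IsDiscretizationMap I U Rd) {h : ℝ} {y : TangentBundle I M}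
  (hy : legendreLift L Γ h y ∈ cotangentDiscretizationDomain I U Rd)
include hRd hy

lemma contMDiffAt_cotangentDiscretization_legendreLift :
    ContMDiffAt I.tangent ((cotangentModel I).prod (cotangentModel I)) ∞
      (fun y => cotangentDiscretization I Rd (legendreLift L Γ h y)) y :=
  have := FiniteDimensional.complete ℝ E
  (contMDiffAt_cotangentDiscretization hRd hy).comp y (contMDiff_legendreLift hL hΓ h y)

theorem canonicalForm_cotangentDiscretization_legendreLift (u w : E × E) :
    canonicalForm I (cotangentDiscretization I Rd (legendreLift L Γ h y)).2
        (modelDeriv I.tangent (cotangentModel I)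
          (fun y => (cotangentDiscretization I Rd (legendreLift L Γ h y)).2) y u)
        (modelDeriv I.tangent (cotangentModel I)
          (fun y => (cotangentDiscretization I Rd (legendreLift L Γ h y)).2) y w) =
      canonicalForm I (cotangentDiscretization I Rd (legendreLift L Γ h y)).1
        (modelDeriv I.tangent (cotangentModel I)
          (fun y => (cotangentDiscretization I Rd (legendreLift L Γ h y)).1) y u)
        (modelDeriv I.tangent (cotangentModel I)
          (fun y => (cotangentDiscretization I Rd (legendreLift L Γ h y)).1) y w) := by
  have := FiniteDimensional.complete ℝ E
  have h_disc := (contMDiffAt_cotangentDiscretization hRd hy).mdifferentiableAt (by simp)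
  have h_lift := (contMDiff_legendreLift hL hΓ h y).mdifferentiableAt (by simp)
  have h_fst := modelDeriv_comp h_disc.fst h_lift
  have h_snd := modelDeriv_comp h_disc.snd h_lift
  have h_tulczyjew := modelDeriv_comp ((contMDiff_tulczyjew _).mdifferentiableAt (n := ∞) (by simp))
    h_lift
  rw [← sub_eq_zero, ← canonicalForm_tulczyjew_legendreLift hL hΓ h y u w]
  refine (Eq.trans ?_ (canonicalForm_cotangentDiscretization hRd hy
    (modelDeriv I.tangent (cotangentModel I).tangent (legendreLift L Γ h) y u)
    (modelDeriv I.tangent (cotangentModel I).tangent (legendreLift L Γ h) y w))).trans ?_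
  · exact congrArg₂ (· - ·)
      (congrArg₂ (canonicalForm I _) (DFunLike.congr_fun h_snd u) (DFunLike.congr_fun h_snd w))
      (congrArg₂ (canonicalForm I _) (DFunLike.congr_fun h_fst u) (DFunLike.congr_fun h_fst w))
  · exact (congrArg₂ _ (DFunLike.congr_fun h_tulczyjew u) (DFunLike.congr_fun h_tulczyjew w)).symm

end LegendreLift

section Scheme

variable {E : Type*} [NormedAddCommGroup E] [NormedSpace ℝ E]
  {H : Type*} [TopologicalSpace H] {I : ModelWithCorners ℝ E H}
  {M : Type*} [TopologicalSpace M] [ChartedSpace H M] [IsManifold I ∞ M]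
  {U : Set (TangentBundle I M)} {Rd : TangentBundle I M → M × M}
  {L : TangentBundle I M → ℝ} {W : Set (TangentBundle I.tangent (TangentBundle I M))}
  {R : TangentBundle I.tangent (TangentBundle I M) → TangentBundle I M × TangentBundle I M}
  {Γ : ∀ v : TangentBundle I M, TangentSpace I.tangent v} {h : ℝ}
  {V : Set (TangentBundle I M)} {φ Y : TangentBundle I M → TangentBundle I M}
  {x : TangentBundle I M}

namespace IsLagrangianLift

lemma cotangentDiscretization_legendreLift (hR : IsLagrangianLift I L U Rd W R)
    {x₀ x₁ y : TangentBundle I M} (h_step : SchemeStep I.tangent Γ W R h x₀ x₁ y) :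
    cotangentDiscretization I Rd (legendreLift L Γ h y) = (legendre I L x₀, legendre I L x₁) := by
  refine (hR.isPullbackAt h_step.1).eventually_map_eq.self_of_nhds.symm.trans ?_
  rw [h_step.2]
  rfl

variable [I.Boundaryless] [FiniteDimensional ℝ E]
  (hRd : IsDiscretizationMap I U Rd) (hL : IsRegularLagrangian I L)
  (hR : IsLagrangianLift I L U Rd W R)

include hRd hL hR in
lemma eqOn_id_of_schemeStep_zero
    (h_step : ∀ x₀ ∈ V, SchemeStep I.tangent Γ W R 0 x₀ (φ x₀) (Y x₀)) : EqOn φ id V := by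
  intro x₀ hx₀
  have h_zero := (hR.isDiscretizationMap hRd hL).apply_scaledField_zero (Γ := Γ) (Y x₀)
  obtain ⟨h_fst, h_snd⟩ := Prod.ext_iff.1 ((h_step x₀ hx₀).2.symm.trans h_zero)
  exact h_snd.trans h_fst.symm

variable (hΓ : IsEulerLagrangeField I L Γ) (hV : IsOpen V)
  (hφ : ContMDiffOn I.tangent I.tangent ∞ φ V)
  (h_step : ∀ x₀ ∈ V, SchemeStep I.tangent Γ W R h x₀ (φ x₀) (Y x₀))
include hRd hL hR hΓ hV hφ h_step

lemma contMDiffAt_auxiliaryPoint (hh : h ≠ 0) (hY : ContinuousOn Y V) (hx : x ∈ V) :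
    ContMDiffAt I.tangent I.tangent ∞ Y x := by
  have := FiniteDimensional.complete ℝ E
  have h_domain {x₀} (hx₀ : x₀ ∈ V) : fiberScaling h (Y x₀) ∈ U ∧
      (modelDeriv I.tangent (I.prod I) Rd (fiberScaling h (Y x₀))).IsInvertible := by
    have h_proj : (tulczyjew I (legendreLift L Γ h (Y x₀))).proj = fiberScaling h (Y x₀) :=
      tulczyjew_legendreLift_proj hL hΓ h (Y x₀)
    rw [← h_proj]
    exact hR.mem_domain _ (h_step x₀ hx₀).1
  have h_scaling := contMDiff_fiberScaling (I := I) (M := M) h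
  have h_base : Rd ∘ fiberScaling h ∘ Y =ᶠ[𝓝 x] fun x₀ => (x₀.proj, (φ x₀).proj) := by
    filter_upwards [hV.mem_nhds hx] with x₀ hx₀
    have h_eq := hR.cotangentDiscretization_legendreLift (h_step x₀ hx₀)
    have h_proj := congrArg (Prod.map TotalSpace.proj TotalSpace.proj) h_eq
    exact (congrArg Rd (tulczyjew_legendreLift_proj hL hΓ h (Y x₀))).symm.trans h_proj
  have h_smooth : ContMDiffAt I.tangent (I.prod I) ∞
      (fun x₀ : TangentBundle I M => (x₀.proj, (φ x₀).proj)) x :=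
    (contMDiffAt_proj _).prodMk
      ((contMDiffAt_proj _).comp x (hφ.contMDiffAt (hV.mem_nhds hx)))
  have hYx := hY.continuousAt (hV.mem_nhds hx)
  refine contMDiffAt_of_contMDiffAt_comp isOpen_univ h_scaling.contMDiffOn (mem_univ _)
    (isInvertible_modelDeriv_fiberScaling hh _) hYx ?_
  exact contMDiffAt_of_contMDiffAt_comp hRd.isOpen hRd.smooth (h_domain hx).1 (h_domain hx).2
    (h_scaling.continuous.continuousAt.comp hYx) (h_smooth.congr_of_eventuallyEq h_base)

lemma lagrangeForm_eq_of_contMDiffAt (hx : x ∈ V) (hY : ContMDiffAt I.tangent I.tangent ∞ Y x)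
    (u w : E × E) :
    lagrangeForm I L (φ x) (modelDeriv I.tangent I.tangent φ x u)
      (modelDeriv I.tangent I.tangent φ x w) = lagrangeForm I L x u w := by
  have h_domain := hR.mem_domain _ (h_step x hx).1
  have hGd := (contMDiffAt_cotangentDiscretization_legendreLift hL hΓ hRd
    h_domain).mdifferentiableAt (by simp)
  have hYx := hY.mdifferentiableAt (by simp)
  have hφx := (hφ.contMDiffAt (hV.mem_nhds hx)).mdifferentiableAt (by simp)
  have hFLx := (contMDiff_legendre hL.smooth (φ x)).mdifferentiableAt (by simp)
  have h_eq : ∀ᶠ x₀ in 𝓝 x, cotangentDiscretization I Rd (legendreLift L Γ h (Y x₀)) =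
      (legendre I L x₀, legendre I L (φ x₀)) :=
    (hV.eventually_mem hx).mono fun x₀ hx₀ =>
      hR.cotangentDiscretization_legendreLift (h_step x₀ hx₀)
  have h_fst (u : E × E) : modelDeriv I.tangent (cotangentModel I)
      (fun y => (cotangentDiscretization I Rd (legendreLift L Γ h y)).1) (Y x)
        (modelDeriv I.tangent I.tangent Y x u) =
      modelDeriv I.tangent (cotangentModel I) (legendre I L) x u := by
    rw [← modelDeriv_congr (h_eq.mono fun _ => congrArg Prod.fst)]
    exact (DFunLike.congr_fun (modelDeriv_comp hGd.fst hYx) u).symm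
  have h_snd (u : E × E) : modelDeriv I.tangent (cotangentModel I)
      (fun y => (cotangentDiscretization I Rd (legendreLift L Γ h y)).2) (Y x)
        (modelDeriv I.tangent I.tangent Y x u) =
      modelDeriv I.tangent (cotangentModel I) (legendre I L) (φ x)
        (modelDeriv I.tangent I.tangent φ x u) :=
    (DFunLike.congr_fun (modelDeriv_comp hGd.snd hYx) u).symm.trans
      ((DFunLike.congr_fun (modelDeriv_congr (h_eq.mono fun _ => congrArg Prod.snd)) u).trans
        (DFunLike.congr_fun (modelDeriv_comp hFLx hφx) u))
  have h_form := canonicalForm_cotangentDiscretization_legendreLift hL hΓ hRd h_domain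
    (modelDeriv I.tangent I.tangent Y x u) (modelDeriv I.tangent I.tangent Y x w)
  rw [h_fst, h_fst, h_snd, h_snd, canonicalForm_apply, canonicalForm_apply] at h_form
  exact (canonicalForm_apply _ _ _).trans (h_form.trans (canonicalForm_apply _ _ _).symm)

lemma preservesForm (hY : ContinuousOn Y V) : PreservesForm I.tangent (lagrangeForm I L) V φ := by
  intro x hx u w
  rcases eq_or_ne h 0 with rfl | hh
  · have h_id := (hR.eqOn_id_of_schemeStep_zero hRd hL h_step).eventuallyEq_of_mem (hV.mem_nhds hx)
    change lagrangeForm I L (φ x) (modelDeriv I.tangent I.tangent φ x u)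
      (modelDeriv I.tangent I.tangent φ x w) = _
    rw [modelDeriv_congr h_id, h_id.self_of_nhds, modelDeriv_id]
    rfl
  · exact lagrangeForm_eq_of_contMDiffAt hRd hL hR hΓ hV hφ h_step hx
      (contMDiffAt_auxiliaryPoint hRd hL hR hΓ hV hφ h_step hh hY hx) u w

omit hΓ hV hφ h_step in
theorem isSymplecticScheme (hΓ : IsEulerLagrangeField I L Γ) :
    IsSymplecticScheme I.tangent (lagrangeForm I L) Γ W R :=
  fun _ _ _ _ hV hφ hY h_step => preservesForm hRd hL hR hΓ hV hφ h_step hY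

end IsLagrangianLift

end Scheme

/-! ### Existence of the lift -/

section Gluing

variable {X Y : Type*} [TopologicalSpace X] [TopologicalSpace Y]

lemma exists_isOpen_mem_eventually_subset [ParacompactSpace X] [NormalSpace X] {O : X → Set X}
    (hO : ∀ x, IsOpen (O x)) (h_mem : ∀ x, x ∈ O x) :
    ∃ N : X → Set X, (∀ x, IsOpen (N x)) ∧ (∀ x, x ∈ N x) ∧ (∀ x, ∃ y, N x ⊆ O y) ∧
      ∀ x, ∀ᶠ x' in 𝓝 x, N x ⊆ N x' := by
  obtain ⟨V, hV, hV_cover, hV_finite, hVO⟩ := precise_refinement O hO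
    (iUnion_eq_univ_iff.2 fun x => ⟨x, h_mem x⟩)
  obtain ⟨C, hC_cover, hC, hCV⟩ := exists_iUnion_eq_closed_subset hV hV_finite.point_finite hV_cover
  have hC_finite : LocallyFinite C := hV_finite.subset hCV
  refine ⟨fun x => ⋂ i ∈ {i | x ∈ C i}, V i,
    fun x => (hC_finite.point_finite x).isOpen_biInter fun i _ => hV i,
    fun x => mem_iInter₂.2 fun i hi => hCV i hi, fun x => ?_, fun x => ?_⟩
  · obtain ⟨i, hi⟩ := iUnion_eq_univ_iff.1 hC_cover x
    exact ⟨i, (iInter₂_subset (s := fun i _ => V i) i hi).trans (hVO i)⟩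
  · filter_upwards [hC_finite.iInter_compl_mem_nhds hC x] with x' hx'
    refine biInter_subset_biInter_left fun i hi => ?_
    by_contra h
    exact mem_iInter₂.1 hx' i h hi

lemma mem_target_and_symm_eq_of_source_subset {σ τ : OpenPartialHomeomorph X Y}
    (h_source : σ.source ⊆ τ.source) (h_eq : EqOn τ σ σ.source) {y : Y} (hy : y ∈ σ.target) :
    y ∈ τ.target ∧ τ.symm y = σ.symm y := by
  have h_mem := h_source (σ.map_target hy)
  have hτ : τ (σ.symm y) = y := (h_eq (σ.map_target hy)).trans (σ.right_inv hy)
  exact ⟨(congrArg (· ∈ τ.target) hτ).mp (τ.map_source h_mem),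
    (congrArg τ.symm hτ).symm.trans (τ.left_inv h_mem)⟩

lemma exists_localInverse_eventually_eq [ParacompactSpace X] [NormalSpace X] {f : X → Y}
    (hf : IsLocalHomeomorph f) :
    ∃ σ : X → OpenPartialHomeomorph X Y, (∀ x, x ∈ (σ x).source) ∧ (∀ x, ⇑(σ x) = f) ∧
      ∀ x, ∀ᶠ x' in 𝓝 x, ∀ y ∈ (σ x).target, y ∈ (σ x').target ∧ (σ x').symm y = (σ x).symm y := by
  choose τ hτ_mem hτ using hf
  obtain ⟨N, hN, hN_mem, hN_subset, hN_mono⟩ := exists_isOpen_mem_eventually_subset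
    (fun x => (τ x).open_source) hτ_mem
  choose c hc using hN_subset
  refine ⟨fun x => (τ (c x)).restrOpen (N x) (hN x), fun x => ⟨hc x (hN_mem x), hN_mem x⟩,
    fun x => (hτ (c x)).symm, fun x => ?_⟩
  filter_upwards [hN_mono x] with x' h_subset y hy
  exact mem_target_and_symm_eq_of_source_subset
    (σ := (τ (c x)).restrOpen (N x) (hN x)) (τ := (τ (c x')).restrOpen (N x') (hN x'))
    (fun z hz => ⟨hc x' (h_subset hz.2), h_subset hz.2⟩)
    (fun z _ => congrFun ((hτ (c x')).symm.trans (hτ (c x))) z) hy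

end Gluing

section Pullback

variable {E : Type*} [NormedAddCommGroup E] [NormedSpace ℝ E]
  {H : Type*} [TopologicalSpace H] {I : ModelWithCorners ℝ E H}
  {M : Type*} [TopologicalSpace M] [ChartedSpace H M] [IsManifold I ∞ M]
  {F : Type*} [NormedAddCommGroup F] [NormedSpace ℝ F]
  {G : Type*} [TopologicalSpace G] {J : ModelWithCorners ℝ F G}
  {N : Type*} [TopologicalSpace N] [ChartedSpace G N] [IsManifold J ∞ N]

theorem IsDiscretizationMap.exists_isPullbackAt [ParacompactSpace M] [NormalSpace M] {f : M → N}
    {V : Set (TangentBundle J N)} {S : TangentBundle J N → N × N} (h : IsDiscretizationMap J V S)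
    (hf : ContMDiff I J ∞ f) (hf_homeo : IsLocalHomeomorph f) :
    ∃ (W : Set (TangentBundle I M)) (R : TangentBundle I M → M × M), IsOpen W ∧
      (∀ x, (⟨x, 0⟩ : TangentBundle I M) ∈ W) ∧ MapsTo (tangentMap I J f) W V ∧
      ∀ w ∈ W, IsPullbackAt I J f S R w := by
  obtain ⟨σ, h_mem, hσ, h_glue⟩ := exists_localInverse_eventually_eq hf_homeo
  have hTf : Continuous (tangentMap I J f) :=
    (hf.contMDiff_tangentMap (m := ∞) le_rfl).continuous
  have h_ev {w : TangentBundle I M} (hw : tangentMap I J f w ∈ V)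
      (h₁ : (S (tangentMap I J f w)).1 ∈ (σ w.proj).target)
      (h₂ : (S (tangentMap I J f w)).2 ∈ (σ w.proj).target) :
      ∀ᶠ w' in 𝓝 w, tangentMap I J f w' ∈ V ∧
        ((S (tangentMap I J f w')).1 ∈ (σ w.proj).target ∧
          (S (tangentMap I J f w')).2 ∈ (σ w.proj).target) ∧
        ∀ y ∈ (σ w.proj).target,
          y ∈ (σ w'.proj).target ∧ (σ w'.proj).symm y = (σ w.proj).symm y := by
    have hS := (h.contMDiffAt hw).continuousAt.comp hTf.continuousAt
    have h_target := (σ w.proj).open_target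
    exact (hTf.continuousAt.eventually (h.isOpen.eventually_mem hw)).and
      (((hS.fst.eventually (h_target.eventually_mem h₁)).and
        (hS.snd.eventually (h_target.eventually_mem h₂))).and
        ((FiberBundle.continuous_proj E (TangentSpace I)).continuousAt.eventually
          (h_glue w.proj)))
  refine ⟨{w | tangentMap I J f w ∈ V ∧ (S (tangentMap I J f w)).1 ∈ (σ w.proj).target ∧
    (S (tangentMap I J f w)).2 ∈ (σ w.proj).target}, fun w =>
      ((σ w.proj).symm (S (tangentMap I J f w)).1, (σ w.proj).symm (S (tangentMap I J f w)).2),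
    isOpen_iff_mem_nhds.2 fun w ⟨hw, h₁, h₂⟩ => ?_, fun x => ?_,
    fun w hw => hw.1, fun w hw => ⟨σ w.proj, h_mem _, fun x _ => congrFun (hσ _) x, ?_⟩⟩
  · filter_upwards [h_ev hw h₁ h₂] with w' ⟨hw', ⟨h₁', h₂'⟩, h_eq⟩
    exact ⟨hw', (h_eq _ h₁').1, (h_eq _ h₂').1⟩
  · have h_zero : tangentMap I J f ⟨x, 0⟩ = ⟨f x, 0⟩ :=
      congrArg (TotalSpace.mk (f x)) (_root_.map_zero (modelDeriv I J f x))
    have h_target : f x ∈ (σ x).target := congrFun (hσ x) x ▸ (σ x).map_source (h_mem x)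
    rw [mem_ofPred_eq, h_zero, h.map_zero]
    exact ⟨h.zero_mem _, h_target, h_target⟩
  · filter_upwards [h_ev hw.1 hw.2.1 hw.2.2] with w' ⟨_, ⟨h₁', h₂'⟩, h_eq⟩
    exact ⟨h₁', h₂', Prod.ext (h_eq _ h₁').2 (h_eq _ h₂').2⟩

end Pullback

section Topology

variable {B F : Type*} [TopologicalSpace B] [TopologicalSpace F] (V : B → Type*)
  [TopologicalSpace (TotalSpace F V)] [∀ b, TopologicalSpace (V b)] [FiberBundle F V]

lemma t2Space_totalSpace [T2Space B] [T2Space F] : T2Space (TotalSpace F V) := by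
  refine ⟨fun v w hvw => ?_⟩
  by_cases h : v.proj = w.proj
  · have hv := FiberBundle.mem_trivializationAt_proj_source (F := F) (x := v)
    have hw : w ∈ (trivializationAt F V v.proj).source := by
      rw [Trivialization.mem_source, ← h]
      exact FiberBundle.mem_baseSet_trivializationAt F V v.proj
    have h_source : T2Space (trivializationAt F V v.proj).source :=
      T2Space.of_injective_continuous (trivializationAt F V v.proj).injOn.injective
        (trivializationAt F V v.proj).continuousOn.domRestrict
    have h_ne : (⟨v, hv⟩ : (trivializationAt F V v.proj).source) ≠ ⟨w, hw⟩ :=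
      fun h_eq => hvw (congrArg Subtype.val h_eq)
    exact separated_by_isOpenEmbedding
      (trivializationAt F V v.proj).open_source.isOpenEmbedding_subtypeVal h_ne
  · exact separated_by_continuous (FiberBundle.continuous_proj F V) h

end Topology

section TangentBundle

variable {E : Type*} [NormedAddCommGroup E] [NormedSpace ℝ E] [FiniteDimensional ℝ E]
  {H : Type*} [TopologicalSpace H] (I : ModelWithCorners ℝ E H)
  (M : Type*) [TopologicalSpace M] [ChartedSpace H M] [IsManifold I 1 M]

lemma secondCountableTopology_tangentBundle [SecondCountableTopology M] :
    SecondCountableTopology (TangentBundle I M) := by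
  have : SecondCountableTopology H := I.secondCountableTopology
  have : SecondCountableTopology (ModelProd H E) :=
    inferInstanceAs (SecondCountableTopology (H × E))
  obtain ⟨s, hs, h_cover⟩ := TopologicalSpace.countable_cover_nhds
    (fun q : M => chart_source_mem_nhds H q)
  refine ChartedSpace.secondCountable_of_countable_cover (ModelProd H E)
    (s := (fun q : M => (⟨q, 0⟩ : TangentBundle I M)) '' s) (eq_univ_of_forall fun v => ?_)
    (hs.image _)
  obtain ⟨q, hq, hqv⟩ := mem_iUnion₂.1 (h_cover.symm ▸ mem_univ v.proj : v.proj ∈ ⋃ x ∈ s, _)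
  exact mem_iUnion₂.2 ⟨_, mem_image_of_mem _ hq, (TangentBundle.mem_chart_source_iff _ _).2 hqv⟩

lemma paracompactSpace_tangentBundle [T2Space M] [SecondCountableTopology M] :
    ParacompactSpace (TangentBundle I M) := by
  have : T2Space (TangentBundle I M) := t2Space_totalSpace (TangentSpace I)
  have : SecondCountableTopology (TangentBundle I M) := secondCountableTopology_tangentBundle I M
  have : LocallyCompactSpace (TangentBundle I M) :=
    Manifold.locallyCompact_of_finiteDimensional I.tangent
  infer_instance

end TangentBundle

section Existence

variable {E : Type*} [NormedAddCommGroup E] [NormedSpace ℝ E] [FiniteDimensional ℝ E]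
  {H : Type*} [TopologicalSpace H] {I : ModelWithCorners ℝ E H} [I.Boundaryless]
  {M : Type*} [TopologicalSpace M] [ChartedSpace H M] [IsManifold I ∞ M]
  {U : Set (TangentBundle I M)} {Rd : TangentBundle I M → M × M} {L : TangentBundle I M → ℝ}

lemma isLocalHomeomorph_legendre (hL : IsRegularLagrangian I L) :
    IsLocalHomeomorph (legendre I L) := by
  have := FiniteDimensional.complete ℝ E
  refine IsLocalHomeomorph.mk _ fun v => ?_
  obtain ⟨σ, hv, -, hσ, -⟩ := exists_openPartialHomeomorph_eqOn isOpen_univ (mem_univ v)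
    (contMDiff_legendre hL.smooth).contMDiffOn (isInvertible_modelDeriv_legendre hL v)
  exact ⟨σ, hv, hσ.symm⟩

theorem exists_isLagrangianLift [T2Space M] [SecondCountableTopology M]
    (hRd : IsDiscretizationMap I U Rd) (hL : IsRegularLagrangian I L) :
    ∃ W R, IsLagrangianLift I L U Rd W R := by
  have := FiniteDimensional.complete ℝ E
  have : T2Space (TangentBundle I M) := t2Space_totalSpace (TangentSpace I)
  have := paracompactSpace_tangentBundle I M
  obtain ⟨W, R, hW, h_zero, h_maps, hR⟩ := hRd.cotangentDiscretization.exists_isPullbackAt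
    (contMDiff_legendre hL.smooth) (isLocalHomeomorph_legendre hL)
  exact ⟨W, R, hW, h_zero, h_maps, hR⟩

end Existence

end DiscMap

end

theorem mainTheorem5_general {E : Type*} [NormedAddCommGroup E] [NormedSpace ℝ E]
    [FiniteDimensional ℝ E] {H : Type*} [TopologicalSpace H]
    (I : ModelWithCorners ℝ E H) [I.Boundaryless]
    {Q : Type*} [TopologicalSpace Q] [ChartedSpace H Q] [IsManifold I ∞ Q]
    [T2Space Q] [SecondCountableTopology Q]
    (U : Set (TangentBundle I Q)) (Rd : TangentBundle I Q → Q × Q)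
    (hRd : DiscMap.IsDiscretizationMap I U Rd)
    (L : TangentBundle I Q → ℝ) (hL : DiscMap.IsRegularLagrangian I L) :
    (∃! Γ, DiscMap.IsEulerLagrangeField I L Γ) ∧
    (∃ W R, DiscMap.IsLagrangianLift I L U Rd W R) ∧
    ∀ W R, DiscMap.IsLagrangianLift I L U Rd W R →
      (∀ Γ, DiscMap.IsEulerLagrangeField I L Γ →
        DiscMap.IsIntegrator I.tangent Γ W R ∧
        DiscMap.IsSymplecticScheme I.tangent (DiscMap.lagrangeForm I L) Γ W R) ∧
      DiscMap.IsDiscretizationMap I.tangent W R := by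
  have := FiniteDimensional.complete ℝ E
  refine ⟨DiscMap.existsUnique_eulerLagrangeField hL, DiscMap.exists_isLagrangianLift hRd hL,
    fun W R hR => ?_⟩
  have h_disc : DiscMap.IsDiscretizationMap I.tangent W R := hR.isDiscretizationMap hRd hL
  refine ⟨fun Γ hΓ => ⟨?_, ?_⟩, h_disc⟩
  · exact h_disc.isIntegrator (DiscMap.contMDiff_eulerLagrangeField hL hΓ)
  · exact hR.isSymplecticScheme hRd hL hΓ

theorem mainTheorem5 {E : Type*} [NormedAddCommGroup E] [NormedSpace ℝ E] [FiniteDimensional ℝ E]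
    {Q : Type*} [TopologicalSpace Q] [ChartedSpace E Q] [IsManifold 𝓘(ℝ, E) ∞ Q]
    [T2Space Q] [SecondCountableTopology Q]
    (U : Set (TangentBundle 𝓘(ℝ, E) Q)) (Rd : TangentBundle 𝓘(ℝ, E) Q → Q × Q)
    (hRd : DiscMap.IsDiscretizationMap 𝓘(ℝ, E) U Rd)
    (L : TangentBundle 𝓘(ℝ, E) Q → ℝ) (hL : DiscMap.IsRegularLagrangian 𝓘(ℝ, E) L) :
    (∃! Γ, DiscMap.IsEulerLagrangeField 𝓘(ℝ, E) L Γ) ∧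
    (∃ W R, DiscMap.IsLagrangianLift 𝓘(ℝ, E) L U Rd W R) ∧
    ∀ W R, DiscMap.IsLagrangianLift 𝓘(ℝ, E) L U Rd W R →
      (∀ Γ, DiscMap.IsEulerLagrangeField 𝓘(ℝ, E) L Γ →
        DiscMap.IsIntegrator 𝓘(ℝ, E).tangent Γ W R ∧
        DiscMap.IsSymplecticScheme 𝓘(ℝ, E).tangent (DiscMap.lagrangeForm 𝓘(ℝ, E) L) Γ W R) ∧
      DiscMap.IsDiscretizationMap 𝓘(ℝ, E).tangent W R :=
  mainTheorem5_general 𝓘(ℝ, E) U Rd hRd L hL
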